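/- Let $\Omega\subset\mathbb{R}^3$ be a bounded domain with $C^\infty$ boundary and outward unit normal $\nu$. For $0<\alpha<\beta<\infty$ let $\mathcal{M}_{\mathbb{C}}(\alpha,\beta;\Omega)$ be the set of measurable complex $3\times 3$ matrix-valued functions $A$ on $\Omega$ such that, for a.e. $x\in\Omega$ and all $\xi\in\mathbb{C}^3$, $$-\mathrm{i}\,\xi\cdot\bigl(A(x)-A(x)^{\dagger}\bigr)\overline{\xi}\ \ge\ \alpha|\xi|^2,\qquad |A(x)\xi|\le\beta|\xi|,$$ where $A^\dagger$ is the Hermitian conjugate of $A$ and $\cdot$ is the bilinear product. Let $H(\mathrm{curl},\Omega)=\{u\in L^2(\Omega)^3:\nabla\times u\in L^2(\Omega)^3\}$ (complex fields, weak curl), with $\|u\|_{H(\mathrm{curl},\Omega)}^2=\|u\|_{L^2}^2+\|\nabla\times u\|_{L^2}^2$. Let $H^{-1/2}(\partial\Omega)$ be the dual of $H^{1/2}(\partial\Omega)$, the latter with the Sobolev–Slobodeckij norm, and let $H^{-1/2}(\mathrm{div},\partial\Omega)$ be the space of tangential fields $f\in H^{-1/2}(\partial\Omega)^3$ whose surface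 divergence $\mathrm{Div}_{\partial\Omega}f$ lies in $H^{-1/2}(\partial\Omega)$, with $\|f\|^2_{H^{-1/2}(\mathrm{div},\partial\Omega)}=\|f\|^2_{H^{-1/2}}+\|\mathrm{Div}_{\partial\Omega}f\|^2_{H^{-1/2}}$. For $u\in H(\mathrm{curl},\Omega)$ the tangential trace $\nu\times u|_{\partial\Omega}$ is understood in the weak sense, i.e. as the functional $\Phi\mapsto\int_\Omega\bigl((\nabla\times u)\cdot\Phi-u\cdot(\nabla\times\Phi)\bigr)\,dx$ on fields $\Phi\in C^\infty(\overline\Omega)^3$. **Proposition.** Let $0<\alpha<\beta<\infty$ and $\omega>0$. There is a constant $C>0$, depending only on $\Omega,\alpha,\beta,\omega$, such that for all $\epsilon,\mu\in\mathcal{M}_{\mathbb{C}}(\alpha,\beta;\Omega)$ and all $f\in H^{-1/2}(\mathrm{div},\partial\Omega)$ the Maxwell system $$\nabla\times E=\mathrm{i}\omega\mu H,\qquad \nabla\times H=-\mathrm{i}\omega\epsilon E\quad\text{in }\Omega,\qquad \nu\times E|_{\partial\Omega}=f$$ has a unique solution $(E,H)\in H(\mathrm{curl},\Omega)\times H(\mathrm{curl},\Omega)$,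 and this solution satisfies $$\|E\|_{H(\mathrm{curl},\Omega)}+\|H\|_{H(\mathrm{curl},\Omega)}\le C\,\|f\|_{H^{-1/2}(\mathrm{div},\partial\Omega)}.$$ -/

import Mathlib

open MeasureTheory Filter Topology
open scoped ENNReal

noncomputable section

namespace Maxwell

/-- Three-dimensional real Euclidean space. -/
abbrev R3 := EuclideanSpace ℝ (Fin 3)

/-- `ℂ³` with its Hermitian norm. -/
abbrev C3 := EuclideanSpace ℂ (Fin 3)

section

open scoped ContDiff

/-! ### Vector calculus in `ℝ³` -/

/-- The bilinear (not sesquilinear) product `u · v = ∑ⱼ uⱼ vⱼ` on `ℂ³`. -/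
def dot (u v : C3) : ℂ := ∑ j, u j * v j

/-- The partial derivative `∂ⱼ F (x)`. -/
def partialDeriv {F : Type*} [NormedAddCommGroup F] [NormedSpace ℝ F]
    (j : Fin 3) (f : R3 → F) (x : R3) : F :=
  fderiv ℝ f x (EuclideanSpace.single j 1)

/-- The gradient of a complex-valued function on `ℝ³`. -/
def grad (G : R3 → ℂ) (x : R3) : C3 := WithLp.toLp 2 fun j => partialDeriv j G x

/-- The classical curl of a differentiable complex vector field on `ℝ³`. -/
def classicalCurl (Φ : R3 → C3) (x : R3) : C3 :=
  !₂[partialDeriv 1 Φ x 2 - partialDeriv 2 Φ x 1,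
     partialDeriv 2 Φ x 0 - partialDeriv 0 Φ x 2,
     partialDeriv 0 Φ x 1 - partialDeriv 1 Φ x 0]

/-! ### Smooth bounded domains and the outward unit normal -/

/-- `ρ` is a smooth defining function of `Ω` on the neighbourhood `U` of the point `x`:
`Ω ∩ U = {ρ < 0} ∩ U` and `∇ρ(x) ≠ 0`. -/
structure IsLocalDefiningFunction (Ω : Set R3) (x : R3) (U : Set R3) (ρ : R3 → ℝ) : Prop where
  mem_nhds : U ∈ 𝓝 x
  smooth : ContDiff ℝ ∞ ρ
  gradient_ne_zero : gradient ρ x ≠ 0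
  mem_iff : ∀ y ∈ U, y ∈ Ω ↔ ρ y < 0

/-- A bounded domain (nonempty connected open set) with `C^∞` boundary. -/
structure IsSmoothBoundedDomain (Ω : Set R3) : Prop where
  isOpen : IsOpen Ω
  isConnected : IsConnected Ω
  isBounded : Bornology.IsBounded Ω
  smooth_boundary : ∀ x ∈ frontier Ω, ∃ U ρ, IsLocalDefiningFunction Ω x U ρ

/-- `n` is the outward unit normal of `Ω` at the boundary point `x`, that is,
`n = ∇ρ(x) / |∇ρ(x)|` for a local defining function `ρ`. -/
def IsOutwardUnitNormal (Ω : Set R3) (x n : R3) : Prop :=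
  ‖n‖ = 1 ∧ ∃ U ρ, IsLocalDefiningFunction Ω x U ρ ∧ ∃ c : ℝ, 0 < c ∧ gradient ρ x = c • n

theorem eventually_pos_of_gradient {ρ : R3 → ℝ} {x v : R3} (hρ : DifferentiableAt ℝ ρ x)
    (h0 : ρ x = 0) (hv : 0 < inner ℝ (gradient ρ x) v) :
    ∀ᶠ t in 𝓝[>] (0 : ℝ), 0 < ρ (x + t • v) := by
  have h1 : HasDerivAt (fun t : ℝ => ρ (x + t • v)) (inner ℝ (gradient ρ x) v) 0 := by
    have h2 : HasFDerivAt ρ (InnerProductSpace.toDual ℝ R3 (gradient ρ x)) (x + (0 : ℝ) • v) := by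
      simpa using hρ.hasGradientAt.hasFDerivAt
    have h3 : HasDerivAt (fun t : ℝ => x + t • v) v 0 := by
      simpa using ((hasDerivAt_id (0 : ℝ)).smul_const v).const_add x
    have h4 := h2.comp_hasDerivAt (0 : ℝ) h3
    rw [InnerProductSpace.toDual_apply_apply] at h4
    exact h4
  have h4 := h1.tendsto_slope
  have h5 : ∀ᶠ t in 𝓝[≠] (0 : ℝ), 0 < slope (fun t : ℝ => ρ (x + t • v)) 0 t :=
    h4.eventually (lt_mem_nhds hv)
  have h6 : ∀ᶠ t in 𝓝[>] (0 : ℝ), 0 < slope (fun t : ℝ => ρ (x + t • v)) 0 t :=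
    h5.filter_mono (nhdsWithin_mono _ fun t ht => ne_of_gt ht)
  filter_upwards [h6, self_mem_nhdsWithin] with t ht htpos
  have htpos' : 0 < t := htpos
  simp only [slope, sub_zero, zero_smul, add_zero, h0, vsub_eq_sub, smul_eq_mul] at ht
  exact (mul_pos_iff_of_pos_left (inv_pos.mpr htpos')).mp ht

theorem IsLocalDefiningFunction.eq_zero {Ω : Set R3} {x : R3} {U : Set R3} {ρ : R3 → ℝ}
    (h : IsLocalDefiningFunction Ω x U ρ) (hΩ : IsOpen Ω) (hx : x ∈ frontier Ω) : ρ x = 0 := by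
  have hxU : x ∈ U := mem_of_mem_nhds h.mem_nhds
  apply le_antisymm
  · by_contra! hpos
    have h1 : ∀ᶠ y in 𝓝 x, 0 < ρ y := h.smooth.continuous.continuousAt.eventually (lt_mem_nhds hpos)
    have h2 : ∃ᶠ y in 𝓝 x, y ∈ Ω := mem_closure_iff_frequently.mp hx.1
    obtain ⟨y, hyΩ, hy, hyU⟩ := (h2.and_eventually (h1.and h.mem_nhds)).exists
    exact absurd ((h.mem_iff y hyU).mp hyΩ) (not_lt.mpr hy.le)
  · by_contra! hneg
    have : x ∈ Ω := (h.mem_iff x hxU).mpr hneg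
    exact hx.2 (hΩ.interior_eq.symm ▸ this)

/-- The outward unit normal does not depend on the defining function. -/
theorem IsOutwardUnitNormal.unique {Ω : Set R3} (hΩ : IsOpen Ω) {x m n : R3}
    (hx : x ∈ frontier Ω) (hm : IsOutwardUnitNormal Ω x m) (hn : IsOutwardUnitNormal Ω x n) :
    m = n := by
  obtain ⟨hm1, U, ρ, hρ, c, hc, hcm⟩ := hm
  obtain ⟨hn1, V, σ, hσ, d, hd, hdn⟩ := hn
  by_contra hne
  have hlt : inner ℝ m n < 1 := (inner_lt_one_iff_real_of_norm_eq_one hm1 hn1).mpr hne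
  have hmm : inner ℝ m m = (1 : ℝ) := by rw [real_inner_self_eq_norm_sq, hm1]; norm_num
  have hnn : inner ℝ n n = (1 : ℝ) := by rw [real_inner_self_eq_norm_sq, hn1]; norm_num
  have hnm : inner ℝ n m = inner ℝ m n := real_inner_comm _ _
  have e1 := eventually_pos_of_gradient (v := n - m)
    (hσ.smooth.differentiable (by simp) x) (hσ.eq_zero hΩ hx) (by
      rw [hdn, real_inner_smul_left, inner_sub_right, hnn, hnm]
      exact mul_pos hd (by linarith))
  have hgrad : gradient (fun y => -ρ y) x = -gradient ρ x := by
    simp [gradient, fderiv_fun_neg]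
  have e2 := eventually_pos_of_gradient (ρ := fun y => -ρ y) (v := n - m)
    (hρ.smooth.differentiable (by simp) x).neg (by simp [hρ.eq_zero hΩ hx]) (by
      rw [hgrad, hcm, inner_neg_left, real_inner_smul_left, inner_sub_right, hmm]
      nlinarith)
  have hcont : Tendsto (fun t : ℝ => x + t • (n - m)) (𝓝[>] 0) (𝓝 x) := by
    have : Continuous fun t : ℝ => x + t • (n - m) := by fun_prop
    simpa using (this.tendsto 0).mono_left nhdsWithin_le_nhds
  obtain ⟨t, h1, h2, h3, h4⟩ :=
    (e1.and (e2.and ((hcont.eventually hρ.mem_nhds).and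
      (hcont.eventually hσ.mem_nhds)))).exists
  have hin := (hρ.mem_iff _ h3).mpr (by simpa using h2)
  exact absurd ((hσ.mem_iff _ h4).mp hin) (not_lt.mpr h1.le)

open Classical in
/-- The outward unit normal field `ν` on `∂Ω`. -/
def outwardNormal (Ω : Set R3) (x : R3) : R3 :=
  if h : ∃ n, IsOutwardUnitNormal Ω x n then h.choose else 0

/-- The outward unit normal, viewed in `ℂ³`. -/
def outwardNormalC (Ω : Set R3) (x : R3) : C3 :=
  WithLp.toLp 2 fun j => (outwardNormal Ω x j : ℂ)

/-! ### The space `H(curl, Ω)` -/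

/-- The space `L²(Ω)³` of complex vector fields. -/
abbrev L2 (Ω : Set R3) := Lp C3 2 (volume.restrict Ω)

/-- `v` is the weak curl of `u` in `Ω`. -/
def HasWeakCurl (Ω : Set R3) (u v : L2 Ω) : Prop :=
  ∀ φ : R3 → C3, ContDiff ℝ ∞ φ → HasCompactSupport φ → tsupport φ ⊆ Ω →
    ∫ x in Ω, dot (u x) (classicalCurl φ x) = ∫ x in Ω, dot (v x) (φ x)

/-- `H(curl, Ω)`: the fields in `L²(Ω)³` whose weak curl is in `L²(Ω)³`. -/
def Hcurl (Ω : Set R3) : Set (L2 Ω) := {u | ∃ v : L2 Ω, HasWeakCurl Ω u v}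

/-- The weak curl of an element of `H(curl, Ω)`. -/
def curl {Ω : Set R3} (u : Hcurl Ω) : L2 Ω := u.2.choose

/-- The norm `‖u‖_{H(curl)} = (‖u‖² + ‖∇ × u‖²)^{1/2}`. -/
def hcurlNorm {Ω : Set R3} (u : Hcurl Ω) : ℝ := √(‖(u : L2 Ω)‖ ^ 2 + ‖curl u‖ ^ 2)

/-! ### Sobolev spaces on the boundary -/

/-- The space `C^∞(∂Ω; F)` of smooth functions on the (compact embedded) boundary surface,
realized as restrictions of smooth functions on `ℝ³`. -/
def SmoothBdry (Ω : Set R3) (F : Type*) [NormedAddCommGroup F] [NormedSpace ℂ F] :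
    Submodule ℂ (frontier Ω → F) where
  carrier := {g | ∃ G : R3 → F, ContDiff ℝ ∞ G ∧ ∀ x : frontier Ω, g x = G x}
  zero_mem' := ⟨fun _ => 0, contDiff_const, fun _ => rfl⟩
  add_mem' := by
    rintro g h ⟨G, hG, hg⟩ ⟨H, hH, hh⟩
    exact ⟨fun x => G x + H x, hG.add hH, fun x => by simp [hg, hh]⟩
  smul_mem' := by
    rintro c g ⟨G, hG, hg⟩
    exact ⟨fun x => c • G x, contDiff_const.smul hG, fun x => by simp [hg]⟩

/-- The restriction to `∂Ω` of a smooth function on `ℝ³`. -/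
def restrictBdry (Ω : Set R3) {F : Type*} [NormedAddCommGroup F] [NormedSpace ℂ F]
    (G : R3 → F) (hG : ContDiff ℝ ∞ G) : SmoothBdry Ω F :=
  ⟨fun x => G x, G, hG, fun _ => rfl⟩

/-- The surface measure on `∂Ω`: the two-dimensional Hausdorff measure, normalized as area. -/
def surfaceMeasure (Ω : Set R3) : Measure (frontier Ω) :=
  Measure.euclideanHausdorffMeasure 2

/-- The Sobolev–Slobodeckij norm of `H^{1/2}(∂Ω)`:
`‖g‖² = ∫ |g(x)|² dS(x) + ∬ |g(x) - g(y)|² / |x - y|³ dS(y) dS(x)`. -/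
def hHalfNorm {Ω : Set R3} {F : Type*} [NormedAddCommGroup F] (g : frontier Ω → F) : ℝ≥0∞ :=
  ((∫⁻ x, ‖g x‖ₑ ^ 2 ∂surfaceMeasure Ω) +
    ∫⁻ x, ∫⁻ y, ‖g x - g y‖ₑ ^ 2 / edist x y ^ 3 ∂surfaceMeasure Ω ∂surfaceMeasure Ω) ^ (1 / 2 : ℝ)

/-- Linear functionals on `C^∞(∂Ω; F)`. An integrable field `u` on `∂Ω` is identified with
`φ ↦ ∫_{∂Ω} u · φ dS` (bilinear product). -/
abbrev BdryFunctional (Ω : Set R3) (F : Type*) [NormedAddCommGroup F] [NormedSpace ℂ F] :=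
  SmoothBdry Ω F →ₗ[ℂ] ℂ

/-- `|⟨u, φ⟩| ≤ C ‖φ‖_{H^{1/2}(∂Ω)}` for all smooth `φ`. -/
def IsHalfBound {Ω : Set R3} {F : Type*} [NormedAddCommGroup F] [NormedSpace ℂ F]
    (u : BdryFunctional Ω F) (C : ℝ) : Prop :=
  0 ≤ C ∧ ∀ φ : SmoothBdry Ω F, ‖u φ‖ₑ ≤ ENNReal.ofReal C * hHalfNorm (φ : frontier Ω → F)

/-- `H^{-1/2}(∂Ω)` (for `F = ℂ`) and `H^{-1/2}(∂Ω)³` (for `F = ℂ³`), the dual of `H^{1/2}`. -/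
def HMinusHalf (Ω : Set R3) (F : Type*) [NormedAddCommGroup F] [NormedSpace ℂ F] :
    Set (BdryFunctional Ω F) := {u | ∃ C, IsHalfBound u C}

/-- The dual norm of `H^{-1/2}(∂Ω)`. -/
def hMinusHalfNorm {Ω : Set R3} {F : Type*} [NormedAddCommGroup F] [NormedSpace ℂ F]
    (u : BdryFunctional Ω F) : ℝ := sInf {C | IsHalfBound u C}

/-- `γₙ f = ν · f = 0`: the functional `f` vanishes on all normal test fields. -/
def IsTangential {Ω : Set R3} (f : BdryFunctional Ω C3) : Prop :=
  ∀ Φ : SmoothBdry Ω C3,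
    (∀ x, ∃ c : ℂ, (Φ : frontier Ω → C3) x = c • outwardNormalC Ω x) → f Φ = 0

/-- The tangential gradient `∇_T G = ∇G - (ν · ∇G) ν` on `∂Ω`. -/
def tangentialGrad (Ω : Set R3) (G : R3 → ℂ) (x : frontier Ω) : C3 :=
  grad G x - dot (outwardNormalC Ω x) (grad G x) • outwardNormalC Ω x

/-- `d = Div_{∂Ω} f` in the weak sense: `⟨d, G⟩ = - ⟨f, ∇_T G⟩` for all smooth `G`. -/
def HasSurfaceDiv {Ω : Set R3} (f : BdryFunctional Ω C3) (d : BdryFunctional Ω ℂ) : Prop :=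
  ∀ (G : R3 → ℂ) (hG : ContDiff ℝ ∞ G) (Φ : SmoothBdry Ω C3),
    (Φ : frontier Ω → C3) = tangentialGrad Ω G → d (restrictBdry Ω G hG) = -f Φ

/-- `H^{-1/2}(div, ∂Ω)`: the tangential fields `f` in `H^{-1/2}(∂Ω)³` with
`Div_{∂Ω} f` in `H^{-1/2}(∂Ω)`. -/
def HMinusHalfDiv (Ω : Set R3) : Set (BdryFunctional Ω C3) :=
  {f | f ∈ HMinusHalf Ω C3 ∧ IsTangential f ∧ ∃ d ∈ HMinusHalf Ω ℂ, HasSurfaceDiv f d}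

/-- The surface divergence of an element of `H^{-1/2}(div, ∂Ω)`. -/
def surfaceDiv {Ω : Set R3} (f : HMinusHalfDiv Ω) : BdryFunctional Ω ℂ := f.2.2.2.choose

/-- The norm of `H^{-1/2}(div, ∂Ω)`. -/
def hMinusHalfDivNorm {Ω : Set R3} (f : HMinusHalfDiv Ω) : ℝ :=
  √(hMinusHalfNorm (f : BdryFunctional Ω C3) ^ 2 + hMinusHalfNorm (surfaceDiv f) ^ 2)

/-- `ν × u = f` on `∂Ω` for `u ∈ H(curl, Ω)`, in the sense of the Stokes formula
`∫_Ω ((∇ × u) · Φ - u · (∇ × Φ)) dx = ∫_{∂Ω} (ν × u) · Φ dS` for `Φ` smooth up to the boundary. -/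
def HasTangentialTrace {Ω : Set R3} (u : Hcurl Ω) (f : BdryFunctional Ω C3) : Prop :=
  ∀ (Φ : R3 → C3) (hΦ : ContDiff ℝ ∞ Φ),
    ∫ x in Ω, (dot (curl u x) (Φ x) - dot ((u : L2 Ω) x) (classicalCurl Φ x)) =
      f (restrictBdry Ω Φ hΦ)

end

/-! ### Coefficients and the Maxwell system -/

/-- The product of a matrix and a vector in `ℂ³`. -/
def matVec (A : Matrix (Fin 3) (Fin 3) ℂ) (ξ : C3) : C3 := WithLp.toLp 2 (A.mulVec ξ.ofLp)

/-- The vector in `ℂ³` with complex conjugate entries. -/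
def conjVec (ξ : C3) : C3 := WithLp.toLp 2 fun j => star (ξ j)

/-- The class `M_ℂ(α, β; Ω)`: measurable matrix fields with
`-i ξ · (A(x) - A(x)†) ξ̄ ≥ α |ξ|²` and `|A(x) ξ| ≤ β |ξ|` for all `ξ ∈ ℂ³` and a.e. `x ∈ Ω`.
The left-hand side of the first inequality is always real. -/
structure MC (α β : ℝ) (Ω : Set R3) (A : R3 → Matrix (Fin 3) (Fin 3) ℂ) : Prop where
  measurable : ∀ k l, AEMeasurable (fun x => A x k l) (volume.restrict Ω)
  lower : ∀ᵐ x ∂volume.restrict Ω, ∀ ξ : C3,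
    α * ‖ξ‖ ^ 2 ≤ (-Complex.I * dot ξ (matVec (A x - (A x).conjTranspose) (conjVec ξ))).re
  upper : ∀ᵐ x ∂volume.restrict Ω, ∀ ξ : C3, ‖matVec (A x) ξ‖ ≤ β * ‖ξ‖

/-- `(E, H) ∈ H(curl, Ω)²` solves `∇ × E = iωμH`, `∇ × H = -iωεE` in `Ω`, `ν × E = f` on `∂Ω`. -/
structure IsMaxwellSolution {Ω : Set R3} (ε μ : R3 → Matrix (Fin 3) (Fin 3) ℂ) (ω : ℝ)
    (f : HMinusHalfDiv Ω) (E H : Hcurl Ω) : Prop where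
  curl_E : ∀ᵐ x ∂volume.restrict Ω,
    curl E x = (Complex.I * ω) • matVec (μ x) ((H : L2 Ω) x)
  curl_H : ∀ᵐ x ∂volume.restrict Ω,
    curl H x = (-Complex.I * ω) • matVec (ε x) ((E : L2 Ω) x)
  trace_E : HasTangentialTrace E (f : BdryFunctional Ω C3)

end Maxwell

end

noncomputable section

namespace Maxwell

open scoped ContDiff

/-! The class `MC` asks exactly that the imaginary part of `⟨ξ, Aξ⟩` be positive definite. For a
field `E` with vanishing tangential trace, pairing `curl E` with `H` and `curl H` with `E` makes the
two curls cancel, and what remains is `ω (Im⟨E, εE⟩ + Im⟨H, μH⟩)`, at least `(ωα/2)(‖E‖² + ‖H‖²)`.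
Hence the Maxwell operator with zero boundary condition is bounded below on `L² × L²` for every `ω >
0` (`energy_bound`), without any compactness or Fredholm alternative. Its graph is closed, and a
vector orthogonal to its range satisfies an adjoint system to which the same sign argument applies,
so the operator is onto (`surjective_of_bounded_below`, `eq_zero_of_orthogonal_maxwellGraph`). A
general datum `f` is moved into the sources by subtracting a lift `E₀` with `ν × E₀ = f`; see
`maxwell_wellposed`. The final constant involves only `α`, `β`, `ω` and the norm of the lifting.

Two facts about `Ω` remain. The first is `curlPairingSymm`: zero trace is defined by testing against
fields smooth up to the boundary, but the energy identity needs every field of `H(curl)` as a test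
field. A zero-trace field is localized, extended by zero, translated into `Ω` along a cone of
directions and mollified, which yields admissible test fields for the weak curl of the other factor.

The second is `hasTangentialLifting`. By the Riesz theorem (`exists_lifting`) it suffices to bound
`|f(Φ)|` by the norm of `f` times the `H(curl)` norm of `Φ`, for smooth `Φ`. In coordinates
flattening the boundary, the vertical derivative of the tangential components of `Φ` is a horizontal
gradient plus components of `curl Φ`, so their boundary values are controlled in `H^{-1/2}(ℝ²)`
(`negHalf_slice_le`). Their planar rotation is the flux of the divergence-free field `curl Φ`, so it
is controlled in `H^{-1/2}` too. A planar Hodge decomposition then writes the tangential part as `ψ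
+ ∇p` with `ψ` and `p` in `H^{1/2}` (`exists_plane_decomposition`). The functional `f` acts on `ψ`
through its own `H^{-1/2}` norm, on `∇p` through that of its surface divergence up to a cutoff term,
and annihilates the normal remainder. Planar `H^{1/2}` norms are compared with the Slobodeckij norm
of the surface in `gagliardo_le` and `IsGraphChart.exists_hHalfNorm_le`. -/

theorem dot_eq_inner (u v : C3) : dot u v = inner ℂ (conjVec u) v := by
  simp [dot, conjVec, PiLp.inner_apply, mul_comm]

theorem inner_eq_dot (u v : C3) : inner ℂ u v = dot (conjVec u) v := by
  simp [dot, conjVec, PiLp.inner_apply, mul_comm]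

@[simp] theorem conjVec_conjVec (u : C3) : conjVec (conjVec u) = u := by
  ext j; simp [conjVec]

@[simp] theorem norm_conjVec (u : C3) : ‖conjVec u‖ = ‖u‖ := by
  simp [conjVec, EuclideanSpace.norm_eq]

theorem dot_comm (u v : C3) : dot u v = dot v u := by simp [dot, mul_comm]

theorem norm_dot_le (u v : C3) : ‖dot u v‖ ≤ ‖u‖ * ‖v‖ := by
  rw [dot_eq_inner, ← norm_conjVec u]; exact norm_inner_le_norm _ _

theorem dot_add_left (u u' v : C3) : dot (u + u') v = dot u v + dot u' v := by
  simp [dot, add_mul, Finset.sum_add_distrib]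

theorem dot_add_right (u v v' : C3) : dot u (v + v') = dot u v + dot u v' := by
  simp [dot, mul_add, Finset.sum_add_distrib]

theorem dot_smul_left (c : ℂ) (u v : C3) : dot (c • u) v = c * dot u v := by
  simp [dot, Finset.mul_sum, mul_assoc]

theorem dot_smul_right (c : ℂ) (u v : C3) : dot u (c • v) = c * dot u v := by
  simp [dot, Finset.mul_sum, mul_left_comm]

@[simp] theorem dot_zero_left (v : C3) : dot 0 v = 0 := by simp [dot]

@[simp] theorem dot_zero_right (v : C3) : dot v 0 = 0 := by simp [dot]

theorem dot_single (u : C3) (m : Fin 3) (c : ℂ) : dot u (EuclideanSpace.single m c) = u m * c := by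
  simp [dot]

/-- Complex conjugation on `ℂ³` as a real-linear map. -/
def conjCLM : C3 →L[ℝ] C3 :=
  LinearMap.mkContinuous
    { toFun := conjVec
      map_add' := fun u v => by ext j; simp [conjVec]
      map_smul' := fun c u => by ext j; simp [conjVec] } 1 fun u => by simp

@[simp] theorem conjCLM_apply (u : C3) : conjCLM u = conjVec u := rfl

/-! ### The bilinear pairing and the weak curl on `L²` -/

section L2

variable {Ω : Set R3}

/-- Pointwise complex conjugation on `L²(Ω)³`. -/
def conjL2 (u : L2 Ω) : L2 Ω := conjCLM.compLp u

theorem coeFn_conjL2 (u : L2 Ω) : ∀ᵐ x ∂volume.restrict Ω, conjL2 u x = conjVec (u x) :=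
  ContinuousLinearMap.coeFn_compLp _ _

@[simp] theorem conjL2_conjL2 (u : L2 Ω) : conjL2 (conjL2 u) = u := by
  apply Lp.ext
  filter_upwards [coeFn_conjL2 u, coeFn_conjL2 (conjL2 u)] with x h1 h2
  rw [h2, h1, conjVec_conjVec]

@[simp] theorem norm_conjL2 (u : L2 Ω) : ‖conjL2 u‖ = ‖u‖ := by
  have h : ∀ᵐ x ∂volume.restrict Ω, ‖conjL2 u x‖ = ‖u x‖ := by
    filter_upwards [coeFn_conjL2 u] with x h1
    rw [h1, norm_conjVec]
  exact le_antisymm (Lp.norm_le_norm_of_ae_le (h.mono fun _ => le_of_eq))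
    (Lp.norm_le_norm_of_ae_le (h.mono fun _ => ge_of_eq))

theorem conjL2_add (u v : L2 Ω) : conjL2 (u + v) = conjL2 u + conjL2 v :=
  ((conjCLM.compLpL 2 (volume.restrict Ω)).map_add u v)

theorem conjL2_neg (u : L2 Ω) : conjL2 (-u) = -conjL2 u :=
  ((conjCLM.compLpL 2 (volume.restrict Ω)).map_neg u)

theorem conjL2_smul (c : ℂ) (u : L2 Ω) : conjL2 (c • u) = star c • conjL2 u := by
  apply Lp.ext
  filter_upwards [coeFn_conjL2 u, coeFn_conjL2 (c • u), Lp.coeFn_smul c u,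
    Lp.coeFn_smul (star c) (conjL2 u)] with x h1 h2 h3 h4
  rw [h2, h3, h4, Pi.smul_apply, Pi.smul_apply, h1]
  ext j; simp [conjVec]

theorem continuous_conjL2 : Continuous (conjL2 : L2 Ω → L2 Ω) :=
  (conjCLM.compLpL 2 (volume.restrict Ω)).continuous

/-- The bilinear pairing `∫_Ω u · v dx` on `L²(Ω)³`. -/
def pairing (u v : L2 Ω) : ℂ := ∫ x in Ω, dot (u x) (v x)

theorem pairing_eq_inner (u v : L2 Ω) : pairing u v = inner ℂ (conjL2 u) v := by
  rw [L2.inner_def]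
  apply integral_congr_ae
  filter_upwards [coeFn_conjL2 u] with x h1
  rw [h1, dot_eq_inner]

theorem inner_eq_pairing (u v : L2 Ω) : inner ℂ u v = pairing (conjL2 u) v := by
  rw [pairing_eq_inner, conjL2_conjL2]

theorem pairing_comm (u v : L2 Ω) : pairing u v = pairing v u := by
  simp only [pairing, dot_comm]

theorem integrable_dot (u v : L2 Ω) :
    Integrable (fun x => dot (u x) (v x)) (volume.restrict Ω) := by
  refine (L2.integrable_inner (𝕜 := ℂ) (conjL2 u) v).congr ?_
  filter_upwards [coeFn_conjL2 u] with x h1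
  rw [h1, dot_eq_inner]

theorem pairing_add_left (u u' v : L2 Ω) : pairing (u + u') v = pairing u v + pairing u' v := by
  simp [pairing_eq_inner, conjL2_add, inner_add_left]

theorem pairing_sub_right (u v v' : L2 Ω) : pairing u (v - v') = pairing u v - pairing u v' := by
  simp [pairing_eq_inner, inner_sub_right]

theorem pairing_sub_left (u u' v : L2 Ω) : pairing (u - u') v = pairing u v - pairing u' v := by
  rw [pairing_comm, pairing_sub_right, pairing_comm v, pairing_comm v]

theorem pairing_smul_left (c : ℂ) (u v : L2 Ω) : pairing (c • u) v = c * pairing u v := by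
  simp [pairing_eq_inner, conjL2_smul, inner_smul_left]

theorem pairing_neg_left (u v : L2 Ω) : pairing (-u) v = -pairing u v := by
  simp [pairing_eq_inner, conjL2_neg, inner_neg_left]

theorem continuous_pairing_left (v : L2 Ω) : Continuous fun u : L2 Ω => pairing u v := by
  simp only [pairing_eq_inner]
  exact (continuous_conjL2).inner continuous_const

theorem memLp_of_continuous (hb : Bornology.IsBounded Ω) {F : Type*} [NormedAddCommGroup F]
    {Φ : R3 → F} (hΦ : Continuous Φ) (p : ℝ≥0∞) : MemLp Φ p (volume.restrict Ω) := by
  have hc : IsCompact (closure Ω) := hb.isCompact_closure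
  obtain ⟨C, hC⟩ := hc.exists_bound_of_continuousOn hΦ.continuousOn
  have : IsFiniteMeasure (volume.restrict (closure Ω)) := ⟨by simpa using hc.measure_lt_top⟩
  refine MemLp.mono_measure (Measure.restrict_mono subset_closure le_rfl) ?_
  refine MemLp.of_bound ?_ C (ae_restrict_of_forall_mem hc.isClosed.measurableSet hC)
  exact hΦ.continuousOn.aestronglyMeasurable_of_isCompact hc hc.isClosed.measurableSet

/-- The class in `L²(Ω)³` of a continuous field on `ℝ³`. -/
def toL2 (hb : Bornology.IsBounded Ω) (Φ : R3 → C3) (hΦ : Continuous Φ) : L2 Ω :=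
  (memLp_of_continuous hb hΦ 2).toLp Φ

theorem coeFn_toL2 (hb : Bornology.IsBounded Ω) {Φ : R3 → C3} (hΦ : Continuous Φ) :
    ∀ᵐ x ∂volume.restrict Ω, toL2 hb Φ hΦ x = Φ x := MemLp.coeFn_toLp _

theorem pairing_toL2 (hb : Bornology.IsBounded Ω) (u : L2 Ω) {Φ : R3 → C3} (hΦ : Continuous Φ) :
    pairing u (toL2 hb Φ hΦ) = ∫ x in Ω, dot (u x) (Φ x) := by
  apply integral_congr_ae
  filter_upwards [coeFn_toL2 hb hΦ] with x h1
  rw [h1]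

theorem integrable_dot_continuous (hb : Bornology.IsBounded Ω) (u : L2 Ω) {Φ : R3 → C3}
    (hΦ : Continuous Φ) : Integrable (fun x => dot (u x) (Φ x)) (volume.restrict Ω) := by
  refine (integrable_dot u (toL2 hb Φ hΦ)).congr ?_
  filter_upwards [coeFn_toL2 hb hΦ] with x h1
  rw [h1]

theorem contDiff_partialDeriv {F : Type*} [NormedAddCommGroup F] [NormedSpace ℝ F]
    {f : R3 → F} (hf : ContDiff ℝ ∞ f) (j : Fin 3) : ContDiff ℝ ∞ (partialDeriv j f) :=
  (hf.fderiv_right (m := ∞) (by simp)).clm_apply contDiff_const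

theorem classicalCurl_apply (Φ : R3 → C3) (x : R3) (m : Fin 3) :
    classicalCurl Φ x m = partialDeriv (m + 1) Φ x (m + 2) - partialDeriv (m + 2) Φ x (m + 1) := by
  fin_cases m <;> rfl

theorem contDiff_classicalCurl {Φ : R3 → C3} (hΦ : ContDiff ℝ ∞ Φ) :
    ContDiff ℝ ∞ (classicalCurl Φ) := by
  rw [contDiff_piLp]
  intro m
  simp only [classicalCurl_apply]
  exact ((contDiff_piLp 2).mp (contDiff_partialDeriv hΦ _) _).sub
    ((contDiff_piLp 2).mp (contDiff_partialDeriv hΦ _) _)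

/-- Written with `L²` classes of the test fields, the condition is visibly linear and closed in `(u,
v)`, which is how it is used later. -/
theorem hasWeakCurl_iff (hb : Bornology.IsBounded Ω) (u v : L2 Ω) : HasWeakCurl Ω u v ↔
    ∀ (φ : R3 → C3) (h : ContDiff ℝ ∞ φ), HasCompactSupport φ → tsupport φ ⊆ Ω →
      pairing u (toL2 hb _ (contDiff_classicalCurl h).continuous) =
        pairing v (toL2 hb _ h.continuous) := by
  simp only [pairing_toL2]; rfl

theorem hasTangentialTrace_iff (hb : Bornology.IsBounded Ω) (u : Hcurl Ω)
    (f : BdryFunctional Ω C3) : HasTangentialTrace u f ↔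
    ∀ (Φ : R3 → C3) (h : ContDiff ℝ ∞ Φ),
      pairing (curl u) (toL2 hb _ h.continuous) -
        pairing (u : L2 Ω) (toL2 hb _ (contDiff_classicalCurl h).continuous) =
          f (restrictBdry Ω Φ h) := by
  unfold HasTangentialTrace
  refine forall_congr' fun Φ => forall_congr' fun h => ?_
  rw [pairing_toL2, pairing_toL2, integral_sub]
  · exact integrable_dot_continuous hb _ h.continuous
  · exact integrable_dot_continuous hb _ (contDiff_classicalCurl h).continuous

/-- The fundamental lemma of the calculus of variations for scalar bumps `g`, applied one component
at a time through the test fields `g • e_m`. -/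
theorem eq_zero_of_pairing_eq_zero (hΩ : IsOpen Ω) (v : L2 Ω)
    (h : ∀ φ : R3 → C3, ContDiff ℝ ∞ φ → HasCompactSupport φ → tsupport φ ⊆ Ω →
      ∫ x in Ω, dot (v x) (φ x) = 0) : v = 0 := by
  have hl : LocallyIntegrable (fun x => v x) (volume.restrict Ω) :=
    (Lp.memLp v).locallyIntegrable (by norm_num)
  have hz : ∀ᵐ x ∂volume.restrict Ω, x ∈ Ω → v x = 0 := by
    refine hΩ.ae_eq_zero_of_integral_contDiff_smul_eq_zero (hl.locallyIntegrableOn Ω)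
      fun g hg hgc hgs => ?_
    have hi : Integrable (fun x => g x • v x) (volume.restrict Ω) :=
      hl.integrable_smul_left_of_hasCompactSupport hg.continuous hgc
    ext m
    have e1 : (∫ x in Ω, g x • v x) m = ∫ x in Ω, (g x • v x) m :=
      ((EuclideanSpace.proj (𝕜 := ℂ) m).integral_comp_comm hi).symm
    rw [e1]
    have hφ : ContDiff ℝ ∞ fun x => g x • (EuclideanSpace.single m 1 : C3) :=
      hg.smul contDiff_const
    have hsub : tsupport (fun x => g x • (EuclideanSpace.single m 1 : C3)) ⊆ tsupport g :=
      closure_mono fun x hx hgx => hx (by simp [hgx])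
    have := h _ hφ (hgc.mono' ((subset_tsupport _).trans hsub)) (hsub.trans hgs)
    rw [PiLp.zero_apply, ← this]
    refine integral_congr_ae (Eventually.of_forall fun x => ?_)
    simp [dot, mul_comm]
  apply Lp.ext
  filter_upwards [hz, ae_restrict_mem hΩ.measurableSet, Lp.coeFn_zero C3 2 (volume.restrict Ω)]
    with x h1 h2 h3
  rw [h1 h2, h3]; rfl

/-- Makes `curl`, which is defined by choice, computable: any field satisfying the defining identity
is the chosen one. -/
theorem HasWeakCurl.unique (hΩ : IsOpen Ω) (hb : Bornology.IsBounded Ω) {u v w : L2 Ω}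
    (hv : HasWeakCurl Ω u v) (hw : HasWeakCurl Ω u w) : v = w := by
  rw [← sub_eq_zero]
  refine eq_zero_of_pairing_eq_zero hΩ _ fun φ h hc hs => ?_
  rw [← pairing_toL2 hb _ h.continuous, pairing_sub_left,
    ← (hasWeakCurl_iff hb u v).mp hv φ h hc hs, ← (hasWeakCurl_iff hb u w).mp hw φ h hc hs, sub_self]

theorem hasWeakCurl_curl (u : Hcurl Ω) : HasWeakCurl Ω (u : L2 Ω) (curl u) := u.2.choose_spec

theorem curl_eq (hΩ : IsOpen Ω) (hb : Bornology.IsBounded Ω) {u : Hcurl Ω} {v : L2 Ω}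
    (h : HasWeakCurl Ω u v) : curl u = v := (hasWeakCurl_curl u).unique hΩ hb h

theorem HasWeakCurl.sub (hb : Bornology.IsBounded Ω) {u u' v v' : L2 Ω} (h : HasWeakCurl Ω u v)
    (h' : HasWeakCurl Ω u' v') : HasWeakCurl Ω (u - u') (v - v') := by
  rw [hasWeakCurl_iff hb] at *
  intro φ h1 h2 h3
  rw [pairing_sub_left, pairing_sub_left, h φ h1 h2 h3, h' φ h1 h2 h3]

theorem HasWeakCurl.add (hb : Bornology.IsBounded Ω) {u u' v v' : L2 Ω} (h : HasWeakCurl Ω u v)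
    (h' : HasWeakCurl Ω u' v') : HasWeakCurl Ω (u + u') (v + v') := by
  rw [hasWeakCurl_iff hb] at *
  intro φ h1 h2 h3
  rw [pairing_add_left, pairing_add_left, h φ h1 h2 h3, h' φ h1 h2 h3]

theorem conjVec_classicalCurl {Φ : R3 → C3} (h : ContDiff ℝ ∞ Φ) (x : R3) :
    classicalCurl (fun y => conjVec (Φ y)) x = conjVec (classicalCurl Φ x) := by
  have hd : ∀ j, partialDeriv j (fun y => conjVec (Φ y)) x = conjVec (partialDeriv j Φ x) := by
    intro j
    have : HasFDerivAt (fun y => conjVec (Φ y)) (conjCLM.comp (fderiv ℝ Φ x)) x :=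
      conjCLM.hasFDerivAt.comp x (h.differentiable (by simp) x).hasFDerivAt
    rw [partialDeriv, this.fderiv]; rfl
  ext m
  rw [classicalCurl_apply, hd, hd]
  simp [classicalCurl_apply, conjVec]

theorem contDiff_conjVec {Φ : R3 → C3} (h : ContDiff ℝ ∞ Φ) :
    ContDiff ℝ ∞ fun y => conjVec (Φ y) := conjCLM.contDiff.comp h

theorem integral_dot_conjL2 (w : L2 Ω) (Ψ : R3 → C3) :
    ∫ x in Ω, dot (conjL2 w x) (Ψ x) = star (∫ x in Ω, dot (w x) (conjVec (Ψ x))) := by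
  rw [← starRingEnd_apply, ← integral_conj]
  refine integral_congr_ae ?_
  filter_upwards [coeFn_conjL2 w] with x hx
  simp [hx, dot, conjVec]

/-- The curl has real coefficients. This lets the bilinear definition of the weak curl be combined
with the sesquilinear inner product of the energy argument. -/
theorem HasWeakCurl.conj {u v : L2 Ω} (h : HasWeakCurl Ω u v) :
    HasWeakCurl Ω (conjL2 u) (conjL2 v) := by
  intro φ h1 h2 h3
  rw [integral_dot_conjL2, integral_dot_conjL2]
  have hsub : tsupport (fun x => conjVec (φ x)) ⊆ tsupport φ :=
    closure_mono fun x hx hgx => hx (by ext; simp [hgx, conjVec])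
  have := h _ (contDiff_conjVec h1) (h2.mono' ((subset_tsupport _).trans hsub)) (hsub.trans h3)
  rw [← this]
  simp only [conjVec_classicalCurl h1]

end L2

/-! ### Coefficient matrices as operators on `L²` -/

section Multiplication

variable {Ω : Set R3} {α β : ℝ} {A : R3 → Matrix (Fin 3) (Fin 3) ℂ}

theorem matVec_apply (A : Matrix (Fin 3) (Fin 3) ℂ) (ξ : C3) (k : Fin 3) :
    matVec A ξ k = ∑ l, A k l * ξ l := rfl

theorem MC.memLp (hA : MC α β Ω A) (u : L2 Ω) :
    MemLp (fun x => matVec (A x) (u x)) 2 (volume.restrict Ω) := by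
  have hm : AEStronglyMeasurable (fun x => matVec (A x) (u x)) (volume.restrict Ω) := by
    refine (PiLp.continuous_toLp 2 _).comp_aestronglyMeasurable
      (g := fun f : Fin 3 → ℂ => WithLp.toLp 2 f)
      (f := fun x k => ∑ l, A x k l * u x l) (AEMeasurable.aestronglyMeasurable (aemeasurable_pi_lambda _ fun k => AEStronglyMeasurable.aemeasurable ?_))
    refine Finset.aestronglyMeasurable_fun_sum _ fun l _ =>
      (hA.measurable k l).aestronglyMeasurable.mul ?_
    exact ((EuclideanSpace.proj (𝕜 := ℂ) l).continuous).comp_aestronglyMeasurable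
      (Lp.aestronglyMeasurable u)
  refine MemLp.of_le_mul (c := β) (Lp.memLp u) hm ?_
  filter_upwards [hA.upper] with x hx using hx _

/-- Multiplication by a matrix field in `M_ℂ(α, β; Ω)` as a bounded operator on `L²(Ω)³`. -/
def MC.mulL2 (hA : MC α β Ω A) : L2 Ω →L[ℂ] L2 Ω :=
  LinearMap.mkContinuous
    { toFun := fun u => (hA.memLp u).toLp _
      map_add' := fun u v => by
        apply Lp.ext
        filter_upwards [(hA.memLp (u + v)).coeFn_toLp, Lp.coeFn_add u v, (hA.memLp u).coeFn_toLp,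
          (hA.memLp v).coeFn_toLp, Lp.coeFn_add ((hA.memLp u).toLp _) ((hA.memLp v).toLp _)]
          with x h1 h2 h3 h4 h5
        rw [h1, h5, Pi.add_apply, h3, h4, h2]
        ext k; simp [matVec_apply, mul_add, Finset.sum_add_distrib]
      map_smul' := fun c u => by
        apply Lp.ext
        filter_upwards [(hA.memLp (c • u)).coeFn_toLp, Lp.coeFn_smul c u, (hA.memLp u).coeFn_toLp,
          Lp.coeFn_smul c ((hA.memLp u).toLp _)] with x h1 h2 h3 h4
        rw [h1, RingHom.id_apply, h4, Pi.smul_apply, h3, h2]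
        ext k; simp [matVec_apply, mul_left_comm, Finset.mul_sum] }
    β fun u => by
      refine Lp.norm_le_mul_norm_of_ae_le_mul ?_
      filter_upwards [hA.upper, (hA.memLp u).coeFn_toLp] with x hx h1
      simpa [h1] using hx _

theorem MC.coeFn_mulL2 (hA : MC α β Ω A) (u : L2 Ω) :
    ∀ᵐ x ∂volume.restrict Ω, hA.mulL2 u x = matVec (A x) (u x) := (hA.memLp u).coeFn_toLp

theorem MC.norm_mulL2_le (hA : MC α β Ω A) (u : L2 Ω) : ‖hA.mulL2 u‖ ≤ β * ‖u‖ := by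
  refine Lp.norm_le_mul_norm_of_ae_le_mul ?_
  filter_upwards [hA.upper, hA.coeFn_mulL2 u] with x hx h1
  simpa [h1] using hx _

/-- The form of `A - A†` at `η` is `z - z̄ = 2i Im z` with `z = ⟨η, Aη⟩`. This accounts for the
factor `α / 2` in the lower bounds below. -/
theorem re_neg_I_mul_dot (A : Matrix (Fin 3) (Fin 3) ℂ) (η : C3) :
    (-Complex.I * dot (conjVec η) (matVec (A - A.conjTranspose) η)).re =
      2 * (inner ℂ η (matVec A η)).im := by
  have h : dot (conjVec η) (matVec (A - A.conjTranspose) η) =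
      inner ℂ η (matVec A η) - star (inner ℂ η (matVec A η)) := by
    rw [inner_eq_dot]
    simp only [dot, matVec_apply, conjVec, Fin.sum_univ_three, Matrix.sub_apply,
      Matrix.conjTranspose_apply, star_add, star_mul', star_star]
    ring
  have h2 : ∀ z : ℂ, (-Complex.I * (z - star z)).re = 2 * z.im := fun z => by
    simp
    ring
  rw [h, h2]

theorem MC.im_inner_ge (hA : MC α β Ω A) (u : L2 Ω) :
    α / 2 * ‖u‖ ^ 2 ≤ (inner ℂ u (hA.mulL2 u)).im := by
  have h1 : (inner ℂ u (hA.mulL2 u)).im = ∫ x in Ω, (inner ℂ (u x) (hA.mulL2 u x)).im := by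
    rw [L2.inner_def]
    exact (integral_im (L2.integrable_inner (𝕜 := ℂ) u (hA.mulL2 u))).symm
  have h2 : ‖u‖ ^ 2 = ∫ x in Ω, ‖u x‖ ^ 2 := by
    have := congrArg Complex.re (L2.inner_def (𝕜 := ℂ) u u)
    rw [← RCLike.re_eq_complex_re, inner_self_eq_norm_sq] at this
    rw [this, ← integral_re (L2.integrable_inner (𝕜 := ℂ) u u)]
    simp only [inner_self_eq_norm_sq]
  rw [h1, h2, ← integral_const_mul]
  refine integral_mono_ae ?_ (L2.integrable_inner (𝕜 := ℂ) u (hA.mulL2 u)).im ?_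
  · exact ((Lp.memLp u).integrable_norm_pow (by norm_num)).const_mul _
  · filter_upwards [hA.lower, hA.coeFn_mulL2 u] with x h3 h4
    -- The defining inequality has `ξ` on the left and its conjugate on the right, so it is tested
    -- at the conjugate of `u x` to produce `⟨u x, A (u x)⟩`.
    have := h3 (conjVec (u x))
    rw [conjVec_conjVec, re_neg_I_mul_dot, norm_conjVec] at this
    rw [h4]
    linarith

end Multiplication

/-! ### Fields with vanishing tangential trace -/

/-- `v` is the curl of `u` and `u` has vanishing tangential trace, in the weak sense: the Stokes
formula without boundary term holds against all fields that are smooth up to the boundary. -/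
def HasWeakCurlZeroTrace (Ω : Set R3) (u v : L2 Ω) : Prop :=
  ∀ Φ : R3 → C3, ContDiff ℝ ∞ Φ →
    ∫ x in Ω, dot (u x) (classicalCurl Φ x) = ∫ x in Ω, dot (v x) (Φ x)

/-- The curl operators with and without vanishing tangential trace are formally adjoint. -/
def CurlPairingSymm (Ω : Set R3) : Prop :=
  ∀ u v w c : L2 Ω, HasWeakCurlZeroTrace Ω u v → HasWeakCurl Ω w c → pairing v w = pairing u c

variable {Ω : Set R3}

theorem HasWeakCurlZeroTrace.hasWeakCurl {u v : L2 Ω} (h : HasWeakCurlZeroTrace Ω u v) :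
    HasWeakCurl Ω u v := fun φ h1 _ _ => h φ h1

theorem hasWeakCurlZeroTrace_iff (hb : Bornology.IsBounded Ω) (u v : L2 Ω) :
    HasWeakCurlZeroTrace Ω u v ↔ ∀ (Φ : R3 → C3) (h : ContDiff ℝ ∞ Φ),
      pairing u (toL2 hb _ (contDiff_classicalCurl h).continuous) =
        pairing v (toL2 hb _ h.continuous) := by
  simp only [pairing_toL2]; rfl

theorem hasWeakCurlZeroTrace_zero : HasWeakCurlZeroTrace Ω (0 : L2 Ω) 0 := by
  intro Φ h
  have h0 : ∀ F : R3 → C3, ∫ x in Ω, dot ((0 : L2 Ω) x) (F x) = 0 := fun F => by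
    refine integral_eq_zero_of_ae ?_
    filter_upwards [Lp.coeFn_zero C3 2 (volume.restrict Ω)] with x hx
    rw [hx]; simp
  rw [h0, h0]

theorem HasWeakCurlZeroTrace.conj {u v : L2 Ω} (h : HasWeakCurlZeroTrace Ω u v) :
    HasWeakCurlZeroTrace Ω (conjL2 u) (conjL2 v) := by
  intro φ h1
  rw [integral_dot_conjL2, integral_dot_conjL2, ← h _ (contDiff_conjVec h1)]
  simp only [conjVec_classicalCurl h1]

theorem contDiff_coord {Φ : R3 → C3} (h : ContDiff ℝ ∞ Φ) (m : Fin 3) :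
    ContDiff ℝ ∞ fun x => Φ x m := (contDiff_piLp 2).mp h m

theorem partialDeriv_coord {Φ : R3 → C3} {x : R3} (h : DifferentiableAt ℝ Φ x) (j m : Fin 3) :
    partialDeriv j Φ x m = partialDeriv j (fun y => Φ y m) x := by
  have : HasFDerivAt (fun y => Φ y m)
      (((EuclideanSpace.proj (𝕜 := ℂ) m).restrictScalars ℝ).comp (fderiv ℝ Φ x)) x :=
    ((EuclideanSpace.proj (𝕜 := ℂ) m).restrictScalars ℝ).hasFDerivAt.comp x h.hasFDerivAt
  rw [partialDeriv, partialDeriv, this.fderiv]; rfl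

theorem integral_mul_partialDeriv {f g : R3 → ℂ} (hf : ContDiff ℝ ∞ f) (hg : ContDiff ℝ ∞ g)
    (hc : HasCompactSupport g) (j : Fin 3) :
    ∫ x, f x * partialDeriv j g x = -∫ x, partialDeriv j f x * g x := by
  have hc' : HasCompactSupport (partialDeriv j g) :=
    hc.fderiv_apply (𝕜 := ℝ) (v := EuclideanSpace.single j 1)
  refine integral_mul_fderiv_eq_neg_fderiv_mul_of_integrable ?_ ?_ ?_
    (fun x _ => hf.differentiable (by simp) x) (fun x _ => hg.differentiable (by simp) x)
  · exact ((contDiff_partialDeriv hf j).continuous.mul hg.continuous).integrable_of_hasCompactSupport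
      hc.mul_left
  · exact (hf.continuous.mul (contDiff_partialDeriv hg j).continuous).integrable_of_hasCompactSupport
      hc'.mul_left
  · exact (hf.continuous.mul hg.continuous).integrable_of_hasCompactSupport hc.mul_left

/-- Each integration by parts costs a sign, and the antisymmetry of the curl in its indices returns
it, so the curl is formally symmetric for the bilinear pairing. -/
theorem integral_dot_classicalCurl {Φ φ : R3 → C3} (hΦ : ContDiff ℝ ∞ Φ) (hφ : ContDiff ℝ ∞ φ)
    (hc : HasCompactSupport φ) :
    ∫ x, dot (Φ x) (classicalCurl φ x) = ∫ x, dot (classicalCurl Φ x) (φ x) := by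
  have hcm : ∀ m, HasCompactSupport fun x => φ x m := fun m =>
    hc.comp_left (g := fun v : C3 => v m) rfl
  have hcd : ∀ j m, HasCompactSupport (partialDeriv j fun x => φ x m) := fun j m =>
    (hcm m).fderiv_apply (𝕜 := ℝ) (v := EuclideanSpace.single j 1)
  have i1 : ∀ j m l, Integrable fun x => Φ x l * partialDeriv j (fun y => φ y m) x := fun j m l =>
    ((contDiff_coord hΦ l).continuous.mul
      (contDiff_partialDeriv (contDiff_coord hφ m) j).continuous).integrable_of_hasCompactSupport
      (hcd j m).mul_left
  have i2 : ∀ j m l, Integrable fun x => partialDeriv j (fun y => Φ y l) x * φ x m := fun j m l =>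
    ((contDiff_partialDeriv (contDiff_coord hΦ l) j).continuous.mul
      (contDiff_coord hφ m).continuous).integrable_of_hasCompactSupport (hcm m).mul_left
  have ibp := fun j m l => integral_mul_partialDeriv (contDiff_coord hΦ l) (contDiff_coord hφ m)
    (hcm m) j
  have hΦd := fun x => hΦ.differentiable (by simp) x
  have hφd := fun x => hφ.differentiable (by simp) x
  have e1 : ∀ x, dot (Φ x) (classicalCurl φ x) = ∑ m : Fin 3,
      (Φ x m * partialDeriv (m + 1) (fun y => φ y (m + 2)) x -
        Φ x m * partialDeriv (m + 2) (fun y => φ y (m + 1)) x) := fun x => by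
    refine Finset.sum_congr rfl fun m _ => ?_
    rw [classicalCurl_apply, partialDeriv_coord (hφd x), partialDeriv_coord (hφd x), mul_sub]
  have e2 : ∀ x, dot (classicalCurl Φ x) (φ x) = ∑ m : Fin 3,
      (partialDeriv (m + 1) (fun y => Φ y (m + 2)) x * φ x m -
        partialDeriv (m + 2) (fun y => Φ y (m + 1)) x * φ x m) := fun x => by
    refine Finset.sum_congr rfl fun m _ => ?_
    rw [classicalCurl_apply, partialDeriv_coord (hΦd x), partialDeriv_coord (hΦd x), sub_mul]
  simp only [e1, e2]
  rw [integral_finsetSum, integral_finsetSum]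
  · simp only [integral_sub (i1 _ _ _) (i1 _ _ _), integral_sub (i2 _ _ _) (i2 _ _ _), ibp]
    simp only [Fin.sum_univ_three, Fin.isValue, Fin.reduceAdd, zero_add]
    ring
  · exact fun m _ => (i2 _ _ _).sub (i2 _ _ _)
  · exact fun m _ => (i1 _ _ _).sub (i1 _ _ _)

theorem setIntegral_dot_eq_integral {F φ : R3 → C3} (hs : tsupport φ ⊆ Ω) :
    ∫ x in Ω, dot (F x) (φ x) = ∫ x, dot (F x) (φ x) := by
  refine setIntegral_eq_integral_of_forall_compl_eq_zero fun x hx => ?_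
  rw [image_eq_zero_of_notMem_tsupport fun h => hx (hs h), dot_zero_right]

theorem tsupport_classicalCurl_subset (φ : R3 → C3) :
    tsupport (classicalCurl φ) ⊆ tsupport φ := by
  refine closure_minimal (fun x hx => ?_) (isClosed_tsupport φ)
  by_contra h
  apply hx
  have h0 : fderiv ℝ φ x = 0 := by
    by_contra h1
    exact h (support_fderiv_subset ℝ h1)
  ext m
  rw [classicalCurl_apply]
  simp [partialDeriv, h0]

theorem hasWeakCurl_toL2 (hb : Bornology.IsBounded Ω) {Φ : R3 → C3} (h : ContDiff ℝ ∞ Φ) :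
    HasWeakCurl Ω (toL2 hb _ h.continuous) (toL2 hb _ (contDiff_classicalCurl h).continuous) := by
  rw [hasWeakCurl_iff hb]
  intro φ h1 hc hs
  rw [pairing_comm, pairing_toL2, pairing_comm, pairing_toL2]
  have e : ∀ {F G : R3 → C3} (hF : Continuous F), ∫ x in Ω, dot (toL2 hb F hF x) (G x) =
      ∫ x in Ω, dot (F x) (G x) := fun {F G} hF => by
    refine integral_congr_ae ?_
    filter_upwards [coeFn_toL2 hb hF] with x hx
    rw [hx]
  rw [e, e]
  simp_rw [dot_comm _ (Φ _), dot_comm _ (classicalCurl Φ _)]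
  rw [setIntegral_dot_eq_integral hs,
    setIntegral_dot_eq_integral ((tsupport_classicalCurl_subset φ).trans hs)]
  exact integral_dot_classicalCurl h h1 hc

/-- This is `hasWeakCurl_toL2` with the roles of test field and field exchanged: the boundary term
is absent because one of the two fields is supported inside `Ω`. -/
theorem hasWeakCurlZeroTrace_toL2 (hb : Bornology.IsBounded Ω) {φ : R3 → C3}
    (h : ContDiff ℝ ∞ φ) (hc : HasCompactSupport φ) (hs : tsupport φ ⊆ Ω) :
    HasWeakCurlZeroTrace Ω (toL2 hb _ h.continuous)
      (toL2 hb _ (contDiff_classicalCurl h).continuous) := by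
  rw [hasWeakCurlZeroTrace_iff hb]
  intro Φ hΦ
  have := (hasWeakCurl_iff hb _ _).mp (hasWeakCurl_toL2 hb hΦ) φ h hc hs
  rw [pairing_comm, ← this, pairing_comm]

/-! ### The energy identity and the a priori bound -/

section Energy

variable {α β : ℝ} {ε μ : R3 → Matrix (Fin 3) (Fin 3) ℂ} {κ : ℝ}

/-- Symmetry of the two curls gives `⟨w, curl u⟩ = ⟨curl w, u⟩`. After substituting the equations,
the terms `iκ⟨w, μw⟩` and `iκ` times the conjugate of `⟨u, εu⟩` stand on opposite sides, so in the
real part the two imaginary parts add up instead of cancelling. -/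
theorem energy_identity (hG : CurlPairingSymm Ω) (hε : MC α β Ω ε) (hμ : MC α β Ω μ)
    {u w g₁ g₂ : L2 Ω}
    (hu : HasWeakCurlZeroTrace Ω u (g₁ + (Complex.I * κ) • hμ.mulL2 w))
    (hw : HasWeakCurl Ω w (g₂ - (Complex.I * κ) • hε.mulL2 u)) :
    κ * ((inner ℂ u (hε.mulL2 u)).im + (inner ℂ w (hμ.mulL2 w)).im) =
      (inner ℂ w g₁).re - (inner ℂ g₂ u).re := by
  have h := hG _ _ _ _ hu hw.conj
  rw [pairing_comm, ← inner_eq_pairing, pairing_comm, ← inner_eq_pairing, inner_add_right,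
    inner_smul_right, inner_sub_left, inner_smul_left, ← inner_conj_symm (hε.mulL2 u) u] at h
  have := congrArg Complex.re h
  simp only [Complex.add_re, Complex.sub_re, Complex.mul_re, Complex.mul_im, Complex.I_re,
    Complex.I_im, Complex.conj_re, Complex.conj_im, Complex.ofReal_re, Complex.ofReal_im] at this
  linarith

theorem energy_estimate (hκ : 0 < κ) (hG : CurlPairingSymm Ω) (hε : MC α β Ω ε)
    (hμ : MC α β Ω μ) {u w g₁ g₂ : L2 Ω}
    (hu : HasWeakCurlZeroTrace Ω u (g₁ + (Complex.I * κ) • hμ.mulL2 w))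
    (hw : HasWeakCurl Ω w (g₂ - (Complex.I * κ) • hε.mulL2 u)) :
    κ * (α / 2) * (‖u‖ ^ 2 + ‖w‖ ^ 2) ≤ ‖g₁‖ * ‖w‖ + ‖g₂‖ * ‖u‖ := by
  have h := energy_identity hG hε hμ hu hw
  have h1 := hε.im_inner_ge u
  have h2 := hμ.im_inner_ge w
  have h3 : (inner ℂ w g₁).re ≤ ‖w‖ * ‖g₁‖ :=
    (Complex.re_le_norm _).trans (norm_inner_le_norm _ _)
  have h4 : -(inner ℂ g₂ u).re ≤ ‖g₂‖ * ‖u‖ :=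
    (neg_le_abs _).trans ((Complex.abs_re_le_norm _).trans (norm_inner_le_norm _ _))
  have h5 : κ * (α / 2 * ‖u‖ ^ 2 + α / 2 * ‖w‖ ^ 2) ≤
      κ * ((inner ℂ u (hε.mulL2 u)).im + (inner ℂ w (hμ.mulL2 w)).im) :=
    mul_le_mul_of_nonneg_left (add_le_add h1 h2) hκ.le
  nlinarith

/-- Combines `(s + t)² ≤ 2(s² + t²)` with `pt + qs ≤ (p + q)(s + t)`, and divides by `s + t`. -/
theorem norm_le_of_energy {a s t p q : ℝ} (ha : 0 < a) (hs : 0 ≤ s) (ht : 0 ≤ t)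
    (hp : 0 ≤ p) (hq : 0 ≤ q) (h : a * (s ^ 2 + t ^ 2) ≤ p * t + q * s) :
    s + t ≤ 2 / a * (p + q) := by
  rw [div_mul_eq_mul_div, le_div_iff₀ ha]
  by_contra! hlt
  have h1 : 0 < s + t := by
    by_contra! h0
    have : (s + t) * a ≤ 0 := mul_nonpos_of_nonpos_of_nonneg h0 ha.le
    linarith
  nlinarith [mul_pos h1 (sub_pos.mpr hlt), sq_nonneg (s - t), mul_nonneg hp hs, mul_nonneg hq ht,
    mul_nonneg ha.le (sq_nonneg (s - t))]

theorem energy_bound (hα : 0 < α) (hκ : 0 < κ) (hG : CurlPairingSymm Ω) (hε : MC α β Ω ε)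
    (hμ : MC α β Ω μ) {u w g₁ g₂ : L2 Ω}
    (hu : HasWeakCurlZeroTrace Ω u (g₁ + (Complex.I * κ) • hμ.mulL2 w))
    (hw : HasWeakCurl Ω w (g₂ - (Complex.I * κ) • hε.mulL2 u)) :
    ‖u‖ + ‖w‖ ≤ 2 / (κ * (α / 2)) * (‖g₁‖ + ‖g₂‖) :=
  norm_le_of_energy (by positivity) (norm_nonneg _) (norm_nonneg _) (norm_nonneg _)
    (norm_nonneg _) (energy_estimate hκ hG hε hμ hu hw)

end Energy

/-- A closed linear relation between Hilbert spaces that is bounded below and whose range has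
trivial orthogonal complement is onto. -/
theorem surjective_of_bounded_below {X : Type*} [NormedAddCommGroup X] [InnerProductSpace ℂ X]
    [CompleteSpace X] (G : Submodule ℂ (X × X)) (hc : IsClosed (G : Set (X × X))) (K : ℝ)
    (hK : ∀ p ∈ G, ‖p.1‖ ≤ K * ‖p.2‖)
    (hd : ∀ z : X, (∀ p ∈ G, inner ℂ z p.2 = 0) → z = 0) (y : X) :
    ∃ x, (x, y) ∈ G := by
  let T : G →ₗ[ℂ] X := (LinearMap.snd ℂ X X).comp G.subtype
  have : CompleteSpace G := hc.completeSpace_coe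
  -- The graph carries the sup norm of `X × X`, so the constant must also dominate the second
  -- component by itself; hence `max K 1`.
  have hanti : AntilipschitzWith (max K 1).toNNReal T := by
    refine AddMonoidHomClass.antilipschitz_of_bound T fun p => ?_
    have h1 : ‖(p : X × X).1‖ ≤ max K 1 * ‖(p : X × X).2‖ :=
      (hK _ p.2).trans (mul_le_mul_of_nonneg_right (le_max_left _ _) (norm_nonneg _))
    have h2 : ‖(p : X × X).2‖ ≤ max K 1 * ‖(p : X × X).2‖ :=
      le_mul_of_one_le_left (norm_nonneg _) (le_max_right _ _)
    rw [Real.coe_toNNReal _ (zero_le_one.trans (le_max_right _ _))]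
    exact max_le h1 h2
  have hT : Continuous T := continuous_snd.comp continuous_subtype_val
  have hT' : UniformContinuous T :=
    uniformContinuous_snd.comp uniformContinuous_subtype_val
  have hclosed : IsClosed (LinearMap.range T : Set X) := by
    rw [LinearMap.coe_range]
    exact hanti.isClosed_range hT'
  have htop : LinearMap.range T = ⊤ := by
    rw [← hclosed.submodule_topologicalClosure_eq, Submodule.topologicalClosure_eq_top_iff,
      Submodule.eq_bot_iff]
    intro z hz
    refine hd z fun p hp => ?_
    have := (Submodule.mem_orthogonal _ _).mp hz p.2 ⟨⟨p, hp⟩, rfl⟩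
    rw [← inner_conj_symm, this, map_zero]
  obtain ⟨p, hp⟩ := LinearMap.range_eq_top.mp htop y
  exact ⟨(p : X × X).1, by convert p.2; exact hp.symm⟩

/-! ### Solvability with homogeneous boundary condition -/

section Solvability

variable {α β : ℝ} {ε μ : R3 → Matrix (Fin 3) (Fin 3) ℂ} {κ : ℝ}

/-- The graph of the Maxwell operator with homogeneous boundary condition. -/
def maxwellGraph (hb : Bornology.IsBounded Ω) (κ : ℝ) (hε : MC α β Ω ε) (hμ : MC α β Ω μ) :
    Submodule ℂ (WithLp 2 (L2 Ω × L2 Ω) × WithLp 2 (L2 Ω × L2 Ω)) where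
  carrier := {p | HasWeakCurlZeroTrace Ω p.1.fst (p.2.fst + (Complex.I * κ) • hμ.mulL2 p.1.snd) ∧
    HasWeakCurl Ω p.1.snd (p.2.snd - (Complex.I * κ) • hε.mulL2 p.1.fst)}
  zero_mem' := by
    constructor
    · simpa using hasWeakCurlZeroTrace_zero
    · simpa using hasWeakCurlZeroTrace_zero.hasWeakCurl
  add_mem' := by
    rintro p q ⟨h1, h2⟩ ⟨h3, h4⟩
    simp only [hasWeakCurlZeroTrace_iff hb, hasWeakCurl_iff hb, Set.mem_ofPred_eq] at *
    constructor
    · intro Φ h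
      have e1 := h1 Φ h
      have e2 := h3 Φ h
      simp only [Prod.fst_add, Prod.snd_add, WithLp.add_fst, WithLp.add_snd, map_add, smul_add,
        pairing_add_left] at *
      rw [e1, e2]; ring
    · intro Φ h hc hs
      have e1 := h2 Φ h hc hs
      have e2 := h4 Φ h hc hs
      simp only [Prod.fst_add, Prod.snd_add, WithLp.add_fst, WithLp.add_snd, map_add, smul_add,
        pairing_add_left, pairing_sub_left] at *
      rw [e1, e2]; ring
  smul_mem' := by
    rintro c p ⟨h1, h2⟩
    simp only [hasWeakCurlZeroTrace_iff hb, hasWeakCurl_iff hb, Set.mem_ofPred_eq] at *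
    constructor
    · intro Φ h
      have e1 := h1 Φ h
      simp only [Prod.smul_fst, Prod.smul_snd, WithLp.smul_fst, WithLp.smul_snd, map_smul,
        pairing_add_left, pairing_smul_left] at *
      rw [e1]; ring
    · intro Φ h hc hs
      have e1 := h2 Φ h hc hs
      simp only [Prod.smul_fst, Prod.smul_snd, WithLp.smul_fst, WithLp.smul_snd, map_smul,
        pairing_sub_left, pairing_smul_left] at *
      rw [e1]; ring

/-- Both conditions are families of identities, one per test field, whose two sides are continuous
in the pair; no convergence of curls has to be discussed. -/
theorem isClosed_maxwellGraph (hb : Bornology.IsBounded Ω) (hε : MC α β Ω ε) (hμ : MC α β Ω μ) :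
    IsClosed (maxwellGraph hb κ hε hμ : Set (WithLp 2 (L2 Ω × L2 Ω) × WithLp 2 (L2 Ω × L2 Ω))) := by
  have e : (maxwellGraph hb κ hε hμ : Set (WithLp 2 (L2 Ω × L2 Ω) × WithLp 2 (L2 Ω × L2 Ω))) =
      {p | HasWeakCurlZeroTrace Ω p.1.fst (p.2.fst + (Complex.I * κ) • hμ.mulL2 p.1.snd)} ∩
      {p | HasWeakCurl Ω p.1.snd (p.2.snd - (Complex.I * κ) • hε.mulL2 p.1.fst)} := rfl
  have c1 : Continuous fun x : WithLp 2 (L2 Ω × L2 Ω) => x.fst :=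
    continuous_fst.comp (WithLp.prod_continuous_ofLp 2 _ _)
  have c2 : Continuous fun x : WithLp 2 (L2 Ω × L2 Ω) => x.snd :=
    continuous_snd.comp (WithLp.prod_continuous_ofLp 2 _ _)
  rw [e]
  simp only [hasWeakCurlZeroTrace_iff hb, hasWeakCurl_iff hb, Set.ofPred_forall]
  refine IsClosed.inter ?_ ?_
  · refine isClosed_iInter fun Φ => isClosed_iInter fun h => isClosed_eq ?_ ?_
    · exact (continuous_pairing_left _).comp (by fun_prop)
    · exact (continuous_pairing_left _).comp (by fun_prop)
  · refine isClosed_iInter fun Φ => isClosed_iInter fun h => isClosed_iInter fun _ =>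
      isClosed_iInter fun _ => isClosed_eq ?_ ?_
    · exact (continuous_pairing_left _).comp (by fun_prop)
    · exact (continuous_pairing_left _).comp (by fun_prop)

-- Orthogonality tested with smooth fields in the second slot says that `z.snd` has vanishing trace
-- and curl `-iκ μ* z.fst`. So `z.snd` is itself admissible in the first slot, and inserting it
-- gives `⟨z.snd, ε z.snd⟩ = conj ⟨z.fst, μ z.fst⟩`. The imaginary part is nonnegative on the left
-- and nonpositive on the right, and both are definite.
set_option maxHeartbeats 1000000 in
theorem eq_zero_of_orthogonal_maxwellGraph (hb : Bornology.IsBounded Ω) (hα : 0 < α) (hκ : 0 < κ)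
    (hε : MC α β Ω ε) (hμ : MC α β Ω μ) (z : WithLp 2 (L2 Ω × L2 Ω))
    (hz : ∀ p ∈ maxwellGraph hb κ hε hμ, inner ℂ z p.2 = 0) : z = 0 := by
  have key : ∀ u v w c, HasWeakCurlZeroTrace Ω u v → HasWeakCurl Ω w c →
      inner ℂ z.fst (v - (Complex.I * κ) • hμ.mulL2 w) +
        inner ℂ z.snd (c + (Complex.I * κ) • hε.mulL2 u) = 0 := by
    intro u v w c h1 h2
    exact hz (WithLp.toLp 2 (u, w), WithLp.toLp 2 (v - (Complex.I * κ) • hμ.mulL2 w,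
      c + (Complex.I * κ) • hε.mulL2 u)) ⟨by simpa using h1, by simpa using h2⟩
  have h00 : HasWeakCurlZeroTrace Ω (0 : L2 Ω) 0 := hasWeakCurlZeroTrace_zero
  have key1 : ∀ u v, HasWeakCurlZeroTrace Ω u v →
      inner ℂ z.fst v + (Complex.I * κ) * inner ℂ z.snd (hε.mulL2 u) = 0 := by
    intro u v h
    simpa [inner_smul_right] using key u v 0 0 h h00.hasWeakCurl
  have key2 : ∀ w c, HasWeakCurl Ω w c →
      inner ℂ z.snd c - (Complex.I * κ) * inner ℂ z.fst (hμ.mulL2 w) = 0 := by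
    intro w c h
    have := key 0 0 w c h00 h
    simp only [zero_sub, map_zero, smul_zero, add_zero, inner_neg_right, inner_smul_right] at this
    rw [sub_eq_neg_add]; exact this
  have hz1 : HasWeakCurl Ω z.fst ((Complex.I * κ) • ContinuousLinearMap.adjoint hε.mulL2 z.snd) := by
    suffices h : HasWeakCurl Ω (conjL2 z.fst)
        (conjL2 ((Complex.I * κ) • ContinuousLinearMap.adjoint hε.mulL2 z.snd)) by simpa using h.conj
    rw [hasWeakCurl_iff hb]
    intro φ h hc hs
    have hφ : HasWeakCurlZeroTrace Ω (toL2 hb _ h.continuous)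
        (toL2 hb _ (contDiff_classicalCurl h).continuous) := by
      exact hasWeakCurlZeroTrace_toL2 hb h hc hs
    have := key1 _ _ hφ
    rw [← inner_eq_pairing, ← inner_eq_pairing, inner_smul_left, ContinuousLinearMap.adjoint_inner_left]
    simp only [map_mul, Complex.conj_I, Complex.conj_ofReal]
    linear_combination this
  have hz2 : HasWeakCurlZeroTrace Ω z.snd ((-(Complex.I * κ)) • ContinuousLinearMap.adjoint hμ.mulL2 z.fst) := by
    suffices h : HasWeakCurlZeroTrace Ω (conjL2 z.snd)
        (conjL2 ((-(Complex.I * κ)) • ContinuousLinearMap.adjoint hμ.mulL2 z.fst)) by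
      simpa using h.conj
    rw [hasWeakCurlZeroTrace_iff hb]
    intro φ h
    have hφ : HasWeakCurl Ω (toL2 hb _ h.continuous)
        (toL2 hb _ (contDiff_classicalCurl h).continuous) := by
      exact hasWeakCurl_toL2 hb h
    have := key2 _ _ hφ
    rw [← inner_eq_pairing z.snd, ← inner_eq_pairing (_ • _), inner_smul_left,
      ContinuousLinearMap.adjoint_inner_left]
    simp only [map_mul, map_neg, Complex.conj_I, Complex.conj_ofReal]
    linear_combination this
  have e1 := key1 _ _ hz2
  rw [inner_smul_right, ContinuousLinearMap.adjoint_inner_right,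
    ← inner_conj_symm (hμ.mulL2 z.fst) z.fst] at e1
  have hκ' : (Complex.I * κ : ℂ) ≠ 0 := mul_ne_zero Complex.I_ne_zero (by exact_mod_cast hκ.ne')
  have e2 : inner ℂ z.snd (hε.mulL2 z.snd) = star (inner ℂ z.fst (hμ.mulL2 z.fst)) := by
    apply mul_left_cancel₀ hκ'
    rw [← starRingEnd_apply]
    linear_combination e1
  have e3 := congrArg Complex.im e2
  rw [← starRingEnd_apply, Complex.conj_im] at e3
  have h1 := hε.im_inner_ge z.snd
  have h2 := hμ.im_inner_ge z.fst
  have h3 : ‖z‖ ^ 2 = 0 := by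
    rw [WithLp.prod_norm_sq_eq_of_L2]
    nlinarith [sq_nonneg ‖z.fst‖, sq_nonneg ‖z.snd‖]
  exact norm_eq_zero.mp (pow_eq_zero_iff (two_ne_zero) |>.mp h3)

theorem exists_homogeneous_solution (hb : Bornology.IsBounded Ω) (hα : 0 < α) (hκ : 0 < κ)
    (hG : CurlPairingSymm Ω) (hε : MC α β Ω ε) (hμ : MC α β Ω μ) (g₁ g₂ : L2 Ω) :
    ∃ u w : L2 Ω, HasWeakCurlZeroTrace Ω u (g₁ + (Complex.I * κ) • hμ.mulL2 w) ∧
      HasWeakCurl Ω w (g₂ - (Complex.I * κ) • hε.mulL2 u) := by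
  -- The extra factor 2 replaces the sum of the norms of the two sources by twice the norm of the
  -- pair.
  suffices hK : ∀ p ∈ maxwellGraph hb κ hε hμ, ‖p.1‖ ≤ 2 / (κ * (α / 2)) * 2 * ‖p.2‖ by
    obtain ⟨x, hx⟩ := surjective_of_bounded_below (maxwellGraph hb κ hε hμ)
      (isClosed_maxwellGraph hb hε hμ) _ hK
      (eq_zero_of_orthogonal_maxwellGraph hb hα hκ hε hμ) (WithLp.toLp 2 (g₁, g₂))
    exact ⟨x.fst, x.snd, hx.1, hx.2⟩
  · intro p hp
    have h1 := energy_bound hα hκ hG hε hμ hp.1 hp.2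
    have h2 : ‖p.1‖ ≤ ‖p.1.fst‖ + ‖p.1.snd‖ := by
      refine abs_le_of_sq_le_sq' ?_ (by positivity) |>.2
      rw [WithLp.prod_norm_sq_eq_of_L2]
      nlinarith [norm_nonneg p.1.fst, norm_nonneg p.1.snd]
    have h3 : ‖p.2.fst‖ ≤ ‖p.2‖ := WithLp.norm_fst_le _ _
    have h4 : ‖p.2.snd‖ ≤ ‖p.2‖ := WithLp.norm_snd_le _ _
    calc ‖p.1‖ ≤ _ := h2.trans h1
      _ ≤ 2 / (κ * (α / 2)) * (‖p.2‖ + ‖p.2‖) := by gcongr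
      _ = _ := by ring

end Solvability

/-- The tangential trace has a bounded right inverse on `H^{-1/2}(div, ∂Ω)`. -/
def HasTangentialLifting (Ω : Set R3) : Prop :=
  ∃ C : ℝ, 0 ≤ C ∧ ∀ f : HMinusHalfDiv Ω, ∃ u : Hcurl Ω,
    HasTangentialTrace u (f : BdryFunctional Ω C3) ∧ hcurlNorm u ≤ C * hMinusHalfDivNorm f

/-! ### The Maxwell system, assuming the adjointness of the curls and a lifting -/

section MaxwellSystem

variable {α β : ℝ} {ε μ : R3 → Matrix (Fin 3) (Fin 3) ℂ} {κ : ℝ}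

theorem MC.eq_smul_mulL2_iff (hμ : MC α β Ω μ) (c : ℂ) (v w : L2 Ω) :
    v = c • hμ.mulL2 w ↔ ∀ᵐ x ∂volume.restrict Ω, v x = c • matVec (μ x) (w x) := by
  constructor
  · intro h
    filter_upwards [hμ.coeFn_mulL2 w, Lp.coeFn_smul c (hμ.mulL2 w)] with x h1 h2
    rw [h, h2, Pi.smul_apply, h1]
  · intro h
    apply Lp.ext
    filter_upwards [h, hμ.coeFn_mulL2 w, Lp.coeFn_smul c (hμ.mulL2 w)] with x h0 h1 h2
    rw [h0, h2, Pi.smul_apply, h1]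

theorem isMaxwellSolution_iff (hε : MC α β Ω ε) (hμ : MC α β Ω μ) (f : HMinusHalfDiv Ω)
    (E H : Hcurl Ω) : IsMaxwellSolution ε μ κ f E H ↔
      curl E = (Complex.I * κ) • hμ.mulL2 (H : L2 Ω) ∧
      curl H = (-Complex.I * κ) • hε.mulL2 (E : L2 Ω) ∧
      HasTangentialTrace E (f : BdryFunctional Ω C3) := by
  rw [hμ.eq_smul_mulL2_iff, hε.eq_smul_mulL2_iff]
  exact ⟨fun h => ⟨h.1, h.2, h.3⟩, fun h => ⟨h.1, h.2.1, h.2.2⟩⟩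

theorem hasWeakCurlZeroTrace_sub (hb : Bornology.IsBounded Ω) {E E' : Hcurl Ω}
    {f : BdryFunctional Ω C3} (h : HasTangentialTrace E f) (h' : HasTangentialTrace E' f) :
    HasWeakCurlZeroTrace Ω ((E : L2 Ω) - E') (curl E - curl E') := by
  rw [hasWeakCurlZeroTrace_iff hb]
  rw [hasTangentialTrace_iff hb] at h h'
  intro Φ hΦ
  rw [pairing_sub_left, pairing_sub_left]
  linear_combination h' Φ hΦ - h Φ hΦ

theorem HasTangentialTrace.add_zeroTrace (hΩ : IsOpen Ω) (hb : Bornology.IsBounded Ω)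
    {E F : Hcurl Ω} {f : BdryFunctional Ω C3} (h : HasTangentialTrace E f) {v : L2 Ω}
    (hF : HasWeakCurlZeroTrace Ω ((F : L2 Ω) - E) v) : HasTangentialTrace F f := by
  have hc : curl F = curl E + v := by
    apply curl_eq hΩ hb
    simpa using (hasWeakCurl_curl E).add hb hF.hasWeakCurl
  rw [hasTangentialTrace_iff hb] at h ⊢
  rw [hasWeakCurlZeroTrace_iff hb] at hF
  intro Φ hΦ
  have := hF Φ hΦ
  rw [pairing_sub_left] at this
  rw [hc, pairing_add_left]
  linear_combination h Φ hΦ - this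

theorem norm_le_hcurlNorm (u : Hcurl Ω) : ‖(u : L2 Ω)‖ ≤ hcurlNorm u :=
  Real.le_sqrt_of_sq_le (le_add_of_nonneg_right (sq_nonneg _))

theorem norm_curl_le_hcurlNorm (u : Hcurl Ω) : ‖curl u‖ ≤ hcurlNorm u :=
  Real.le_sqrt_of_sq_le (le_add_of_nonneg_left (sq_nonneg _))

theorem hcurlNorm_le (u : Hcurl Ω) : hcurlNorm u ≤ ‖(u : L2 Ω)‖ + ‖curl u‖ := by
  refine Real.sqrt_le_iff.mpr ⟨by positivity, ?_⟩
  nlinarith [norm_nonneg (u : L2 Ω), norm_nonneg (curl u)]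

/-- Subtracting a lift `E₀` of the datum turns the boundary condition into the sources `-curl E₀`
and `-iκ ε E₀` of a problem with zero trace. -/
theorem IsMaxwellSolution.difference (hb : Bornology.IsBounded Ω)
    (hε : MC α β Ω ε) (hμ : MC α β Ω μ) {f : HMinusHalfDiv Ω} {E H E₀ : Hcurl Ω}
    (h : IsMaxwellSolution ε μ κ f E H)
    (h₀ : HasTangentialTrace E₀ (f : BdryFunctional Ω C3)) :
    HasWeakCurlZeroTrace Ω ((E : L2 Ω) - E₀)
        (-curl E₀ + (Complex.I * κ) • hμ.mulL2 (H : L2 Ω)) ∧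
      HasWeakCurl Ω (H : L2 Ω) (-((Complex.I * κ) • hε.mulL2 (E₀ : L2 Ω)) -
        (Complex.I * κ) • hε.mulL2 ((E : L2 Ω) - E₀)) := by
  rw [isMaxwellSolution_iff hε hμ] at h
  obtain ⟨h1, h2, h3⟩ := h
  constructor
  · have := hasWeakCurlZeroTrace_sub hb h3 h₀
    rw [h1] at this
    convert this using 1
    abel
  · have := hasWeakCurl_curl H
    rw [h2] at this
    convert this using 1
    rw [map_sub]
    module

theorem maxwell_wellposed (hΩ : IsOpen Ω) (hb : Bornology.IsBounded Ω) (hG : CurlPairingSymm Ω)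
    (hT : HasTangentialLifting Ω) {α β κ : ℝ} (hα : 0 < α) (hαβ : α < β) (hκ : 0 < κ) :
    ∃ C : ℝ, 0 < C ∧ ∀ ε μ : R3 → Matrix (Fin 3) (Fin 3) ℂ, MC α β Ω ε → MC α β Ω μ →
      ∀ f : HMinusHalfDiv Ω, (∃! p : Hcurl Ω × Hcurl Ω, IsMaxwellSolution ε μ κ f p.1 p.2) ∧
        ∀ E H : Hcurl Ω, IsMaxwellSolution ε μ κ f E H →
          hcurlNorm E + hcurlNorm H ≤ C * hMinusHalfDivNorm f := by
  obtain ⟨C₀, hC₀, hlift⟩ := hT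
  have hβ : 0 < β := hα.trans hαβ
  have hnI : ‖(Complex.I * κ : ℂ)‖ = κ := by simp [abs_of_pos hκ]
  have hnI' : ‖(-Complex.I * κ : ℂ)‖ = κ := by simp [abs_of_pos hκ]
  -- The first factor recovers the curls from the fields through the equations, the second is the
  -- energy bound with the sources `-curl E₀` and `-iκ ε E₀` plus `E₀` itself, and `C₀` is the
  -- lifting constant. The summand 1 only ensures positivity when `C₀ = 0`.
  refine ⟨(1 + κ * β) * (1 + 2 / (κ * (α / 2)) * (1 + κ * β)) * C₀ + 1, by positivity,
    fun ε μ hε hμ f => ⟨?_, fun E H h => ?_⟩⟩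
  · obtain ⟨E₀, hE₀, -⟩ := hlift f
    obtain ⟨u, w, hu, hw⟩ := exists_homogeneous_solution hb hα hκ hG hε hμ (-curl E₀)
      (-((Complex.I * κ) • hε.mulL2 (E₀ : L2 Ω)))
    have hE := (hasWeakCurl_curl E₀).add hb hu.hasWeakCurl
    let E : Hcurl Ω := ⟨(E₀ : L2 Ω) + u, _, hE⟩
    let H : Hcurl Ω := ⟨w, _, hw⟩
    have hsol : IsMaxwellSolution ε μ κ f E H := by
      rw [isMaxwellSolution_iff hε hμ]
      refine ⟨?_, ?_, hE₀.add_zeroTrace hΩ hb (F := E) (by simpa [E] using hu)⟩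
      · rw [curl_eq hΩ hb (u := E) hE]
        simp [H]
      · rw [curl_eq hΩ hb (u := H) hw]
        simp only [E, map_add]
        module
    refine ⟨(E, H), hsol, fun p hp => ?_⟩
    obtain ⟨d1, d2⟩ := hsol.difference hb hε hμ hE₀
    obtain ⟨d3, d4⟩ := hp.difference hb hε hμ hE₀
    -- Uniqueness: the difference of two solutions has vanishing trace and solves the system with
    -- zero sources.
    have d5 := energy_bound (u := (p.1 : L2 Ω) - E) (w := (p.2 : L2 Ω) - H) (g₁ := 0) (g₂ := 0)
      hα hκ hG hε hμ ?_ ?_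
    · simp only [norm_zero, add_zero, mul_zero] at d5
      have n1 := norm_nonneg ((p.1 : L2 Ω) - E)
      have n2 := norm_nonneg ((p.2 : L2 Ω) - H)
      refine Prod.ext (Subtype.ext ?_) (Subtype.ext ?_)
      · exact sub_eq_zero.mp (norm_eq_zero.mp (by linarith))
      · exact sub_eq_zero.mp (norm_eq_zero.mp (by linarith))
    · have := hasWeakCurlZeroTrace_sub hb hp.trace_E hsol.trace_E
      convert this using 1
      rw [((isMaxwellSolution_iff hε hμ f _ _).mp hp).1,
        ((isMaxwellSolution_iff hε hμ f _ _).mp hsol).1, map_sub]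
      module
    · have := (hasWeakCurl_curl p.2).sub hb (hasWeakCurl_curl H)
      convert this using 1
      rw [((isMaxwellSolution_iff hε hμ f _ _).mp hp).2.1,
        ((isMaxwellSolution_iff hε hμ f _ _).mp hsol).2.1, map_sub]
      module
  · obtain ⟨E₀, hE₀, hN⟩ := hlift f
    obtain ⟨d1, d2⟩ := h.difference hb hε hμ hE₀
    have h1 := energy_bound hα hκ hG hε hμ d1 d2
    rw [norm_neg, norm_neg, norm_smul, hnI] at h1
    obtain ⟨e1, e2, -⟩ := (isMaxwellSolution_iff hε hμ f E H).mp h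
    have c1 : ‖curl E‖ ≤ κ * β * ‖(H : L2 Ω)‖ := by
      rw [e1, norm_smul, hnI, mul_assoc]
      exact mul_le_mul_of_nonneg_left (hμ.norm_mulL2_le _) hκ.le
    have c2 : ‖curl H‖ ≤ κ * β * ‖(E : L2 Ω)‖ := by
      rw [e2, norm_smul, hnI', mul_assoc]
      exact mul_le_mul_of_nonneg_left (hε.norm_mulL2_le _) hκ.le
    have n0 := norm_le_hcurlNorm E₀
    have n1 := norm_curl_le_hcurlNorm E₀
    have n2 : ‖(E : L2 Ω)‖ ≤ ‖(E : L2 Ω) - E₀‖ + ‖(E₀ : L2 Ω)‖ := by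
      simpa using norm_add_le ((E : L2 Ω) - E₀) (E₀ : L2 Ω)
    have n3 : ‖hε.mulL2 (E₀ : L2 Ω)‖ ≤ β * hcurlNorm E₀ :=
      (hε.norm_mulL2_le _).trans (mul_le_mul_of_nonneg_left n0 hβ.le)
    have h2 : ‖(E : L2 Ω) - E₀‖ + ‖(H : L2 Ω)‖ ≤
        2 / (κ * (α / 2)) * ((1 + κ * β) * hcurlNorm E₀) := by
      refine h1.trans (mul_le_mul_of_nonneg_left ?_ (by positivity))
      have := mul_le_mul_of_nonneg_left n3 hκ.le
      linarith
    have hf : 0 ≤ hMinusHalfDivNorm f := Real.sqrt_nonneg _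
    calc hcurlNorm E + hcurlNorm H
        ≤ (1 + κ * β) * (‖(E : L2 Ω)‖ + ‖(H : L2 Ω)‖) := by
          have := hcurlNorm_le E
          have := hcurlNorm_le H
          linarith
      _ ≤ (1 + κ * β) * ((1 + 2 / (κ * (α / 2)) * (1 + κ * β)) * hcurlNorm E₀) := by
          refine mul_le_mul_of_nonneg_left ?_ (by positivity)
          linarith
      _ ≤ (1 + κ * β) * ((1 + 2 / (κ * (α / 2)) * (1 + κ * β)) * (C₀ * hMinusHalfDivNorm f)) := by
          gcongr
      _ = (1 + κ * β) * (1 + 2 / (κ * (α / 2)) * (1 + κ * β)) * C₀ * hMinusHalfDivNorm f := by ring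
      _ ≤ _ := by linarith

end MaxwellSystem

/-! ### Partitions of unity and graph charts of the boundary -/

theorem exists_smooth_partition {K : Set R3} (hK : IsCompact K) (W : R3 → Set R3)
    (hW : ∀ x ∈ K, W x ∈ 𝓝 x) : ∃ (s : Finset R3) (χ : R3 → R3 → ℝ), (∀ c ∈ s, c ∈ K) ∧
      (∀ c ∈ s, ContDiff ℝ ∞ (χ c) ∧ HasCompactSupport (χ c) ∧ tsupport (χ c) ⊆ W c) ∧
      ∀ x ∈ K, ∑ c ∈ s, χ c x = 1 := by
  -- Intersecting with unit balls forces the supports in the partition to be compact.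
  have hU : ∀ x ∈ K, interior (W x) ∩ Metric.ball x 1 ∈ 𝓝 x := fun x hx =>
    inter_mem (interior_mem_nhds.mpr (hW x hx)) (Metric.ball_mem_nhds x one_pos)
  obtain ⟨t, htK, ht⟩ := hK.elim_nhds_subcover _ hU
  obtain ⟨f, hf⟩ := SmoothPartitionOfUnity.exists_isSubordinate (modelWithCornersSelf ℝ R3)
    hK.isClosed (fun i : t => interior (W i) ∩ Metric.ball (i : R3) 1)
    (fun i => isOpen_interior.inter Metric.isOpen_ball) (by
      intro x hx
      obtain ⟨c, hc, hxc⟩ := Set.mem_iUnion₂.mp (ht hx)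
      exact Set.mem_iUnion.mpr ⟨⟨c, hc⟩, hxc⟩)
  classical
  refine ⟨t, fun c => if h : c ∈ t then f ⟨c, h⟩ else 0, htK, fun c hc => ?_, fun x hx => ?_⟩
  · simp only [hc, dif_pos]
    refine ⟨(f ⟨c, hc⟩).contMDiff.contDiff, ?_, (hf ⟨c, hc⟩).trans
      (Set.inter_subset_left.trans interior_subset)⟩
    exact (isCompact_closedBall c 1).of_isClosed_subset (isClosed_tsupport _)
      ((hf ⟨c, hc⟩).trans (Set.inter_subset_right.trans Metric.ball_subset_closedBall))
  · have h1 := f.sum_eq_one hx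
    rw [finsum_eq_sum_of_fintype] at h1
    rw [← h1, ← Finset.sum_coe_sort t]
    refine Finset.sum_congr rfl fun i _ => ?_
    simp

/-- The Euclidean plane. -/
abbrev R2 := EuclideanSpace ℝ (Fin 2)

/-- The projection of `ℝ³` along the `k`-th axis, with coordinates in cyclic order. -/
def planeProj (k : Fin 3) : R3 →L[ℝ] R2 :=
  LinearMap.toContinuousLinearMap
    { toFun := fun x => !₂[x (k + 1), x (k + 2)]
      map_add' := fun x y => by ext i; fin_cases i <;> simp
      map_smul' := fun c x => by ext i; fin_cases i <;> simp }

@[simp] theorem planeProj_zero (k : Fin 3) (x : R3) : planeProj k x 0 = x (k + 1) := rfl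

@[simp] theorem planeProj_one (k : Fin 3) (x : R3) : planeProj k x 1 = x (k + 2) := rfl

/-- The point of `ℝ³` with `k`-th coordinate `p.2` and projection `p.1`. -/
def axisLift (k : Fin 3) : R2 × ℝ →L[ℝ] R3 :=
  LinearMap.toContinuousLinearMap
    { toFun := fun p => EuclideanSpace.single k p.2 + EuclideanSpace.single (k + 1) (p.1 0) +
        EuclideanSpace.single (k + 2) (p.1 1)
      map_add' := fun x y => by ext i; fin_cases k <;> fin_cases i <;> simp
      map_smul' := fun c x => by ext i; fin_cases k <;> fin_cases i <;> simp }

@[simp] theorem axisLift_self (k : Fin 3) (p : R2 × ℝ) : axisLift k p k = p.2 := by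
  fin_cases k <;> simp [axisLift]

@[simp] theorem axisLift_add_one (k : Fin 3) (p : R2 × ℝ) : axisLift k p (k + 1) = p.1 0 := by
  fin_cases k <;> simp [axisLift]

@[simp] theorem axisLift_add_two (k : Fin 3) (p : R2 × ℝ) : axisLift k p (k + 2) = p.1 1 := by
  fin_cases k <;> simp [axisLift]

@[simp] theorem planeProj_axisLift (k : Fin 3) (p : R2 × ℝ) : planeProj k (axisLift k p) = p.1 := by
  ext i; fin_cases i <;> simp

theorem ext_cyclic {F : Type*} {u v : Fin 3 → F} (k : Fin 3) (h0 : u k = v k)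
    (h1 : u (k + 1) = v (k + 1)) (h2 : u (k + 2) = v (k + 2)) : u = v := by
  funext i
  fin_cases k <;> fin_cases i <;> first | exact h0 | exact h1 | exact h2

theorem axisLift_planeProj (k : Fin 3) (x : R3) : axisLift k (planeProj k x, x k) = x := by
  have : (axisLift k (planeProj k x, x k)).ofLp = x.ofLp :=
    ext_cyclic k (by simp) (by simp) (by simp)
  exact PiLp.ext (congrFun this)

theorem sum_cyclic {F : Type*} [AddCommMonoid F] (f : Fin 3 → F) (k : Fin 3) :
    ∑ i, f i = f k + f (k + 1) + f (k + 2) := by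
  rw [Fin.sum_univ_three]
  fin_cases k <;> simp <;> abel

/-- In the open set `V`, the domain `Ω` is the part of space on the side `σ` of the graph of `g`
over the plane orthogonal to the `k`-th axis. -/
structure IsGraphChart (Ω : Set R3) (k : Fin 3) (σ : ℝ) (g : R2 → ℝ) (V : Set R3) : Prop where
  sign : σ = 1 ∨ σ = -1
  smooth : ContDiff ℝ ∞ g
  compact : HasCompactSupport g
  isOpen : IsOpen V
  mem_iff : ∀ x ∈ V, x ∈ Ω ↔ 0 < σ * (x k - g (planeProj k x))

/-- The map `(y, t) ↦ (y, f (y, t))` is a local diffeomorphism, and `g y` is the height of its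
inverse at `(y, 0)`. On a small box `f` increases strictly in `t`, so its sign decides on which side
of the graph a point lies. The radius `r` of smoothness is fixed before the box, whose horizontal
radius is strictly smaller; this leaves room for a cutoff of `g`. -/
theorem exists_implicit_graph {f : R2 × ℝ → ℝ} (hf : ContDiff ℝ ∞ f) {y₀ : R2} {t₀ : ℝ}
    (h0 : f (y₀, t₀) = 0) (hd : 0 < fderiv ℝ f (y₀, t₀) (0, 1)) :
    ∃ (g : R2 → ℝ) (r : ℝ), 0 < r ∧ ContDiffOn ℝ ∞ g (Metric.ball y₀ r) ∧
      ∀ r' > 0, ∃ δ > 0, ∃ r'' > 0, r'' < r ∧ δ < r' ∧ r'' < r' ∧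
        ∀ y ∈ Metric.ball y₀ r'', ∀ t ∈ Metric.ball t₀ δ,
        (0 < f (y, t) ↔ g y < t) ∧ (f (y, t) < 0 ↔ t < g y) := by
  let F : R2 × ℝ → R2 × ℝ := fun p => (p.1, f p)
  have hF : ContDiff ℝ ∞ F := contDiff_fst.prodMk hf
  have hequiv : ∀ p, fderiv ℝ f p (0, 1) ≠ 0 → ∃ e : (R2 × ℝ) ≃L[ℝ] (R2 × ℝ),
      HasFDerivAt F (e : R2 × ℝ →L[ℝ] R2 × ℝ) p := by
    intro p hp
    let L : R2 × ℝ →L[ℝ] R2 × ℝ := (ContinuousLinearMap.fst ℝ R2 ℝ).prod (fderiv ℝ f p)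
    have hL : Function.Injective L.toLinearMap := by
      rw [← LinearMap.ker_eq_bot, LinearMap.ker_eq_bot']
      rintro ⟨a, b⟩ hab
      have h1 : a = 0 := congrArg Prod.fst hab
      have h2 : fderiv ℝ f p (a, b) = 0 := congrArg Prod.snd hab
      rw [h1, show ((0 : R2), b) = b • ((0 : R2), (1 : ℝ)) by simp, map_smul, smul_eq_mul] at h2
      simp [h1, (mul_eq_zero.mp h2).resolve_right hp]
    refine ⟨(LinearEquiv.ofInjectiveEndo L.toLinearMap hL).toContinuousLinearEquiv, ?_⟩
    have : HasFDerivAt F L p :=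
      hasFDerivAt_fst.prodMk (hf.differentiable (by simp) p).hasFDerivAt
    convert this using 1
    ext v <;> rfl
  obtain ⟨e₀, he₀⟩ := hequiv _ hd.ne'
  let e := hF.contDiffAt.toOpenPartialHomeomorph F he₀ (by simp)
  have heF : ∀ p, e p = F p := fun p => rfl
  have hmem : (y₀, t₀) ∈ e.source := hF.contDiffAt.mem_toOpenPartialHomeomorph_source he₀ (by simp)
  have hpos : ∀ᶠ p in 𝓝 (y₀, t₀), 0 < fderiv ℝ f p (0, 1) := by
    have : Continuous fun p => fderiv ℝ f p ((0, 1) : R2 × ℝ) :=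
      ((hf.fderiv_right (m := ∞) (by simp)).clm_apply contDiff_const).continuous
    exact this.continuousAt.eventually (lt_mem_nhds hd)
  have hF0 : F (y₀, t₀) = (y₀, 0) := by simp [F, h0]
  have hsymm0 : e.symm (y₀, 0) = (y₀, t₀) := by
    rw [← hF0]; exact e.left_inv hmem
  have htgt : (y₀, (0 : ℝ)) ∈ e.target := by rw [← hF0]; exact e.map_source hmem
  let g : R2 → ℝ := fun y => (e.symm (y, 0)).2
  have hsymm_cont : ContinuousAt (fun y : R2 => e.symm (y, (0 : ℝ))) y₀ :=
    (e.continuousAt_symm htgt).comp (f := fun y : R2 => (y, (0 : ℝ))) (by fun_prop)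
  -- The inverse is known to be smooth only at images of points where the derivative is invertible,
  -- so positivity of the vertical derivative must persist along the whole graph piece.
  have hgood : ∀ᶠ y in 𝓝 y₀, (y, (0 : ℝ)) ∈ e.target ∧ 0 < fderiv ℝ f (e.symm (y, 0)) (0, 1) := by
    refine Filter.Eventually.and ?_ ?_
    · exact (Continuous.continuousAt (by fun_prop : Continuous fun y : R2 => (y, (0 : ℝ)))).eventually
        (e.open_target.mem_nhds htgt)
    · exact hsymm_cont.eventually (by simpa only [hsymm0] using hpos)
  obtain ⟨r, hr, hball⟩ := Metric.eventually_nhds_iff_ball.mp hgood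
  refine ⟨g, r, hr, fun y hy => ?_, fun r' hr' => ?_⟩
  · obtain ⟨h1, h2⟩ := hball y hy
    obtain ⟨e', he'⟩ := hequiv _ h2.ne'
    have h3 : ContDiffAt ℝ ∞ e.symm (y, (0 : ℝ)) := e.contDiffAt_symm h1 he' hF.contDiffAt
    have h4 : ContDiffAt ℝ ∞ (fun z : R2 => e.symm (z, (0 : ℝ))) y :=
      h3.comp y (f := fun z : R2 => (z, (0 : ℝ))) (by fun_prop)
    exact (contDiff_snd.contDiffAt.comp y h4).contDiffWithinAt
  · have hnear := hpos
    rw [Metric.eventually_nhds_iff_ball] at hnear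
    obtain ⟨δ₀, hδ₀, hδ⟩ := hnear
    rw [← ball_prod_same] at hδ
    set δ := min δ₀ (r' / 2) with hδdef
    have hδpos : 0 < δ := lt_min hδ₀ (by linarith)
    have hg0 : g y₀ = t₀ := by simp [g, hsymm0]
    have hgcont : ContinuousAt g y₀ := continuous_snd.continuousAt.comp hsymm_cont
    have hgnear : ∀ᶠ y in 𝓝 y₀, g y ∈ Metric.ball t₀ δ :=
      hgcont.eventually (by rw [hg0]; exact Metric.ball_mem_nhds _ hδpos)
    obtain ⟨r₁, hr₁, hb₁⟩ := Metric.eventually_nhds_iff_ball.mp hgnear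
    refine ⟨δ, hδpos, min (min r₁ δ) (r / 2), by positivity, ?_, ?_, ?_, ?_⟩
    · exact (min_le_right _ _).trans_lt (by linarith)
    · exact (min_le_right _ _).trans_lt (by linarith)
    · exact ((min_le_left _ _).trans (min_le_right _ _)).trans_lt
        ((min_le_right _ _).trans_lt (by linarith))
    · intro y hy t ht
      have hy1 : y ∈ Metric.ball y₀ r₁ :=
        Metric.ball_subset_ball ((min_le_left _ _).trans (min_le_left _ _)) hy
      have hy2 : y ∈ Metric.ball y₀ δ₀ :=
        Metric.ball_subset_ball (((min_le_left _ _).trans (min_le_right _ _)).trans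
          (min_le_left _ _)) hy
      have hy3 : y ∈ Metric.ball y₀ r :=
        Metric.ball_subset_ball ((min_le_right _ _).trans (by linarith)) hy
      have hderiv : ∀ s, HasDerivAt (fun s => f (y, s)) (fderiv ℝ f (y, s) (0, 1)) s := fun s =>
        (hf.differentiable (by simp) (y, s)).hasFDerivAt.comp_hasDerivAt s
          ((hasDerivAt_const s y).prodMk (hasDerivAt_id s))
      have hmono : StrictMonoOn (fun s => f (y, s)) (Metric.ball t₀ δ) := by
        refine strictMonoOn_of_deriv_pos (convex_ball t₀ δ)
          (fun s _ => (hderiv s).continuousAt.continuousWithinAt) fun s hs => ?_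
        rw [(hderiv s).deriv]
        rw [Metric.isOpen_ball.interior_eq] at hs
        exact hδ _ ⟨hy2, Metric.ball_subset_ball (min_le_left _ _) hs⟩
      have hfg : f (y, g y) = 0 := by
        have h1 := e.right_inv (hball y hy3).1
        rw [heF] at h1
        have h2 : (e.symm (y, 0)).1 = y := congrArg Prod.fst h1
        have h3 : f (e.symm (y, 0)) = 0 := congrArg Prod.snd h1
        rw [← h3]
        congr 1
        exact Prod.ext h2.symm rfl
      have hgy := hb₁ y hy1
      constructor
      · rw [← hfg]; exact hmono.lt_iff_lt hgy ht
      · rw [← hfg]; exact hmono.lt_iff_lt ht hgy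

-- Some coordinate derivative of a defining function `ρ` is nonzero. The sign `σ` is chosen so that
-- `-σρ` increases in that coordinate, and the implicit function theorem presents the boundary as a
-- graph.
set_option maxHeartbeats 400000 in
theorem exists_isGraphChart {Ω : Set R3} (hΩ : IsSmoothBoundedDomain Ω) {x₀ : R3}
    (hx₀ : x₀ ∈ frontier Ω) : ∃ k σ g V, IsGraphChart Ω k σ g V ∧ x₀ ∈ V := by
  obtain ⟨U, ρ, hρ⟩ := hΩ.smooth_boundary x₀ hx₀
  have hρ0 := hρ.eq_zero hΩ.isOpen hx₀
  have hk : ∃ k : Fin 3, fderiv ℝ ρ x₀ (EuclideanSpace.single k 1) ≠ 0 := by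
    by_contra! h
    apply hρ.gradient_ne_zero
    have : fderiv ℝ ρ x₀ = 0 := by
      ext v
      have hv : v = ∑ i, v i • (EuclideanSpace.single i (1 : ℝ) : R3) := by
        ext j; simp [Pi.single_apply]
      rw [hv, map_sum]
      simp [h]
    simp [gradient, this]
  obtain ⟨k, hk⟩ := hk
  obtain ⟨σ, hσ, hσk⟩ : ∃ σ : ℝ, (σ = 1 ∨ σ = -1) ∧
      0 < -σ * fderiv ℝ ρ x₀ (EuclideanSpace.single k 1) := by
    rcases lt_or_gt_of_ne hk with h | h
    · exact ⟨1, Or.inl rfl, by linarith⟩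
    · exact ⟨-1, Or.inr rfl, by linarith⟩
  let f : R2 × ℝ → ℝ := fun p => -σ * ρ (axisLift k p)
  have hf : ContDiff ℝ ∞ f := contDiff_const.mul (hρ.smooth.comp (axisLift k).contDiff)
  have hlift := axisLift_planeProj k x₀
  have hf' : fderiv ℝ f (planeProj k x₀, x₀ k) (0, 1) =
      -σ * fderiv ℝ ρ x₀ (EuclideanSpace.single k 1) := by
    have h1 : HasFDerivAt f (-σ • (fderiv ℝ ρ x₀).comp (axisLift k)) (planeProj k x₀, x₀ k) := by
      refine HasFDerivAt.const_mul ?_ _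
      refine HasFDerivAt.comp _ ?_ (axisLift k).hasFDerivAt
      rw [hlift]
      exact (hρ.smooth.differentiable (by simp) x₀).hasFDerivAt
    rw [h1.fderiv]
    have : axisLift k (0, 1) = EuclideanSpace.single k 1 := by
      have h0 : ∀ j : Fin 3, (EuclideanSpace.single j 0 : R3) = 0 := fun j => by ext; simp
      simp [axisLift, h0]
    simp [this]
  obtain ⟨g, r, hr, hg, hloc⟩ := exists_implicit_graph hf (y₀ := planeProj k x₀) (t₀ := x₀ k)
    (by simp [f, hlift, hρ0]) (by rw [hf']; exact hσk)
  have hU : axisLift k ⁻¹' U ∈ 𝓝 (planeProj k x₀, x₀ k) :=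
    (axisLift k).continuous.continuousAt.preimage_mem_nhds (by rw [hlift]; exact hρ.mem_nhds)
  obtain ⟨r', hr', hU⟩ := Metric.mem_nhds_iff.mp hU
  rw [← ball_prod_same] at hU
  obtain ⟨δ, hδ, r'', hr'', hr''r, hδr', hr''r', hsign⟩ := hloc r' hr'
  -- The bump equals 1 on the horizontal ball of the chart and is supported where the implicit
  -- function is smooth, so `b * g` is globally smooth with compact support and still describes `Ω`
  -- in the chart.
  let b : ContDiffBump (planeProj k x₀) := ⟨r'', (r'' + r) / 2, hr'', by linarith⟩
  refine ⟨k, σ, fun y => b y * g y, planeProj k ⁻¹' Metric.ball (planeProj k x₀) r'' ∩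
    {x | x k ∈ Metric.ball (x₀ k) δ}, ⟨hσ, ?_, b.hasCompactSupport.mul_right, ?_, ?_⟩, ?_⟩
  · rw [contDiff_iff_contDiffAt]
    intro y
    by_cases hy : y ∈ Metric.ball (planeProj k x₀) r
    · exact b.contDiff.contDiffAt.mul (hg.contDiffAt (Metric.isOpen_ball.mem_nhds hy))
    · have hy' : y ∉ tsupport b := by
        rw [b.tsupport_eq]
        intro h
        apply hy
        have : b.rOut < r := by change (r'' + r) / 2 < r; linarith
        exact Metric.closedBall_subset_ball this h
      have : (fun y => b y * g y) =ᶠ[𝓝 y] fun _ => 0 := by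
        filter_upwards [(isClosed_tsupport b).isOpen_compl.mem_nhds hy'] with z hz
        rw [image_eq_zero_of_notMem_tsupport hz, zero_mul]
      exact contDiffAt_const.congr_of_eventuallyEq this
  · refine (Metric.isOpen_ball.preimage (planeProj k).continuous).inter
      (Metric.isOpen_ball.preimage ?_)
    exact (EuclideanSpace.proj (𝕜 := ℝ) k).continuous
  · rintro x ⟨hx1, hx2⟩
    have hxU : x ∈ U := by
      have := hU (show (planeProj k x, x k) ∈ _ from
        ⟨Metric.ball_subset_ball hr''r'.le hx1, Metric.ball_subset_ball hδr'.le hx2⟩)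
      simpa [axisLift_planeProj] using this
    obtain ⟨s1, s2⟩ := hsign _ hx1 _ hx2
    have hb1 : b (planeProj k x) = 1 := b.one_of_mem_closedBall (Metric.ball_subset_closedBall hx1)
    simp only [f, axisLift_planeProj] at s1 s2
    rw [hρ.mem_iff x hxU, hb1, one_mul]
    rcases hσ with rfl | rfl
    · rw [one_mul, sub_pos, ← s1]; simp
    · rw [neg_one_mul, neg_sub, sub_pos, ← s2]; simp
  · refine Set.mem_inter ?_ ?_
    · rw [Set.mem_preimage]; exact Metric.mem_ball_self hr''
    · rw [Set.mem_ofPred_eq]; exact Metric.mem_ball_self hδ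

/-! ### Lifting of boundary data by duality -/

theorem exists_inner_representation {V X : Type*} [AddCommGroup V] [Module ℂ V]
    [NormedAddCommGroup X] [InnerProductSpace ℂ X] [CompleteSpace X] (J : V →ₗ[ℂ] X)
    (F : V →ₗ[ℂ] ℂ) {K : ℝ} (hK : 0 ≤ K) (h : ∀ v, ‖F v‖ ≤ K * ‖J v‖) :
    ∃ z : X, ‖z‖ ≤ K ∧ ∀ v, F v = inner ℂ z (J v) := by
  -- The bound makes `F` factor through the range of `J`; the Hahn–Banach and Riesz theorems then
  -- give the vector without enlarging the constant.
  have hker : LinearMap.ker J ≤ LinearMap.ker F := fun v hv => by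
    have := h v
    rw [LinearMap.mem_ker.mp hv, norm_zero, mul_zero] at this
    exact norm_le_zero_iff.mp this
  let G : LinearMap.range J →ₗ[ℂ] ℂ :=
    ((LinearMap.ker J).liftQ F hker).comp J.quotKerEquivRange.symm.toLinearMap
  have hG : ∀ v, G ⟨J v, v, rfl⟩ = F v := fun v => by
    have : J.quotKerEquivRange.symm ⟨J v, v, rfl⟩ = Submodule.Quotient.mk v := by
      rw [LinearEquiv.symm_apply_eq]; rfl
    simp only [G, LinearMap.comp_apply, LinearEquiv.coe_coe]
    rw [this]; exact Submodule.liftQ_apply _ _ _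
  have hGb : ∀ y, ‖G y‖ ≤ K * ‖y‖ := by
    rintro ⟨_, v, rfl⟩
    rw [hG]; exact h v
  obtain ⟨g, hg, hgn⟩ := exists_extension_norm_eq (LinearMap.range J) (G.mkContinuous K hGb)
  refine ⟨(InnerProductSpace.toDual ℂ X).symm g, ?_, fun v => ?_⟩
  · rw [LinearIsometryEquiv.norm_map, hgn]
    exact G.mkContinuous_norm_le hK hGb
  · rw [InnerProductSpace.toDual_symm_apply, ← hG v]
    exact (hg ⟨J v, v, rfl⟩).symm

variable {Ω : Set R3}

/-- The space of smooth complex vector fields on `ℝ³`. -/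
def SmoothField : Submodule ℂ (R3 → C3) where
  carrier := {Φ | ContDiff ℝ ∞ Φ}
  zero_mem' := (contDiff_const : ContDiff ℝ ∞ fun _ : R3 => (0 : C3))
  add_mem' := fun {Φ Ψ} h h' => by
    have h1 : ContDiff ℝ ∞ Φ := h
    have h2 : ContDiff ℝ ∞ Ψ := h'
    exact h1.add h2
  smul_mem' := fun c Φ h => by
    have h1 : ContDiff ℝ ∞ Φ := h
    exact contDiff_const.smul h1

theorem contDiff_smoothField (Φ : SmoothField) : ContDiff ℝ ∞ (Φ : R3 → C3) := Φ.2

theorem partialDeriv_add {F : Type*} [NormedAddCommGroup F] [NormedSpace ℝ F] {f g : R3 → F}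
    (hf : ContDiff ℝ ∞ f) (hg : ContDiff ℝ ∞ g) (j : Fin 3) (x : R3) :
    partialDeriv j (f + g) x = partialDeriv j f x + partialDeriv j g x := by
  rw [partialDeriv, fderiv_add (hf.differentiable (by simp) x) (hg.differentiable (by simp) x)]
  rfl

theorem partialDeriv_const_smul {F : Type*} [NormedAddCommGroup F] [NormedSpace ℂ F] {f : R3 → F}
    (hf : ContDiff ℝ ∞ f) (c : ℂ) (j : Fin 3) (x : R3) :
    partialDeriv j (c • f) x = c • partialDeriv j f x := by
  rw [partialDeriv, fderiv_const_smul (hf.differentiable (by simp) x)]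
  rfl

theorem classicalCurl_add {Φ Ψ : R3 → C3} (hΦ : ContDiff ℝ ∞ Φ) (hΨ : ContDiff ℝ ∞ Ψ) :
    classicalCurl (Φ + Ψ) = classicalCurl Φ + classicalCurl Ψ := by
  ext x m
  simp only [classicalCurl_apply, partialDeriv_add hΦ hΨ, Pi.add_apply, PiLp.add_apply]
  ring

theorem classicalCurl_const_smul {Φ : R3 → C3} (hΦ : ContDiff ℝ ∞ Φ) (c : ℂ) :
    classicalCurl (c • Φ) = c • classicalCurl Φ := by
  ext x m
  simp only [classicalCurl_apply, partialDeriv_const_smul hΦ, Pi.smul_apply, PiLp.smul_apply,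
    smul_eq_mul]
  ring

/-- The pair of a smooth field and its curl, in `L²(Ω)³ × L²(Ω)³`. -/
def fieldAndCurl (hb : Bornology.IsBounded Ω) : SmoothField →ₗ[ℂ] WithLp 2 (L2 Ω × L2 Ω) where
  toFun Φ := WithLp.toLp 2 (toL2 hb Φ (contDiff_smoothField Φ).continuous,
    toL2 hb _ (contDiff_classicalCurl (contDiff_smoothField Φ)).continuous)
  map_add' Φ Ψ := by
    rw [← WithLp.toLp_add, Prod.mk_add_mk]
    congr 2
    simp only [toL2, Submodule.coe_add, classicalCurl_add (contDiff_smoothField Φ) (contDiff_smoothField Ψ)]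
    exact MemLp.toLp_add _ _
  map_smul' c Φ := by
    rw [RingHom.id_apply, ← WithLp.toLp_smul, Prod.smul_mk]
    congr 2
    simp only [toL2, Submodule.coe_smul, classicalCurl_const_smul (contDiff_smoothField Φ)]
    exact MemLp.toLp_const_smul _ _

/-- The action of a boundary functional on restrictions of smooth fields. -/
def restrictFunctional (f : BdryFunctional Ω C3) : SmoothField →ₗ[ℂ] ℂ where
  toFun Φ := f (restrictBdry Ω Φ (contDiff_smoothField Φ))
  map_add' Φ Ψ := by rw [← map_add]; rfl
  map_smul' c Φ := by rw [RingHom.id_apply, ← map_smul]; rfl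

/-- Bounded by the `H(curl)` norm, `f` has the form `Φ ↦ ⟨z₁, Φ⟩ + ⟨z₂, curl Φ⟩`. Comparison with
the Stokes formula shows that `u = -conj z₂`, with curl `conj z₁`, has trace `f`. -/
theorem exists_lifting (hΩ : IsOpen Ω) (hb : Bornology.IsBounded Ω) (f : BdryFunctional Ω C3)
    {K : ℝ} (hK : 0 ≤ K) (h : ∀ (Φ : R3 → C3) (hΦ : ContDiff ℝ ∞ Φ), ‖f (restrictBdry Ω Φ hΦ)‖ ≤
      K * (‖toL2 hb Φ hΦ.continuous‖ + ‖toL2 hb _ (contDiff_classicalCurl hΦ).continuous‖)) :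
    ∃ u : Hcurl Ω, HasTangentialTrace u f ∧ hcurlNorm u ≤ 2 * K := by
  obtain ⟨z, hz, hF⟩ := exists_inner_representation (fieldAndCurl hb) (restrictFunctional f)
    (K := 2 * K) (by positivity) fun Φ => by
      refine (h Φ (contDiff_smoothField Φ)).trans ?_
      have h1 : ‖toL2 hb (Φ : R3 → C3) (contDiff_smoothField Φ).continuous‖ ≤ ‖fieldAndCurl hb Φ‖ :=
        WithLp.norm_fst_le _ (fieldAndCurl hb Φ)
      have h2 : ‖toL2 hb _ (contDiff_classicalCurl (contDiff_smoothField Φ)).continuous‖ ≤ ‖fieldAndCurl hb Φ‖ :=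
        WithLp.norm_snd_le _ (fieldAndCurl hb Φ)
      nlinarith
  have hF' : ∀ (Φ : R3 → C3) (hΦ : ContDiff ℝ ∞ Φ),
      pairing (conjL2 z.fst) (toL2 hb Φ hΦ.continuous) -
        pairing (-conjL2 z.snd) (toL2 hb _ (contDiff_classicalCurl hΦ).continuous) =
        f (restrictBdry Ω Φ hΦ) := fun Φ hΦ => by
    rw [pairing_neg_left, sub_neg_eq_add, ← inner_eq_pairing, ← inner_eq_pairing]
    exact (hF ⟨Φ, hΦ⟩).symm
  have hcurl : HasWeakCurl Ω (-conjL2 z.snd) (conjL2 z.fst) := by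
    rw [hasWeakCurl_iff hb]
    intro φ hφ hc hs
    -- Test fields supported inside `Ω` vanish on the boundary, so `f` does not see them; this is
    -- what identifies `conj z₁` as the weak curl.
    have h0 : restrictBdry Ω φ hφ = 0 := by
      apply Subtype.ext
      funext x
      exact image_eq_zero_of_notMem_tsupport (f := φ) (x := x) fun hx =>
        (hΩ.frontier_eq ▸ x.2 : (x : R3) ∈ closure Ω \ Ω).2 (hs hx)
    have := hF' φ hφ
    rw [h0, map_zero] at this
    exact (sub_eq_zero.mp this).symm
  let u : Hcurl Ω := ⟨-conjL2 z.snd, _, hcurl⟩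
  have hu : curl u = conjL2 z.fst := curl_eq hΩ hb hcurl
  refine ⟨u, ?_, ?_⟩
  · rw [hasTangentialTrace_iff hb, hu]
    exact hF'
  · refine le_trans (le_of_eq ?_) hz
    rw [hcurlNorm, hu, norm_conjL2, norm_neg, norm_conjL2, add_comm,
      ← WithLp.prod_norm_sq_eq_of_L2, Real.sqrt_sq (norm_nonneg _)]

theorem hasTangentialLifting_of_bound (hΩ : IsOpen Ω) (hb : Bornology.IsBounded Ω) {C : ℝ}
    (hC : 0 ≤ C) (h : ∀ (f : HMinusHalfDiv Ω) (Φ : R3 → C3) (hΦ : ContDiff ℝ ∞ Φ),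
      ‖(f : BdryFunctional Ω C3) (restrictBdry Ω Φ hΦ)‖ ≤ C * hMinusHalfDivNorm f *
        (‖toL2 hb Φ hΦ.continuous‖ + ‖toL2 hb _ (contDiff_classicalCurl hΦ).continuous‖)) :
    HasTangentialLifting Ω := by
  refine ⟨2 * C, by positivity, fun f => ?_⟩
  obtain ⟨u, h1, h2⟩ := exists_lifting hΩ hb (f : BdryFunctional Ω C3)
    (mul_nonneg hC (Real.sqrt_nonneg _)) (h f)
  exact ⟨u, h1, h2.trans (le_of_eq (mul_assoc _ _ _).symm)⟩

/-! ### The cross product and the product rule for the curl -/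

/-- The bilinear cross product on `ℂ³`. -/
def cross (p q : C3) : C3 :=
  WithLp.toLp 2 fun m => p (m + 1) * q (m + 2) - p (m + 2) * q (m + 1)

theorem cross_apply (p q : C3) (m : Fin 3) :
    cross p q m = p (m + 1) * q (m + 2) - p (m + 2) * q (m + 1) := rfl

theorem dot_cross (a p b : C3) : dot a (cross p b) = -dot (cross p a) b := by
  simp only [dot, cross_apply, Fin.sum_univ_three, Fin.isValue, Fin.reduceAdd, zero_add]
  ring

theorem cross_sum_left {ι : Type*} (s : Finset ι) (p : ι → C3) (q : C3) :
    cross (∑ i ∈ s, p i) q = ∑ i ∈ s, cross (p i) q := by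
  ext m
  simp [cross_apply, Finset.sum_mul, Finset.sum_sub_distrib]

theorem norm_cross_le (p q : C3) : ‖cross p q‖ ≤ 6 * (‖p‖ * ‖q‖) := by
  have h1 : ‖cross p q‖ ≤ ∑ m, ‖cross p q m‖ := by
    have : cross p q = ∑ m, EuclideanSpace.single m (cross p q m) := by
      ext j; simp [Pi.single_apply]
    calc ‖cross p q‖ = ‖∑ m, EuclideanSpace.single m (cross p q m)‖ := by rw [← this]
      _ ≤ _ := (norm_sum_le _ _).trans (by simp)
  have h2 : ∀ m, ‖cross p q m‖ ≤ 2 * (‖p‖ * ‖q‖) := fun m => by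
    rw [cross_apply]
    refine (norm_sub_le _ _).trans ?_
    rw [norm_mul, norm_mul, two_mul]
    gcongr <;> exact PiLp.norm_apply_le _ _
  refine h1.trans ((Finset.sum_le_sum fun m _ => h2 m).trans (le_of_eq ?_))
  simp; ring

theorem cross_zero_left (q : C3) : cross 0 q = 0 := by ext m; simp [cross_apply]

theorem continuous_cross : Continuous fun p : C3 × C3 => cross p.1 p.2 := by
  refine (PiLp.continuous_toLp 2 _).comp (continuous_pi fun m => ?_)
  fun_prop

theorem contDiff_grad {χ : R3 → ℂ} (h : ContDiff ℝ ∞ χ) : ContDiff ℝ ∞ (grad χ) := by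
  rw [contDiff_piLp]
  exact fun m => contDiff_partialDeriv h m

theorem partialDeriv_smul {χ : R3 → ℂ} {Φ : R3 → C3} (hχ : ContDiff ℝ ∞ χ) (hΦ : ContDiff ℝ ∞ Φ)
    (j : Fin 3) (x : R3) : partialDeriv j (fun y => χ y • Φ y) x =
      χ x • partialDeriv j Φ x + partialDeriv j χ x • Φ x := by
  have := ((hχ.differentiable (by simp) x).hasFDerivAt).smul
    ((hΦ.differentiable (by simp) x).hasFDerivAt)
  exact congrArg (fun T => T (EuclideanSpace.single j 1)) this.fderiv

theorem classicalCurl_smul {χ : R3 → ℂ} {Φ : R3 → C3} (hχ : ContDiff ℝ ∞ χ)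
    (hΦ : ContDiff ℝ ∞ Φ) (x : R3) : classicalCurl (fun y => χ y • Φ y) x =
      χ x • classicalCurl Φ x + cross (grad χ x) (Φ x) := by
  ext m
  simp only [classicalCurl_apply, partialDeriv_smul hχ hΦ, PiLp.add_apply, PiLp.smul_apply,
    cross_apply, grad, smul_eq_mul]
  ring

theorem classicalCurl_const (v : C3) (x : R3) : classicalCurl (fun _ => v) x = 0 := by
  ext m
  simp [classicalCurl_apply, partialDeriv]

/-- The bilinear product as a continuous bilinear map. -/
def dotCLM : C3 →L[ℝ] C3 →L[ℝ] ℂ :=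
  LinearMap.mkContinuous₂
    (LinearMap.mk₂ ℝ dot dot_add_left
      (fun c u v => by simp [dot, Finset.mul_sum, mul_assoc]) dot_add_right
      (fun c u v => by simp [dot, Finset.mul_sum, mul_left_comm])) 1
    fun u v => by simpa using norm_dot_le u v

@[simp] theorem dotCLM_apply (u v : C3) : dotCLM u v = dot u v := rfl

/-! ### Translating the closure of the domain into the domain -/

section Translation

theorem lipschitz_of_graphChart {Ω : Set R3} {k : Fin 3} {σ : ℝ} {g : R2 → ℝ} {V : Set R3}
    (h : IsGraphChart Ω k σ g V) : ∃ L, LipschitzWith L g :=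
  h.smooth.lipschitzWith_of_hasCompactSupport h.compact (by simp)

theorem IsGraphChart.nonneg_of_mem_closure {Ω : Set R3} {k : Fin 3} {σ : ℝ} {g : R2 → ℝ}
    {V : Set R3} (h : IsGraphChart Ω k σ g V) {x : R3} (hV : x ∈ V) (hx : x ∈ closure Ω) :
    0 ≤ σ * (x k - g (planeProj k x)) := by
  by_contra! hneg
  have hcont : Continuous fun y : R3 => σ * (y k - g (planeProj k y)) := by
    have := h.smooth.continuous
    fun_prop
  have h1 : ∀ᶠ y in 𝓝 x, σ * (y k - g (planeProj k y)) < 0 :=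
    hcont.continuousAt.eventually (gt_mem_nhds hneg)
  obtain ⟨y, hyΩ, hy, hyV⟩ := ((mem_closure_iff_frequently.mp hx).and_eventually
    (h1.and (h.isOpen.mem_nhds hV))).exists
  exact absurd ((h.mem_iff y hyV).mp hyΩ) (not_lt.mpr hy.le)

/-- A Lipschitz graph satisfies a uniform cone condition: moving by `y` changes the graph height by
at most `L` times the horizontal part of `y`, so a steeper move towards the side `σ` enters `Ω` even
from the boundary. The admissible vectors form an open set accumulating at 0. -/
theorem exists_translation {Ω : Set R3} (hΩ : IsSmoothBoundedDomain Ω) {x : R3}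
    (hx : x ∈ closure Ω) : ∃ W ∈ 𝓝 x, ∃ Y : Set R3, IsOpen Y ∧ (0 : R3) ∈ closure Y ∧
      ∀ z ∈ W, z ∈ closure Ω → ∀ y ∈ Y, z + y ∈ Ω := by
  by_cases hxΩ : x ∈ Ω
  · obtain ⟨r, hr, hb⟩ := Metric.isOpen_iff.mp hΩ.isOpen x hxΩ
    refine ⟨Metric.ball x (r / 2), Metric.ball_mem_nhds _ (by linarith), Metric.ball 0 (r / 2),
      Metric.isOpen_ball, subset_closure (Metric.mem_ball_self (by linarith)),
      fun z hz _ y hy => hb ?_⟩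
    rw [Metric.mem_ball, dist_eq_norm] at *
    calc ‖z + y - x‖ = ‖(z - x) + (y - 0)‖ := by congr 1; abel
      _ ≤ _ := norm_add_le _ _
      _ < r := by linarith
  · have hxf : x ∈ frontier Ω := by rw [hΩ.isOpen.frontier_eq]; exact ⟨hx, hxΩ⟩
    obtain ⟨k, σ, g, V, hc, hxV⟩ := exists_isGraphChart hΩ hxf
    obtain ⟨L, hL⟩ := lipschitz_of_graphChart hc
    obtain ⟨r, hr, hb⟩ := Metric.isOpen_iff.mp hc.isOpen x hxV
    have hσσ : σ * σ = 1 := by rcases hc.sign with rfl | rfl <;> norm_num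
    -- The cone of directions steeper than the Lipschitz constant, truncated so that translates stay
    -- in the chart.
    let Y : Set R3 := {y | L * ‖planeProj k y‖ < σ * y k} ∩ Metric.ball 0 (r / 2)
    refine ⟨Metric.ball x (r / 2), Metric.ball_mem_nhds _ (by linarith), Y, ?_, ?_, ?_⟩
    · refine IsOpen.inter (isOpen_lt ?_ ?_) Metric.isOpen_ball
      · exact continuous_const.mul (planeProj k).continuous.norm
      · fun_prop
    · rw [mem_closure_iff_frequently]
      have ht : Tendsto (fun t : ℝ => t • (EuclideanSpace.single k σ : R3)) (𝓝[>] 0) (𝓝 0) := by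
        have : Continuous fun t : ℝ => t • (EuclideanSpace.single k σ : R3) := by fun_prop
        simpa using (this.tendsto 0).mono_left nhdsWithin_le_nhds
      refine ht.frequently (Eventually.frequently ?_)
      filter_upwards [self_mem_nhdsWithin, ht.eventually (Metric.ball_mem_nhds 0
        (by linarith : (0 : ℝ) < r / 2))] with t ht0 htb
      refine ⟨?_, htb⟩
      have h0 : planeProj k (t • (EuclideanSpace.single k σ : R3)) = 0 := by
        ext i
        fin_cases k <;> fin_cases i <;> simp
      change L * ‖planeProj k (t • (EuclideanSpace.single k σ : R3))‖ < _
      rw [h0, norm_zero, mul_zero]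
      simp only [PiLp.smul_apply, PiLp.single_apply, if_true, smul_eq_mul]
      have ht0' : 0 < t := ht0
      nlinarith
    · rintro z hz hzΩ y ⟨hy1, hy2⟩
      have hy1' : L * ‖planeProj k y‖ < σ * y k := hy1
      have hzV : z ∈ V := hb (Metric.ball_subset_ball (by linarith) hz)
      have hzyV : z + y ∈ V := by
        refine hb ?_
        rw [Metric.mem_ball, dist_eq_norm] at *
        calc ‖z + y - x‖ = ‖(z - x) + (y - 0)‖ := by congr 1; abel
          _ ≤ _ := norm_add_le _ _
          _ < r := by linarith
      rw [hc.mem_iff _ hzyV]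
      have h0 := hc.nonneg_of_mem_closure hzV hzΩ
      have h1 := hL.dist_le_mul (planeProj k (z + y)) (planeProj k z)
      rw [Real.dist_eq, dist_eq_norm, map_add, add_sub_cancel_left] at h1
      rw [map_add, PiLp.add_apply]
      have h2 := abs_le.mp h1
      rcases hc.sign with rfl | rfl <;> linarith [h2.1, h2.2]

end Translation

/-! ### Mollification against translates -/

section Mollification

theorem partialDeriv_convolution {η : R3 → ℝ} {b : R3 → C3} (hη : ContDiff ℝ ∞ η)
    (hc : HasCompactSupport η) (hb : LocallyIntegrable b) (j : Fin 3) (x : R3) :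
    partialDeriv j (convolution η b (ContinuousLinearMap.lsmul ℝ ℝ) volume) x =
      ∫ t, partialDeriv j η t • b (x - t) := by
  have h := hc.hasFDerivAt_convolution_left (ContinuousLinearMap.lsmul ℝ ℝ)
    (hη.of_le (by simp)) hb x
  rw [partialDeriv, h.fderiv, convolution_def]
  have hex := (hc.fderiv (𝕜 := ℝ)).convolutionExists_left
    ((ContinuousLinearMap.lsmul ℝ ℝ : ℝ →L[ℝ] C3 →L[ℝ] C3).precompL R3)
    (hη.continuous_fderiv (by simp)) hb x
  have := (ContinuousLinearMap.apply ℝ C3 (EuclideanSpace.single j 1 : R3)).integral_comp_comm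
    hex.integrable
  simp only [ContinuousLinearMap.apply_apply] at this
  rw [← this]
  rfl

/-- A convolution with `b` differentiates through `η`, and the resulting integral is the weak
identity tested with the fields `z ↦ η (x - z) e_m`. -/
theorem classicalCurl_convolution {a b : R3 → C3} (ha : Integrable a) (hb : Integrable b)
    (hZ : ∀ Φ : R3 → C3, ContDiff ℝ ∞ Φ →
      ∫ x, dot (b x) (classicalCurl Φ x) = ∫ x, dot (a x) (Φ x))
    {η : R3 → ℝ} (hη : ContDiff ℝ ∞ η) (hc : HasCompactSupport η) (x : R3) :
    classicalCurl (convolution η b (ContinuousLinearMap.lsmul ℝ ℝ) volume) x =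
      convolution η a (ContinuousLinearMap.lsmul ℝ ℝ) volume x := by
  have hint : ∀ {θ : R3 → ℝ} {d : R3 → C3}, Continuous θ → HasCompactSupport θ → Integrable d →
      Integrable fun t => θ t • d (x - t) := fun {θ d} h1 h2 h3 => by
    obtain ⟨M, hM⟩ := h2.exists_bound_of_continuous h1
    exact (h3.comp_sub_left x).bdd_smul M h1.aestronglyMeasurable (Eventually.of_forall hM)
  have hpc : ∀ j, HasCompactSupport (partialDeriv j η) := fun j =>
    hc.fderiv_apply (𝕜 := ℝ) (v := EuclideanSpace.single j 1)
  have hcoord : ∀ {F : R3 → C3} (m : Fin 3), Integrable F → (∫ t, F t) m = ∫ t, F t m :=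
    fun {F} m h => ((EuclideanSpace.proj (𝕜 := ℂ) m).integral_comp_comm h).symm
  have hci : ∀ {F : R3 → C3} (m : Fin 3), Integrable F → Integrable fun t => F t m :=
    fun {F} m h => (EuclideanSpace.proj (𝕜 := ℂ) m).integrable_comp h
  ext m
  have hi := fun j => hint (contDiff_partialDeriv hη j).continuous (hpc j) hb
  rw [classicalCurl_apply, partialDeriv_convolution hη hc hb.locallyIntegrable,
    partialDeriv_convolution hη hc hb.locallyIntegrable, hcoord _ (hi _), hcoord _ (hi _),
    ← integral_sub (hci _ (hi _)) (hci _ (hi _)), convolution_def]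
  simp only [ContinuousLinearMap.lsmul_apply]
  rw [hcoord _ (hint hη.continuous hc ha)]
  let θ : R3 → ℂ := fun z => (η (x - z) : ℂ)
  have hθ : ContDiff ℝ ∞ θ :=
    Complex.ofRealCLM.contDiff.comp (hη.comp (contDiff_const.sub contDiff_id))
  have hgrad : ∀ z j, grad θ z j = -((partialDeriv j η (x - z) : ℝ) : ℂ) := fun z j => by
    have h1 : HasFDerivAt θ (Complex.ofRealCLM.comp ((fderiv ℝ η (x - z)).comp
        (-ContinuousLinearMap.id ℝ R3))) z := by
      refine Complex.ofRealCLM.hasFDerivAt.comp z ?_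
      refine HasFDerivAt.comp z (hη.differentiable (by simp) (x - z)).hasFDerivAt ?_
      exact (hasFDerivAt_id z).const_sub x
    change partialDeriv j θ z = _
    rw [partialDeriv, h1.fderiv]
    simp [partialDeriv]
  have hΦ : ContDiff ℝ ∞ fun z => θ z • (EuclideanSpace.single m 1 : C3) :=
    hθ.smul contDiff_const
  have key := hZ _ hΦ
  convert key using 1
  · rw [← integral_sub_left_eq_self _ volume x]
    refine integral_congr_ae (Eventually.of_forall fun z => ?_)
    beta_reduce
    rw [classicalCurl_smul hθ contDiff_const, classicalCurl_const, smul_zero, zero_add, dot_cross,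
      dot_single, cross_apply, hgrad, hgrad]
    simp
    ring
  · rw [← integral_sub_left_eq_self _ volume x]
    refine integral_congr_ae (Eventually.of_forall fun z => ?_)
    beta_reduce
    rw [dot_smul_right, dot_single]
    simp [θ]

/-- Translation acts continuously on `L²`, and the integral is an inner product with the translate.
-/
theorem continuous_integral_dot_translate {w a : R3 → C3} (hw : MemLp w 2 volume)
    (ha : MemLp a 2 volume) : Continuous fun t => ∫ x, dot (w x) (a (x - t)) := by
  have : Fact ((2 : ℝ≥0∞) ≠ ⊤) := ⟨by norm_num⟩
  have hw' : MemLp (fun x => conjVec (w x)) 2 volume := conjCLM.comp_memLp' hw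
  have e : (fun t => ∫ x, dot (w x) (a (x - t))) =
      fun t : R3 => inner ℂ (hw'.toLp _) (DomAddAct.mk (-t) +ᵥ ha.toLp a) := by
    funext t
    rw [L2.inner_def]
    refine integral_congr_ae ?_
    have h3 : ∀ᵐ x, (ha.toLp a) (-t + x) = a (-t + x) :=
      (measurePreserving_add_left volume (-t)).quasiMeasurePreserving.ae ha.coeFn_toLp
    filter_upwards [hw'.coeFn_toLp, DomAddAct.vadd_Lp_ae_eq (DomAddAct.mk (-t)) (ha.toLp a), h3]
      with x h1 h2 h3
    rw [h1, h2, dot_eq_inner]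
    simp only [Equiv.symm_apply_apply, vadd_eq_add]
    rw [h3, sub_eq_neg_add]
  rw [e]
  refine continuous_const.inner ?_
  have hc : Continuous fun t : R3 => DomAddAct.mk (-t) :=
    DomAddAct.continuous_mk.comp continuous_neg
  exact hc.vadd continuous_const

theorem integral_smul_integral_dot {w a : R3 → C3} (hw : Integrable w) (ha : Integrable a)
    {η : R3 → ℝ} (hη : Continuous η) (hc : HasCompactSupport η) :
    ∫ t, η t • ∫ x, dot (w x) (a (x - t)) =
      ∫ x, dot (w x) (convolution η a (ContinuousLinearMap.lsmul ℝ ℝ) volume x) := by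
  obtain ⟨M, hM⟩ := hc.exists_bound_of_continuous hη
  have hi : Integrable (Function.uncurry fun t x => η t • dot (w x) (a (x - t)))
      (volume.prod volume) := by
    have h1 : Integrable (fun p : R3 × R3 => dotCLM (w p.2) ((fun z => a (-z)) (p.1 - p.2)))
        (volume.prod volume) :=
      Integrable.convolution_integrand (f := w) (g := fun z => a (-z)) dotCLM hw ha.comp_neg
    have h2 := h1.bdd_smul (φ := fun p => η p.1) M
      (hη.comp continuous_fst).aestronglyMeasurable (Eventually.of_forall fun p => hM p.1)
    refine h2.congr (Eventually.of_forall fun p => ?_)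
    change η p.1 • dot (w p.2) (a (-(p.1 - p.2))) = η p.1 • dot (w p.2) (a (p.2 - p.1))
    rw [neg_sub]
  simp_rw [← integral_smul]
  rw [integral_integral_swap hi]
  refine integral_congr_ae (Eventually.of_forall fun x => ?_)
  beta_reduce
  have h3 : Integrable fun t => η t • a (x - t) :=
    (ha.comp_sub_left x).bdd_smul M hη.aestronglyMeasurable (Eventually.of_forall hM)
  have := (dotCLM (w x)).integral_comp_comm h3
  rw [convolution_def]
  simp only [ContinuousLinearMap.lsmul_apply]
  rw [← dotCLM_apply, ← this]
  refine integral_congr_ae (Eventually.of_forall fun t => ?_)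
  simp

theorem integrable_dot_of_memLp {w a : R3 → C3} (hw : MemLp w 2 volume) (ha : MemLp a 2 volume) :
    Integrable fun x => dot (w x) (a x) := by
  have hw' : MemLp (fun x => conjVec (w x)) 2 volume := conjCLM.comp_memLp' hw
  refine (L2.integrable_inner (𝕜 := ℂ) (hw'.toLp _) (ha.toLp a)).congr ?_
  filter_upwards [hw'.coeFn_toLp, ha.coeFn_toLp] with x h1 h2
  rw [h1, h2, dot_eq_inner]

theorem eq_zero_of_forall_integral_smul {K : R3 → ℂ} (hK : Continuous K) {Y : Set R3}
    (hY : IsOpen Y) (h : ∀ η : R3 → ℝ, ContDiff ℝ ∞ η → HasCompactSupport η → tsupport η ⊆ Y →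
      ∫ t, η t • K t = 0) : ∀ t ∈ closure Y, K t = 0 := by
  have hY0 : ∀ t ∈ Y, K t = 0 := by
    have h1 := hY.ae_eq_zero_of_integral_contDiff_smul_eq_zero
      (hK.locallyIntegrable (μ := volume).locallyIntegrableOn Y) h
    have h2 : IsOpen (Y ∩ {t | K t ≠ 0}) := hY.inter (isOpen_ne_fun hK continuous_const)
    have h3 : volume (Y ∩ {t | K t ≠ 0}) = 0 := by
      rw [measure_eq_zero_iff_ae_notMem]
      filter_upwards [h1] with t ht hmem
      exact hmem.2 (ht hmem.1)
    have h4 := h2.eq_empty_of_measure_zero h3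
    intro t ht
    by_contra hne
    exact Set.notMem_empty t (h4 ▸ ⟨ht, hne⟩)
  exact fun t ht => closure_minimal hY0 (isClosed_eq hK continuous_const) ht

-- The difference of the two pairings, with `a` and `b` translated by `t`, is continuous in `t`.
-- Averaged against a bump `η` supported in `Y` it vanishes, because `η * b` is a smooth field with
-- compact support in `Ω` whose curl is `η * a`, hence an admissible test field for the weak curl of
-- `w`. So the difference vanishes on `Y`, and by continuity at `t = 0` in its closure; no
-- approximate identity is needed.
open scoped Pointwise in
theorem integral_dot_eq_of_translates {Ω : Set R3} (hb : Bornology.IsBounded Ω)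
    (hΩ : IsOpen Ω) {w c : L2 Ω} (hw : HasWeakCurl Ω w c) {a b : R3 → C3}
    (ha : MemLp a 2 volume) (hb2 : MemLp b 2 volume) {K₀ : Set R3} (hK : IsCompact K₀)
    (haK : ∀ x ∉ K₀, a x = 0) (hbK : ∀ x ∉ K₀, b x = 0)
    (hZ : ∀ Φ : R3 → C3, ContDiff ℝ ∞ Φ →
      ∫ x, dot (b x) (classicalCurl Φ x) = ∫ x, dot (a x) (Φ x))
    {Y : Set R3} (hY : IsOpen Y) (h0 : (0 : R3) ∈ closure Y)
    (hKY : ∀ z ∈ K₀, ∀ y ∈ Y, z + y ∈ Ω) :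
    ∫ x in Ω, dot (w x) (a x) = ∫ x in Ω, dot (c x) (b x) := by
  have hint : ∀ {d : R3 → C3}, MemLp d 2 volume → (∀ x ∉ K₀, d x = 0) → Integrable d := by
    intro d hd hdK
    have h1 : IntegrableOn d K₀ := by
      have : IsFiniteMeasure (volume.restrict K₀) := ⟨by simpa using hK.measure_lt_top⟩
      exact (hd.restrict K₀).integrable (by norm_num)
    exact h1.integrable_of_forall_notMem_eq_zero hdK
  have hext : ∀ d : L2 Ω, MemLp (Ω.indicator d) 2 volume ∧ Integrable (Ω.indicator d) := fun d => by
    refine ⟨(memLp_indicator_iff_restrict hΩ.measurableSet).mpr (Lp.memLp d), ?_⟩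
    rw [integrable_indicator_iff hΩ.measurableSet]
    have : IsFiniteMeasure (volume.restrict Ω) := ⟨by simpa using hb.measure_lt_top⟩
    exact (Lp.memLp d).integrable (by norm_num)
  have hind : ∀ (d : L2 Ω) (F : R3 → C3),
      ∫ x, dot (Ω.indicator d x) (F x) = ∫ x in Ω, dot (d x) (F x) := fun d F => by
    rw [← integral_indicator hΩ.measurableSet]
    refine integral_congr_ae (Eventually.of_forall fun x => ?_)
    by_cases hx : x ∈ Ω <;> simp [hx]
  let K₁ : R3 → ℂ := fun t => ∫ x, dot (Ω.indicator w x) (a (x - t))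
  let K₂ : R3 → ℂ := fun t => ∫ x, dot (Ω.indicator c x) (b (x - t))
  have hK₁ : Continuous K₁ := continuous_integral_dot_translate (hext w).1 ha
  have hK₂ : Continuous K₂ := continuous_integral_dot_translate (hext c).1 hb2
  have hzero := eq_zero_of_forall_integral_smul (hK₁.sub hK₂) hY (fun η hη hηc hηs => ?_) 0 h0
  · have := sub_eq_zero.mp hzero
    simp only [K₁, K₂, sub_zero] at this
    rwa [hind, hind] at this
  · have hsm : ∀ {K : R3 → ℂ}, Continuous K → Integrable fun t => η t • K t := fun hK =>
      (hη.continuous.smul hK).integrable_of_hasCompactSupport hηc.smul_right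
    simp only [Pi.sub_apply, smul_sub]
    rw [integral_sub (hsm hK₁) (hsm hK₂),
      integral_smul_integral_dot (hext w).2 (hint ha haK) hη.continuous hηc,
      integral_smul_integral_dot (hext c).2 (hint hb2 hbK) hη.continuous hηc, hind, hind,
      sub_eq_zero]
    have hsub : tsupport (convolution η b (ContinuousLinearMap.lsmul ℝ ℝ) volume) ⊆
        tsupport η + K₀ := by
      refine closure_minimal ?_ (hηc.isCompact.add hK).isClosed
      refine (support_convolution_subset _).trans (Set.add_subset_add (subset_tsupport η) ?_)
      intro x hx
      by_contra hxK
      exact hx (hbK x hxK)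
    have hφ := hηc.contDiff_convolution_left (ContinuousLinearMap.lsmul ℝ ℝ : ℝ →L[ℝ] C3 →L[ℝ] C3)
      (n := ⊤) hη (hint hb2 hbK).locallyIntegrable
    have key := hw _ hφ
      ((hηc.isCompact.add hK).of_isClosed_subset (isClosed_tsupport _) hsub) (hsub.trans ?_)
    · simpa only [classicalCurl_convolution (hint ha haK) (hint hb2 hbK) hZ hη hηc] using key
    · rintro _ ⟨y, hy, z, hz, rfl⟩
      rw [show (fun x1 x2 : R3 => x1 + x2) y z = z + y from add_comm y z]
      exact hKY z hz y (hηs hy)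

end Mollification

theorem sum_grad_eq_zero {s : Finset R3} {χ : R3 → R3 → ℝ} (h : ∀ c ∈ s, ContDiff ℝ ∞ (χ c))
    {x : R3} (h1 : ∀ᶠ y in 𝓝 x, ∑ c ∈ s, χ c y = 1) :
    ∑ c ∈ s, grad (fun y => (χ c y : ℂ)) x = 0 := by
  have h2 : (fun y => ∑ c ∈ s, (χ c y : ℂ)) =ᶠ[𝓝 x] fun _ => 1 := by
    filter_upwards [h1] with y hy
    exact_mod_cast hy
  ext j
  have h3 : partialDeriv j (fun y => ∑ c ∈ s, (χ c y : ℂ)) x = 0 := by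
    rw [partialDeriv, h2.fderiv_eq]; simp
  have h4 : ∀ c ∈ s, DifferentiableAt ℝ (fun y => (χ c y : ℂ)) x := fun c hc =>
    (Complex.ofRealCLM.contDiff.comp (h c hc)).differentiable (by simp) x
  rw [partialDeriv, fderiv_fun_sum h4] at h3
  rw [WithLp.ofLp_sum, Finset.sum_apply, PiLp.zero_apply, ← h3, sum_apply]
  rfl

/-! ### Localizing fields with zero trace -/

section Localization

variable {Ω : Set R3} {χ : R3 → ℝ}

theorem contDiff_ofReal (hχ : ContDiff ℝ ∞ χ) : ContDiff ℝ ∞ fun x => (χ x : ℂ) :=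
  Complex.ofRealCLM.contDiff.comp hχ

theorem hasCompactSupport_grad {χ : R3 → ℂ} (hc : HasCompactSupport χ) :
    HasCompactSupport (grad χ) := by
  refine (hc.fderiv (𝕜 := ℝ)).mono fun x hx h0 => hx ?_
  ext j
  simp [grad, partialDeriv, h0]

theorem memLp_smul {u : R3 → C3} (hu : MemLp u 2 volume) (hχ : ContDiff ℝ ∞ χ)
    (hc : HasCompactSupport χ) : MemLp (fun x => (χ x : ℂ) • u x) 2 volume := by
  obtain ⟨M, hM⟩ := hc.exists_bound_of_continuous hχ.continuous
  refine hu.of_le_mul (c := M)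
    ((contDiff_ofReal hχ).continuous.aestronglyMeasurable.smul hu.1) (Eventually.of_forall fun x => ?_)
  rw [norm_smul, Complex.norm_real]
  exact mul_le_mul_of_nonneg_right (hM x) (norm_nonneg _)

theorem memLp_cross {u p : R3 → C3} (hu : MemLp u 2 volume) (hp : Continuous p)
    (hc : HasCompactSupport p) : MemLp (fun x => cross (p x) (u x)) 2 volume := by
  obtain ⟨M, hM⟩ := hc.exists_bound_of_continuous hp
  have hm : AEStronglyMeasurable (fun x => (p x, u x)) volume :=
    hp.aestronglyMeasurable.prodMk hu.1
  have hm2 : AEStronglyMeasurable (fun x => cross (p x) (u x)) volume :=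
    continuous_cross.comp_aestronglyMeasurable hm
  refine MemLp.of_le_mul (c := 6 * M) hu hm2 (Eventually.of_forall fun x => ?_)
  refine (norm_cross_le _ _).trans ?_
  rw [mul_assoc]
  have := mul_le_mul_of_nonneg_right (hM x) (norm_nonneg (u x))
  linarith

theorem memLp_cross_grad {u : R3 → C3} (hu : MemLp u 2 volume) (hχ : ContDiff ℝ ∞ χ)
    (hc : HasCompactSupport χ) :
    MemLp (fun x => cross (grad (fun y => (χ y : ℂ)) x) (u x)) 2 volume := by
  have hcc : HasCompactSupport fun x => (χ x : ℂ) := hc.comp_left Complex.ofReal_zero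
  exact memLp_cross hu (contDiff_grad (contDiff_ofReal hχ)).continuous (hasCompactSupport_grad hcc)

/-- Zero trace enters here: testing with `χΦ` and using the product rule shows that the extension by
zero of `χu` has, in all of `ℝ³`, the curl `χv + ∇χ × u` extended by zero, with no contribution from
the boundary. -/
theorem integral_dot_localized (hΩ : IsOpen Ω) (hb : Bornology.IsBounded Ω) {u v : L2 Ω}
    (huv : HasWeakCurlZeroTrace Ω u v) (hχ : ContDiff ℝ ∞ χ) {Φ : R3 → C3}
    (hΦ : ContDiff ℝ ∞ Φ) :
    ∫ x, dot ((χ x : ℂ) • Ω.indicator u x) (classicalCurl Φ x) =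
      ∫ x, dot ((χ x : ℂ) • Ω.indicator v x +
        cross (grad (fun y => (χ y : ℂ)) x) (Ω.indicator u x)) (Φ x) := by
  have hχc := contDiff_ofReal hχ
  have hg := contDiff_grad hχc
  have hcr : Continuous fun x => cross (grad (fun y => (χ y : ℂ)) x) (Φ x) :=
    continuous_cross.comp (hg.continuous.prodMk hΦ.continuous)
  have hχΦ : ContDiff ℝ ∞ fun x => (χ x : ℂ) • Φ x := hχc.smul hΦ
  have key := huv _ hχΦ
  have e1 : ∫ x, dot ((χ x : ℂ) • Ω.indicator u x) (classicalCurl Φ x) =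
      ∫ x in Ω, (dot (u x) (classicalCurl (fun y => (χ y : ℂ) • Φ y) x) -
        dot (u x) (cross (grad (fun y => (χ y : ℂ)) x) (Φ x))) := by
    rw [← integral_indicator hΩ.measurableSet]
    refine integral_congr_ae (Eventually.of_forall fun x => ?_)
    beta_reduce
    by_cases hx : x ∈ Ω
    · rw [Set.indicator_of_mem hx, Set.indicator_of_mem hx, classicalCurl_smul hχc hΦ,
        dot_add_right, dot_smul_left, dot_smul_right]
      ring
    · simp [hx]
  have e2 : ∫ x, dot ((χ x : ℂ) • Ω.indicator v x +
        cross (grad (fun y => (χ y : ℂ)) x) (Ω.indicator u x)) (Φ x) =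
      ∫ x in Ω, (dot (v x) ((χ x : ℂ) • Φ x) -
        dot (u x) (cross (grad (fun y => (χ y : ℂ)) x) (Φ x))) := by
    rw [← integral_indicator hΩ.measurableSet]
    refine integral_congr_ae (Eventually.of_forall fun x => ?_)
    beta_reduce
    by_cases hx : x ∈ Ω
    · rw [Set.indicator_of_mem hx, Set.indicator_of_mem hx, Set.indicator_of_mem hx,
        dot_add_left, dot_smul_left, dot_smul_right, dot_cross]
      ring
    · have : ∀ p, cross p 0 = 0 := fun p => by ext m; simp [cross_apply]
      simp [hx, this]
  rw [e1, e2, integral_sub (integrable_dot_continuous hb u (contDiff_classicalCurl hχΦ).continuous)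
    (integrable_dot_continuous hb u hcr), integral_sub
    (integrable_dot_continuous hb v hχΦ.continuous) (integrable_dot_continuous hb u hcr), key]

end Localization

/-- Each localized piece `χᵢu`, extended by zero, can be translated into `Ω`, so the pairing
identity holds for it by `integral_dot_eq_of_translates`. The pieces are then summed over a
partition of unity on the closure. -/
theorem curlPairingSymm {Ω : Set R3} (hΩ : IsSmoothBoundedDomain Ω) : CurlPairingSymm Ω := by
  intro u v w c huv hw
  have hb := hΩ.isBounded
  have hm := hΩ.isOpen.measurableSet
  have hext : ∀ d : L2 Ω, MemLp (Ω.indicator d) 2 volume := fun d =>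
    (memLp_indicator_iff_restrict hm).mpr (Lp.memLp d)
  choose! W hW Y hY h0 hWY using fun x (hx : x ∈ closure Ω) => exists_translation hΩ hx
  obtain ⟨s, χ, hs, hχ, hsum⟩ := exists_smooth_partition hb.isCompact_closure W hW
  let a : R3 → R3 → C3 := fun i x => (χ i x : ℂ) • Ω.indicator v x +
    cross (grad (fun y => (χ i y : ℂ)) x) (Ω.indicator u x)
  let b : R3 → R3 → C3 := fun i x => (χ i x : ℂ) • Ω.indicator u x
  have ha : ∀ i ∈ s, MemLp (a i) 2 volume := fun i hi =>
    (memLp_smul (hext v) (hχ i hi).1 (hχ i hi).2.1).add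
      (memLp_cross_grad (hext u) (hχ i hi).1 (hχ i hi).2.1)
  have hbm : ∀ i ∈ s, MemLp (b i) 2 volume := fun i hi =>
    memLp_smul (hext u) (hχ i hi).1 (hχ i hi).2.1
  have hgrad0 : ∀ i x, x ∉ tsupport (χ i) → grad (fun y => (χ i y : ℂ)) x = 0 := by
    intro i x hx
    have : (fun y => (χ i y : ℂ)) =ᶠ[𝓝 x] fun _ => 0 := by
      filter_upwards [(isClosed_tsupport _).isOpen_compl.mem_nhds hx] with y hy
      rw [image_eq_zero_of_notMem_tsupport hy, Complex.ofReal_zero]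
    ext j
    simp [grad, partialDeriv, this.fderiv_eq]
  have key : ∀ i ∈ s, ∫ x in Ω, dot (w x) (a i x) = ∫ x in Ω, dot (c x) (b i x) := by
    intro i hi
    have hoff : ∀ x ∉ tsupport (χ i) ∩ closure Ω, χ i x = 0 ∧ grad (fun y => (χ i y : ℂ)) x = 0 ∨
        x ∉ Ω := fun x hx => by
      by_cases hxs : x ∈ tsupport (χ i)
      · exact Or.inr fun h => hx ⟨hxs, subset_closure h⟩
      · exact Or.inl ⟨image_eq_zero_of_notMem_tsupport hxs, hgrad0 i x hxs⟩
    have hcr : ∀ p, cross p 0 = 0 := fun p => by ext m; simp [cross_apply]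
    refine integral_dot_eq_of_translates (K₀ := tsupport (χ i) ∩ closure Ω) hb hΩ.isOpen hw (ha i hi) (hbm i hi)
      ((hχ i hi).2.1.isCompact.inter_right isClosed_closure) ?_ ?_ ?_ (hY i (hs i hi))
      (h0 i (hs i hi)) ?_
    · intro x hx
      rcases hoff x hx with ⟨h1, h2⟩ | h
      · simp [a, h1, h2, cross_zero_left]
      · simp [a, h, hcr]
    · intro x hx
      rcases hoff x hx with ⟨h1, h2⟩ | h
      · simp [b, h1]
      · simp [b, h]
    · exact fun Φ hΦ => integral_dot_localized hΩ.isOpen hb huv (hχ i hi).1 hΦ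
    · exact fun z hz y hy => hWY i (hs i hi) z ((hχ i hi).2.2 hz.1) hz.2 y hy
  have hInt : ∀ (d : L2 Ω) (F : R3 → C3), MemLp F 2 volume →
      Integrable (fun x => dot (d x) (F x)) (volume.restrict Ω) := fun d F hF => by
    refine (integrable_dot_of_memLp (hext d) hF).restrict.congr ?_
    filter_upwards [ae_restrict_mem hm] with x hx
    rw [Set.indicator_of_mem hx]
  have e1 : pairing v w = ∑ i ∈ s, ∫ x in Ω, dot (w x) (a i x) := by
    rw [← integral_finsetSum _ fun i hi => hInt w _ (ha i hi), pairing_comm]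
    refine integral_congr_ae ?_
    filter_upwards [ae_restrict_mem hm] with x hx
    -- The commutator terms `∇χᵢ × u` add up to zero, because the partition sums to 1 near every
    -- point of `Ω`.
    have h1 : ∑ i ∈ s, a i x = v x := by
      simp only [a, Set.indicator_of_mem hx]
      rw [Finset.sum_add_distrib, ← Finset.sum_smul, ← cross_sum_left,
        sum_grad_eq_zero (fun i hi => (hχ i hi).1), cross_zero_left, add_zero]
      · have : (∑ i ∈ s, (χ i x : ℂ)) = 1 := by exact_mod_cast hsum x (subset_closure hx)
        rw [this, one_smul]
      · filter_upwards [hΩ.isOpen.mem_nhds hx] with y hy using hsum y (subset_closure hy)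
    simp only [← dotCLM_apply]
    rw [← map_sum, h1]
  have e2 : pairing u c = ∑ i ∈ s, ∫ x in Ω, dot (c x) (b i x) := by
    rw [← integral_finsetSum _ fun i hi => hInt c _ (hbm i hi), pairing_comm]
    refine integral_congr_ae ?_
    filter_upwards [ae_restrict_mem hm] with x hx
    have h1 : ∑ i ∈ s, b i x = u x := by
      simp only [b, Set.indicator_of_mem hx]
      have : (∑ i ∈ s, (χ i x : ℂ)) = 1 := by exact_mod_cast hsum x (subset_closure hx)
      rw [← Finset.sum_smul, this, one_smul]
    simp only [← dotCLM_apply]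
    rw [← map_sum, h1]
  rw [e1, e2]
  exact Finset.sum_congr rfl key

/-! ### The Gagliardo seminorm and the Fourier transform on the plane -/

open scoped FourierTransform SchwartzMap

/-- The radial kernel `min(1, r²) / r³`. -/
def slobKernel (r : ℝ) : ℝ := min 1 (r ^ 2) / r ^ 3

theorem slobKernel_nonneg {r : ℝ} (hr : 0 ≤ r) : 0 ≤ slobKernel r := by
  unfold slobKernel; positivity

theorem measurable_slobKernel : Measurable slobKernel := by
  unfold slobKernel; fun_prop

theorem slobKernel_eq_min {r : ℝ} (hr : 0 < r) : slobKernel r = min (r ^ 3)⁻¹ r⁻¹ := by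
  have h : r⁻¹ = r ^ 2 / r ^ 3 := by field_simp
  rw [slobKernel, h, ← one_div, min_div_div_right (by positivity)]

theorem slobKernel_antitone {r s : ℝ} (hr : 0 < r) (hrs : r ≤ s) :
    slobKernel s ≤ slobKernel r := by
  rw [slobKernel_eq_min hr, slobKernel_eq_min (hr.trans_le hrs)]
  gcongr

/-- Polar coordinates in the plane contribute one factor `r`: the density is bounded near 0 and at
most `r⁻²` at infinity. -/
theorem integrable_slobKernel_norm : Integrable fun h : R2 => slobKernel ‖h‖ := by
  rw [integrable_fun_norm_addHaar volume (f := slobKernel)]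
  have hd : Module.finrank ℝ R2 = 2 := by simp
  rw [hd]
  have hm : AEStronglyMeasurable (fun y : ℝ => y ^ (2 - 1) • slobKernel y) volume :=
    ((measurable_id.pow_const _).smul measurable_slobKernel).aestronglyMeasurable
  rw [← Set.Ioc_union_Ioi_eq_Ioi (zero_le_one' ℝ), integrableOn_union]
  constructor
  · refine Measure.integrableOn_of_bounded (M := 1) (by simp) hm ?_
    refine (ae_restrict_iff' measurableSet_Ioc).mpr (Eventually.of_forall fun y hy => ?_)
    have h1 := slobKernel_nonneg hy.1.le
    rw [norm_smul, Real.norm_of_nonneg h1, Real.norm_of_nonneg (pow_nonneg hy.1.le _)]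
    rw [slobKernel_eq_min hy.1]
    have : y ^ (2 - 1) * min (y ^ 3)⁻¹ y⁻¹ ≤ y * y⁻¹ := by
      rw [pow_one]; exact mul_le_mul_of_nonneg_left (min_le_right _ _) hy.1.le
    rwa [mul_inv_cancel₀ hy.1.ne'] at this
  · have hint : IntegrableOn (fun y : ℝ => y ^ (-2 : ℝ)) (Set.Ioi 1) :=
      integrableOn_Ioi_rpow_of_lt (by norm_num) one_pos
    refine Integrable.mono' hint hm.restrict ?_
    refine (ae_restrict_iff' measurableSet_Ioi).mpr (Eventually.of_forall fun y hy => ?_)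
    have hy0 : 0 < y := one_pos.trans hy
    rw [norm_smul, Real.norm_of_nonneg (slobKernel_nonneg hy0.le),
      Real.norm_of_nonneg (pow_nonneg hy0.le _), slobKernel_eq_min hy0, Real.rpow_neg hy0.le]
    calc y ^ (2 - 1) * min (y ^ 3)⁻¹ y⁻¹ ≤ y * (y ^ 3)⁻¹ := by
          rw [pow_one]; exact mul_le_mul_of_nonneg_left (min_le_left _ _) hy0.le
      _ = (y ^ (2 : ℝ))⁻¹ := by
          rw [Real.rpow_two]; field_simp

/-- The total mass of the kernel `min(1, |h|²) / |h|³` on the plane. -/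
def slobMass : ℝ≥0∞ := ∫⁻ h : R2, ENNReal.ofReal (slobKernel ‖h‖)

theorem slobMass_lt_top : slobMass < ⊤ := by
  have h := integrable_slobKernel_norm.2
  rw [hasFiniteIntegral_iff_ofReal (Eventually.of_forall fun h => slobKernel_nonneg (norm_nonneg _))]
    at h
  exact h

theorem lintegral_slobKernel_smul {r : ℝ} (hr : 0 < r) :
    ∫⁻ h : R2, ENNReal.ofReal (slobKernel ‖r • h‖) = ENNReal.ofReal (r ^ 2)⁻¹ * slobMass := by
  have hm : Measurable fun h : R2 => ENNReal.ofReal (slobKernel ‖h‖) :=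
    (measurable_slobKernel.comp measurable_norm).ennreal_ofReal
  have h1 := Measure.map_addHaar_smul (volume : Measure R2) hr.ne'
  have h2 : ∫⁻ h : R2, ENNReal.ofReal (slobKernel ‖h‖) ∂(Measure.map (r • ·) volume) =
      ∫⁻ h : R2, ENNReal.ofReal (slobKernel ‖r • h‖) :=
    lintegral_map hm (measurable_const_smul r)
  rw [← h2, h1, lintegral_smul_measure]
  simp [slobMass, abs_of_pos, hr]

theorem lintegral_enorm_sq_fourier (f : 𝓢(R2, ℂ)) :
    ∫⁻ ξ, ‖𝓕 f ξ‖ₑ ^ 2 = ∫⁻ x, ‖f x‖ₑ ^ 2 := by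
  have h : ∀ g : 𝓢(R2, ℂ), ∫⁻ x, ‖g x‖ₑ ^ 2 = ENNReal.ofReal (∫ x, ‖g x‖ ^ 2) := fun g => by
    rw [ofReal_integral_eq_lintegral_ofReal]
    · refine lintegral_congr fun x => ?_
      rw [ENNReal.ofReal_pow (norm_nonneg _), ofReal_norm]
    · exact (g.memLp 2 volume).integrable_norm_pow (by norm_num)
    · exact Eventually.of_forall fun x => by positivity
  rw [h, h, SchwartzMap.integral_norm_sq_fourier]

theorem fourier_translate (f : 𝓢(R2, ℂ)) (h ξ : R2) :
    𝓕 (f.compSubConstCLM ℂ h) ξ = Real.fourierChar (-inner ℝ h ξ) • 𝓕 f ξ := by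
  rw [SchwartzMap.fourier_coe, SchwartzMap.fourier_coe, Real.fourier_eq, Real.fourier_eq,
    ← integral_sub_right_eq_self _ (-h), Circle.smul_def, ← integral_smul]
  refine integral_congr_ae (Eventually.of_forall fun v => ?_)
  simp only [SchwartzMap.compSubConstCLM_apply, sub_neg_eq_add, add_sub_cancel_right, Circle.smul_def,
    inner_add_left, neg_add, AddChar.map_add_eq_mul, Circle.coe_mul, smul_eq_mul]
  ring

theorem norm_one_sub_fourierChar_sq_le (θ : ℝ) :
    ‖(1 : ℂ) - Real.fourierChar θ‖ ^ 2 ≤ 4 * Real.pi ^ 2 * min 1 (θ ^ 2) := by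
  have h1 : ‖(1 : ℂ) - Real.fourierChar θ‖ ≤ 2 := by
    refine (norm_sub_le _ _).trans ?_
    rw [norm_one, Circle.norm_coe]; norm_num
  have h2 : ‖(1 : ℂ) - Real.fourierChar θ‖ ≤ 2 * Real.pi * |θ| := by
    rw [norm_sub_rev, Real.fourierChar_apply]
    have := Real.norm_exp_I_mul_ofReal_sub_one_le (x := 2 * Real.pi * θ)
    rw [mul_comm Complex.I] at this
    refine this.trans (le_of_eq ?_)
    rw [Real.norm_eq_abs, abs_mul, abs_of_pos (by positivity)]
  have hpi := Real.pi_gt_three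
  rcases min_cases 1 (θ ^ 2) with ⟨h, -⟩ | ⟨h, -⟩
  · rw [h]
    nlinarith [norm_nonneg ((1 : ℂ) - Real.fourierChar θ)]
  · rw [h, ← sq_abs θ]
    calc _ ≤ (2 * Real.pi * |θ|) ^ 2 := by gcongr
      _ = _ := by ring

/-- Plancherel: subtracting a translate multiplies the Fourier transform by `1 - exp(-2πi h·ξ)`. -/
theorem lintegral_enorm_sub_translate_sq (f : 𝓢(R2, ℂ)) (h : R2) :
    ∫⁻ x, ‖f x - f (x - h)‖ₑ ^ 2 =
      ∫⁻ ξ, ‖(1 : ℂ) - Real.fourierChar (-inner ℝ h ξ)‖ₑ ^ 2 * ‖𝓕 f ξ‖ₑ ^ 2 := by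
  have := lintegral_enorm_sq_fourier (f - f.compSubConstCLM ℂ h)
  simp only [sub_apply, SchwartzMap.compSubConstCLM_apply] at this
  rw [← this]
  refine lintegral_congr fun ξ => ?_
  rw [sub_eq_add_neg, FourierTransform.fourier_add, ← neg_one_smul ℂ (f.compSubConstCLM ℂ h),
    FourierTransform.fourier_smul, add_apply, smul_apply, fourier_translate, ← mul_pow, ← enorm_mul,
    Circle.smul_def]
  congr 2
  simp only [smul_eq_mul]
  ring

/-- The square of the Gagliardo seminorm of order `1/2` on the plane. -/
def gagliardo (q : R2 → ℂ) : ℝ≥0∞ := ∫⁻ x, ∫⁻ y, ‖q x - q y‖ₑ ^ 2 / edist x y ^ 3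

/-- The numerator is at most `4π² min(1, |ξ|²|h|²)`, so the integrand is dominated by `4π² |ξ|³
slobKernel (|ξ||h|)`. Rescaling in two dimensions returns `|ξ|⁻²`, leaving one power of `|ξ|`, the
weight of the half-order seminorm. -/
theorem kernel_bound (ξ : R2) : ∫⁻ h : R2, ‖(1 : ℂ) - Real.fourierChar (-inner ℝ h ξ)‖ₑ ^ 2 /
    ‖h‖ₑ ^ 3 ≤ ENNReal.ofReal (4 * Real.pi ^ 2) * slobMass * ‖ξ‖ₑ := by
  rcases eq_or_ne ξ 0 with rfl | hξ
  · simp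
  have hξ' : 0 < ‖ξ‖ := norm_pos_iff.mpr hξ
  have h1 : ∀ h : R2, ‖(1 : ℂ) - Real.fourierChar (-inner ℝ h ξ)‖ₑ ^ 2 / ‖h‖ₑ ^ 3 ≤
      ENNReal.ofReal (4 * Real.pi ^ 2 * ‖ξ‖ ^ 3) * ENNReal.ofReal (slobKernel ‖‖ξ‖ • h‖) := by
    intro h
    rcases eq_or_ne h 0 with rfl | hh
    · simp
    have hh' : 0 < ‖h‖ := norm_pos_iff.mpr hh
    rw [← ofReal_norm, ← ofReal_norm, ← ENNReal.ofReal_pow (norm_nonneg _),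
      ← ENNReal.ofReal_pow (norm_nonneg _), ← ENNReal.ofReal_div_of_pos (by positivity),
      ← ENNReal.ofReal_mul (by positivity)]
    refine ENNReal.ofReal_le_ofReal ?_
    rw [norm_smul, norm_norm, slobKernel, div_le_iff₀ (by positivity)]
    refine (norm_one_sub_fourierChar_sq_le _).trans ?_
    have h2 : (-inner ℝ h ξ) ^ 2 ≤ (‖ξ‖ * ‖h‖) ^ 2 := by
      rw [neg_sq, ← sq_abs]
      gcongr
      rw [mul_comm]
      exact abs_real_inner_le_norm h ξ
    calc 4 * Real.pi ^ 2 * min 1 ((-inner ℝ h ξ) ^ 2)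
        ≤ 4 * Real.pi ^ 2 * min 1 ((‖ξ‖ * ‖h‖) ^ 2) := by gcongr
      _ = _ := by field_simp
  refine (lintegral_mono h1).trans ?_
  rw [lintegral_const_mul' _ _ ENNReal.ofReal_ne_top, lintegral_slobKernel_smul hξ', ← mul_assoc,
    ← ENNReal.ofReal_mul (by positivity), ← ofReal_norm ξ,
    mul_right_comm (ENNReal.ofReal (4 * Real.pi ^ 2)), ← ENNReal.ofReal_mul (by positivity)]
  refine le_of_eq ?_
  congr 2
  field_simp

theorem continuous_one_sub_fourierChar :
    Continuous fun p : R2 × R2 => (1 : ℂ) - Real.fourierChar (-inner ℝ p.1 p.2) := by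
  have h : Continuous fun p : R2 × R2 => -inner ℝ p.1 p.2 := (continuous_fst.inner continuous_snd).neg
  exact continuous_const.sub (continuous_subtype_val.comp (Real.continuous_fourierChar.comp h))

theorem gagliardo_le (f : 𝓢(R2, ℂ)) :
    gagliardo f ≤ ENNReal.ofReal (4 * Real.pi ^ 2) * slobMass * ∫⁻ ξ, ‖ξ‖ₑ * ‖𝓕 f ξ‖ₑ ^ 2 := by
  have hf : Continuous f := f.continuous
  obtain ⟨F, hFF, hF⟩ : ∃ F : R2 → ℂ, (∀ ξ, 𝓕 f ξ = F ξ) ∧ Continuous F :=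
    ⟨_, fun _ => rfl, (𝓕 f).continuous⟩
  simp_rw [hFF]
  have hE : Measurable fun p : R2 × R2 => ‖(1 : ℂ) - Real.fourierChar (-inner ℝ p.1 p.2)‖ₑ ^ 2 /
      ‖p.1‖ₑ ^ 3 := by
    refine Measurable.div ?_ (by fun_prop)
    exact continuous_one_sub_fourierChar.measurable.enorm.pow_const _
  have hF2 : Measurable fun ξ => ‖F ξ‖ₑ ^ 2 := hF.measurable.enorm.pow_const _
  have e1 : gagliardo f = ∫⁻ h : R2, ∫⁻ x, ‖f x - f (x - h)‖ₑ ^ 2 / ‖h‖ₑ ^ 3 := by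
    have : ∀ x, ∫⁻ y, ‖f x - f y‖ₑ ^ 2 / edist x y ^ 3 =
        ∫⁻ h, ‖f x - f (x - h)‖ₑ ^ 2 / ‖h‖ₑ ^ 3 := fun x => by
      rw [← lintegral_sub_left_eq_self _ x]
      refine lintegral_congr fun h => ?_
      rw [edist_eq_enorm_sub, sub_sub_cancel]
    rw [gagliardo, lintegral_congr this]
    refine lintegral_lintegral_swap (Measurable.aemeasurable ?_)
    have h1 : Continuous fun p : R2 × R2 => f p.1 - f (p.1 - p.2) :=
      (hf.comp continuous_fst).sub (hf.comp (continuous_fst.sub continuous_snd))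
    exact (h1.measurable.enorm.pow_const _).div (measurable_snd.enorm.pow_const _)
  have e2 : ∀ h : R2, ∫⁻ x, ‖f x - f (x - h)‖ₑ ^ 2 / ‖h‖ₑ ^ 3 =
      ∫⁻ ξ, ‖(1 : ℂ) - Real.fourierChar (-inner ℝ h ξ)‖ₑ ^ 2 / ‖h‖ₑ ^ 3 * ‖F ξ‖ₑ ^ 2 := fun h => by
    have h1 : Continuous fun x => f x - f (x - h) := hf.sub (hf.comp (continuous_id.sub continuous_const))
    simp_rw [div_eq_mul_inv]
    rw [lintegral_mul_const _ (h1.measurable.enorm.pow_const _), lintegral_enorm_sub_translate_sq]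
    simp_rw [hFF]
    rw [← lintegral_mul_const]
    · refine lintegral_congr fun ξ => by ring
    · refine Measurable.mul ?_ hF2
      exact (continuous_one_sub_fourierChar.comp
        (Continuous.prodMk_right h)).measurable.enorm.pow_const _
  rw [e1, lintegral_congr e2, lintegral_lintegral_swap, ← lintegral_const_mul]
  · refine lintegral_mono fun ξ => ?_
    refine (lintegral_mul_const (‖F ξ‖ₑ ^ 2) (hE.comp (measurable_prodMk_right (y := ξ)))).trans_le ?_
    rw [← mul_assoc]
    exact mul_le_mul_left (kernel_bound ξ) _
  · exact measurable_enorm.mul hF2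
  · exact (hE.mul (hF2.comp measurable_snd)).aemeasurable

/-! ### Norms of order `±1/2` and the planar decomposition -/

open scoped FourierTransform SchwartzMap LineDeriv

/-- The squared `H^{1/2}` norm on the plane, on the Fourier side. -/
def posHalf (f : 𝓢(R2, ℂ)) : ℝ≥0∞ := ∫⁻ ξ, ENNReal.ofReal ((1 + ‖ξ‖) * ‖𝓕 f ξ‖ ^ 2)

/-- The squared `H^{-1/2}` norm on the plane, on the Fourier side. -/
def negHalf (f : 𝓢(R2, ℂ)) : ℝ≥0∞ := ∫⁻ ξ, ENNReal.ofReal ((1 + ‖ξ‖)⁻¹ * ‖𝓕 f ξ‖ ^ 2)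

theorem measurable_negHalf_integrand (f : 𝓢(R2, ℂ)) :
    Measurable fun ξ : R2 => ENNReal.ofReal ((1 + ‖ξ‖)⁻¹ * ‖𝓕 f ξ‖ ^ 2) := by
  have h : Continuous (𝓕 f : 𝓢(R2, ℂ)) := (𝓕 f).continuous
  exact ((measurable_const.add measurable_norm).inv.mul (h.norm.measurable.pow_const 2)).ennreal_ofReal

theorem lintegral_enorm_sq_add_gagliardo_le (f : 𝓢(R2, ℂ)) :
    (∫⁻ x, ‖f x‖ₑ ^ 2) + gagliardo f ≤
      (1 + ENNReal.ofReal (4 * Real.pi ^ 2) * slobMass) * posHalf f := by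
  have hF : Continuous (𝓕 f : 𝓢(R2, ℂ)) := (𝓕 f).continuous
  have h1 : ∫⁻ ξ, ‖𝓕 f ξ‖ₑ ^ 2 ≤ posHalf f := by
    refine lintegral_mono fun ξ => ?_
    rw [← ofReal_norm, ← ENNReal.ofReal_pow (norm_nonneg _)]
    exact ENNReal.ofReal_le_ofReal (le_mul_of_one_le_left (by positivity)
      (by linarith [norm_nonneg ξ]))
  have h2 : ∫⁻ ξ, ‖ξ‖ₑ * ‖𝓕 f ξ‖ₑ ^ 2 ≤ posHalf f := by
    refine lintegral_mono fun ξ => ?_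
    rw [← ofReal_norm, ← ofReal_norm, ← ENNReal.ofReal_pow (norm_nonneg _),
      ← ENNReal.ofReal_mul (norm_nonneg _)]
    gcongr
    linarith
  rw [add_mul, one_mul, ← lintegral_enorm_sq_fourier]
  exact add_le_add h1 ((gagliardo_le f).trans (mul_le_mul_right h2 _))

theorem fourier_lineDeriv_apply (f : 𝓢(R2, ℂ)) (m ξ : R2) :
    𝓕 (∂_{m} f) ξ = 2 * Real.pi * Complex.I * (inner ℝ ξ m : ℝ) * 𝓕 f ξ := by
  rw [SchwartzMap.fourier_lineDerivOp_eq, smul_apply, SchwartzMap.smulLeftCLM_apply_apply (by fun_prop)]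
  rw [Complex.real_smul, smul_eq_mul]
  ring

/-- The standard unit vectors of the plane. -/
abbrev e2 (j : Fin 2) : R2 := EuclideanSpace.single j 1

/-- The potential is a multiple of the divergence with symbol divided by `1 + |ξ|²`. Using this
weight instead of `|ξ|²` avoids the singularity at the origin and keeps the potential in the
Schwartz class. -/
theorem exists_potential (φ₀ φ₁ : 𝓢(R2, ℂ)) : ∃ p : 𝓢(R2, ℂ), ∀ ξ, 𝓕 p ξ =
    (((1 + ‖ξ‖ ^ 2)⁻¹ : ℝ) : ℂ) * (-(Complex.I / (2 * Real.pi))) *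
      ((ξ 0 : ℂ) * 𝓕 φ₀ ξ + (ξ 1 : ℂ) * 𝓕 φ₁ ξ) := by
  have hg : Function.HasTemperateGrowth fun ξ : R2 => (((1 + ‖ξ‖ ^ 2) ^ (-1 : ℝ) : ℝ)) :=
    Function.hasTemperateGrowth_one_add_norm_sq_rpow R2 (-1)
  refine ⟨(-(1 / (4 * Real.pi ^ 2) : ℝ)) • SchwartzMap.fourierMultiplierCLM ℂ
    (fun ξ : R2 => (((1 + ‖ξ‖ ^ 2) ^ (-1 : ℝ) : ℝ))) (∂_{e2 0} φ₀ + ∂_{e2 1} φ₁), fun ξ => ?_⟩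
  rw [FourierTransform.fourier_smul, smul_apply, SchwartzMap.fourierMultiplierCLM_apply,
    FourierTransform.fourier_fourierInv_eq, SchwartzMap.smulLeftCLM_apply_apply hg,
    FourierTransform.fourier_add, add_apply, fourier_lineDeriv_apply, fourier_lineDeriv_apply,
    Real.rpow_neg_one]
  simp only [EuclideanSpace.inner_single_right, Complex.real_smul]
  have hpi : (Real.pi : ℂ) ≠ 0 := by exact_mod_cast Real.pi_ne_zero
  push_cast
  simp
  field_simp
  ring

theorem norm_coord_le (ξ : R2) (j : Fin 2) : ‖(ξ j : ℂ)‖ ≤ ‖ξ‖ := by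
  rw [Complex.norm_real]; exact PiLp.norm_apply_le ξ j

/-- Equivalent to `(1 + t)² ≤ 2(1 + t²)`. It trades the weight of order `1/2` for that of order
`-1/2`, using the one order gained from the symbol. -/
theorem weight_mul_le {t : ℝ} (ht : 0 ≤ t) :
    (1 + t) * ((1 + t ^ 2)⁻¹) ^ 2 * (1 + t ^ 2) ≤ 2 * (1 + t)⁻¹ := by
  have h : (1 + t) * ((1 + t ^ 2)⁻¹) ^ 2 * (1 + t ^ 2) = (1 + t) / (1 + t ^ 2) := by
    field_simp
  rw [h, ← div_eq_mul_inv, div_le_div_iff₀ (by positivity) (by positivity)]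
  nlinarith [sq_nonneg (t - 1)]

/-- Hodge-type decomposition of a planar field into a gradient and a field controlled by its curl. -/
theorem exists_plane_decomposition (φ₀ φ₁ : 𝓢(R2, ℂ)) : ∃ p ψ₀ ψ₁ : 𝓢(R2, ℂ),
    φ₀ = ψ₀ + ∂_{e2 0} p ∧ φ₁ = ψ₁ + ∂_{e2 1} p ∧
    posHalf p ≤ 4 * (negHalf φ₀ + negHalf φ₁) ∧
    posHalf ψ₀ ≤ 4 * (negHalf φ₀ + negHalf (∂_{e2 0} φ₁ - ∂_{e2 1} φ₀)) ∧
    posHalf ψ₁ ≤ 4 * (negHalf φ₁ + negHalf (∂_{e2 0} φ₁ - ∂_{e2 1} φ₀)) := by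
  obtain ⟨p, hp⟩ := exists_potential φ₀ φ₁
  have hpi : (Real.pi : ℂ) ≠ 0 := by exact_mod_cast Real.pi_ne_zero
  have hpi3 := Real.pi_gt_three
  -- The first alternative is the shape of the bound for the remainders `ψⱼ`, the second that for
  -- the potential `p`. The constant 4 combines the factor 2 of `weight_mul_le` with a factor 2 from
  -- squaring a sum.
  have key : ∀ (f g h : 𝓢(R2, ℂ)) , (∀ ξ, ‖𝓕 f ξ‖ ≤ (1 + ‖ξ‖ ^ 2)⁻¹ * (‖𝓕 g ξ‖ + ‖ξ‖ * ‖𝓕 h ξ‖) ∨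
      ‖𝓕 f ξ‖ ≤ (1 + ‖ξ‖ ^ 2)⁻¹ * (‖ξ‖ * ‖𝓕 g ξ‖ + ‖ξ‖ * ‖𝓕 h ξ‖)) →
      posHalf f ≤ 4 * (negHalf g + negHalf h) := by
    intro f g h hb
    unfold posHalf negHalf
    rw [← lintegral_add_left (measurable_negHalf_integrand g),
      ← lintegral_const_mul' _ _ (by simp)]
    refine lintegral_mono fun ξ => ?_
    have h4 : (4 : ℝ≥0∞) = ENNReal.ofReal 4 := by simp
    rw [← ENNReal.ofReal_add (by positivity) (by positivity), h4, ← ENNReal.ofReal_mul (by norm_num)]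
    refine ENNReal.ofReal_le_ofReal ?_
    have ht := norm_nonneg ξ
    have hw := weight_mul_le ht
    have hbd : ‖𝓕 f ξ‖ ^ 2 ≤ ((1 + ‖ξ‖ ^ 2)⁻¹) ^ 2 * (1 + ‖ξ‖ ^ 2) *
        (2 * (‖𝓕 g ξ‖ ^ 2 + ‖𝓕 h ξ‖ ^ 2)) := by
      have hb := hb ξ
      generalize ‖𝓕 g ξ‖ = a at hb ⊢
      generalize ‖𝓕 h ξ‖ = b at hb ⊢
      rcases hb with hb | hb
      · refine (pow_le_pow_left₀ (norm_nonneg _) hb 2).trans ?_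
        rw [mul_pow, mul_assoc]
        gcongr
        nlinarith [sq_nonneg (a - ‖ξ‖ * b), sq_nonneg (‖ξ‖ * a), sq_nonneg b]
      · refine (pow_le_pow_left₀ (norm_nonneg _) hb 2).trans ?_
        rw [mul_pow, mul_assoc]
        gcongr
        nlinarith [sq_nonneg (‖ξ‖ * (a - b)), sq_nonneg a, sq_nonneg b]
    calc (1 + ‖ξ‖) * ‖𝓕 f ξ‖ ^ 2 ≤ (1 + ‖ξ‖) * (((1 + ‖ξ‖ ^ 2)⁻¹) ^ 2 * (1 + ‖ξ‖ ^ 2) *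
        (2 * (‖𝓕 g ξ‖ ^ 2 + ‖𝓕 h ξ‖ ^ 2))) := by gcongr
      _ = ((1 + ‖ξ‖) * ((1 + ‖ξ‖ ^ 2)⁻¹) ^ 2 * (1 + ‖ξ‖ ^ 2)) *
        (2 * (‖𝓕 g ξ‖ ^ 2 + ‖𝓕 h ξ‖ ^ 2)) := by ring
      _ ≤ (2 * (1 + ‖ξ‖)⁻¹) * (2 * (‖𝓕 g ξ‖ ^ 2 + ‖𝓕 h ξ‖ ^ 2)) := by gcongr
      _ = _ := by ring
  have fsub : ∀ (f g : 𝓢(R2, ℂ)) ξ, 𝓕 (f - g) ξ = 𝓕 f ξ - 𝓕 g ξ := fun f g ξ => by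
    rw [sub_eq_add_neg, FourierTransform.fourier_add, ← neg_one_smul ℂ g,
      FourierTransform.fourier_smul, add_apply, smul_apply, neg_one_smul, sub_eq_add_neg]
  have hrot : ∀ ξ, 𝓕 (∂_{e2 0} φ₁ - ∂_{e2 1} φ₀) ξ =
      2 * Real.pi * Complex.I * ((ξ 0 : ℂ) * 𝓕 φ₁ ξ - (ξ 1 : ℂ) * 𝓕 φ₀ ξ) := fun ξ => by
    rw [fsub, fourier_lineDeriv_apply, fourier_lineDeriv_apply]
    simp only [EuclideanSpace.inner_single_right]
    simp
    ring
  have hpsi : ∀ (j : Fin 2) (ξ : R2), 𝓕 (∂_{e2 j} p) ξ = (((1 + ‖ξ‖ ^ 2)⁻¹ : ℝ) : ℂ) * (ξ j : ℂ) *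
      ((ξ 0 : ℂ) * 𝓕 φ₀ ξ + (ξ 1 : ℂ) * 𝓕 φ₁ ξ) := fun j ξ => by
    rw [fourier_lineDeriv_apply, hp]
    simp only [EuclideanSpace.inner_single_right]
    simp
    field_simp
    rw [Complex.I_sq]
    ring
  have hn : ∀ ξ : R2, ((‖ξ‖ : ℂ)) ^ 2 = (ξ 0 : ℂ) ^ 2 + (ξ 1 : ℂ) ^ 2 := fun ξ => by
    have := EuclideanSpace.real_norm_sq_eq ξ
    rw [Fin.sum_univ_two] at this
    exact_mod_cast this
  have hne : ∀ ξ : R2, (1 + (‖ξ‖ : ℂ) ^ 2) ≠ 0 := fun ξ => by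
    have : (0 : ℝ) < 1 + ‖ξ‖ ^ 2 := by positivity
    exact_mod_cast this.ne'
  have hinv : ∀ ξ : R2, ‖(((1 + ‖ξ‖ ^ 2)⁻¹ : ℝ) : ℂ)‖ = (1 + ‖ξ‖ ^ 2)⁻¹ := fun ξ => by
    rw [Complex.norm_real, Real.norm_of_nonneg (by positivity)]
  have hpinorm : ‖(2 * Real.pi * Complex.I : ℂ)‖ = 2 * Real.pi := by
    simp [abs_of_pos Real.pi_pos]
  refine ⟨p, φ₀ - ∂_{e2 0} p, φ₁ - ∂_{e2 1} p, by simp, by simp, key _ _ _ fun ξ => Or.inr ?_,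
    key _ _ _ fun ξ => Or.inl ?_, key _ _ _ fun ξ => Or.inl ?_⟩
  · rw [hp, norm_mul, norm_mul, hinv, mul_assoc]
    gcongr
    have h1 : ‖-(Complex.I / (2 * Real.pi))‖ ≤ 1 := by
      have h2 : ‖(2 * Real.pi : ℂ)‖ = 2 * Real.pi := by simp [abs_of_pos Real.pi_pos]
      rw [norm_neg, norm_div, Complex.norm_I, h2, div_le_one (by positivity)]
      linarith
    refine (mul_le_of_le_one_left (norm_nonneg _) h1).trans ((norm_add_le _ _).trans ?_)
    rw [norm_mul, norm_mul]
    gcongr <;> exact norm_coord_le ξ _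
  -- Since `1 + |ξ|² - ξ₀² = 1 + ξ₁²`, removing the gradient leaves only `φ̂₀` and `ξ₁` times the
  -- rotation, both divided by `1 + |ξ|²`.
  · have : 𝓕 (φ₀ - ∂_{e2 0} p) ξ = (((1 + ‖ξ‖ ^ 2)⁻¹ : ℝ) : ℂ) *
        (𝓕 φ₀ ξ - (ξ 1 : ℂ) * ((ξ 0 : ℂ) * 𝓕 φ₁ ξ - (ξ 1 : ℂ) * 𝓕 φ₀ ξ)) := by
      rw [fsub, hpsi]
      push_cast
      field_simp [hne ξ]
      rw [hn]; ring
    rw [this, norm_mul, hinv, hrot]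
    gcongr
    refine (norm_sub_le _ _).trans ?_
    gcongr
    rw [norm_mul, norm_mul, hpinorm]
    gcongr
    · exact norm_coord_le ξ _
    · exact le_mul_of_one_le_left (norm_nonneg _) (by linarith)
  · have : 𝓕 (φ₁ - ∂_{e2 1} p) ξ = (((1 + ‖ξ‖ ^ 2)⁻¹ : ℝ) : ℂ) *
        (𝓕 φ₁ ξ + (ξ 0 : ℂ) * ((ξ 0 : ℂ) * 𝓕 φ₁ ξ - (ξ 1 : ℂ) * 𝓕 φ₀ ξ)) := by
      rw [fsub, hpsi]
      push_cast
      field_simp [hne ξ]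
      rw [hn]; ring
    rw [this, norm_mul, hinv, hrot]
    gcongr
    refine (norm_add_le _ _).trans ?_
    gcongr
    rw [norm_mul, norm_mul, hpinorm]
    gcongr
    · exact norm_coord_le ξ _
    · exact le_mul_of_one_le_left (norm_nonneg _) (by linarith)

/-! ### Traces of slices in `H^{-1/2}` -/

open scoped FourierTransform SchwartzMap LineDeriv

/-- The slice at height `s` of a test function on `ℝ² × ℝ`. -/
def slice {u : R2 × ℝ → ℂ} (hu : ContDiff ℝ ∞ u) (hc : HasCompactSupport u) (s : ℝ) : 𝓢(R2, ℂ) :=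
  HasCompactSupport.toSchwartzMap (f := fun y => u (y, s))
    (HasCompactSupport.intro (hc.image continuous_fst) fun y hy => by
      by_contra h
      exact hy ⟨(y, s), subset_tsupport _ h, rfl⟩)
    (hu.comp (contDiff_id.prodMk contDiff_const))

@[simp] theorem slice_apply {u : R2 × ℝ → ℂ} (hu : ContDiff ℝ ∞ u) (hc : HasCompactSupport u) (s : ℝ)
    (y : R2) : slice hu hc s y = u (y, s) := rfl

theorem lineDeriv_slice {v : R2 × ℝ → ℂ} (hv : ContDiff ℝ ∞ v) (hc : HasCompactSupport v) (j : Fin 2)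
    (s : ℝ) (y : R2) : (∂_{e2 j} (slice hv hc s)) y = fderiv ℝ v (y, s) (e2 j, 0) := by
  rw [SchwartzMap.lineDerivOp_apply_eq_fderiv]
  have h1 : HasFDerivAt v (fderiv ℝ v (y, s)) (y, s) := (hv.differentiable (by simp) _).hasFDerivAt
  have h2 : HasFDerivAt (fun y : R2 => (y, s)) (ContinuousLinearMap.inl ℝ R2 ℝ) y :=
    hasFDerivAt_prodMk_left y s
  have h3 := (h1.comp y h2).fderiv
  have h4 : (⇑(slice hv hc s) : R2 → ℂ) = v ∘ fun y : R2 => (y, s) := rfl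
  rw [h4, h3]
  simp

/-- The character `y ↦ exp(-2πi y·ξ)` as a function of `(y, ξ)`. -/
def planeWave (p : R2 × R2) : ℂ := (Real.fourierChar (-inner ℝ p.1 p.2) : ℂ)

theorem continuous_planeWave : Continuous planeWave := by
  have h : Continuous fun p : R2 × R2 => -inner ℝ p.1 p.2 := (continuous_fst.inner continuous_snd).neg
  exact continuous_subtype_val.comp (Real.continuous_fourierChar.comp h)

theorem fourier_slice {u : R2 × ℝ → ℂ} (hu : ContDiff ℝ ∞ u) (hc : HasCompactSupport u) (s : ℝ)
    (ξ : R2) : 𝓕 (slice hu hc s) ξ = ∫ y : R2, planeWave (y, ξ) * u (y, s) := by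
  rw [SchwartzMap.fourier_coe, Real.fourier_eq]; rfl

theorem measurable_fourier_slice {u : R2 × ℝ → ℂ} (hu : ContDiff ℝ ∞ u) (hc : HasCompactSupport u) :
    Measurable fun p : R2 × ℝ => 𝓕 (slice hu hc p.2) p.1 := by
  simp_rw [fourier_slice]
  have h : Continuous fun q : (R2 × ℝ) × R2 =>
      planeWave (q.2, q.1.1) * u (q.2, q.1.2) := by
    refine Continuous.mul ?_ ?_
    · exact continuous_planeWave.comp
        (continuous_snd.prodMk (continuous_fst.comp continuous_fst))
    · exact hu.continuous.comp (continuous_snd.prodMk (continuous_snd.comp continuous_fst))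
  exact (StronglyMeasurable.integral_prod_right' h.stronglyMeasurable).measurable

/-- The derivative in the vertical direction. -/
def vderiv (u : R2 × ℝ → ℂ) (q : R2 × ℝ) : ℂ := fderiv ℝ u q (0, 1)

theorem contDiff_vderiv {u : R2 × ℝ → ℂ} (hu : ContDiff ℝ ∞ u) : ContDiff ℝ ∞ (vderiv u) :=
  (hu.fderiv_right (by simp)).clm_apply contDiff_const

theorem hasCompactSupport_vderiv {u : R2 × ℝ → ℂ} (hc : HasCompactSupport u) :
    HasCompactSupport (vderiv u) := by
  refine (hc.fderiv (𝕜 := ℝ)).comp_left (g := fun L : R2 × ℝ →L[ℝ] ℂ => L (0, 1)) (by simp)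

theorem hasDerivAt_vertical {u : R2 × ℝ → ℂ} (hu : ContDiff ℝ ∞ u) (y : R2) (s : ℝ) :
    HasDerivAt (fun s => u (y, s)) (vderiv u (y, s)) s := by
  have h1 : HasFDerivAt u (fderiv ℝ u (y, s)) (y, s) := (hu.differentiable (by simp) _).hasFDerivAt
  have h2 : HasDerivAt (fun s : ℝ => (y, s)) ((0 : R2), (1 : ℝ)) s :=
    (hasDerivAt_const s y).prodMk (hasDerivAt_id s)
  exact h1.comp_hasDerivAt s h2

/-- The fundamental theorem of calculus for `exp(-λs) u(y, s)`; compact support removes any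
condition on `λ`, which is later allowed to depend on the frequency. -/
theorem value_zero_eq_integral {u : R2 × ℝ → ℂ} (hu : ContDiff ℝ ∞ u) (hc : HasCompactSupport u)
    (lam : ℝ) (y : R2) : u (y, 0) = ∫ s in Set.Ioi (0 : ℝ),
      (Real.exp (-lam * s) : ℂ) * (lam * u (y, s) - vderiv u (y, s)) := by
  have hd : ∀ s, HasDerivAt (fun s : ℝ => ((Real.exp (-lam * s) : ℝ) : ℂ) * u (y, s))
      (-((Real.exp (-lam * s) : ℂ) * (lam * u (y, s) - vderiv u (y, s)))) s := by
    intro s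
    have h1 : HasDerivAt (fun s : ℝ => ((Real.exp (-lam * s) : ℝ) : ℂ))
        ((Real.exp (-lam * s) * -lam : ℝ) : ℂ) s := by
      have : HasDerivAt (fun s : ℝ => Real.exp (-lam * s)) (Real.exp (-lam * s) * -lam) s := by
        simpa using ((hasDerivAt_id s).const_mul (-lam)).exp
      exact this.ofReal_comp
    refine (h1.mul (hasDerivAt_vertical hu y s)).congr_deriv ?_
    push_cast
    ring
  have hsupp : HasCompactSupport fun s : ℝ => ((Real.exp (-lam * s) : ℝ) : ℂ) * u (y, s) :=
    HasCompactSupport.intro (hc.image continuous_snd) fun s hs => by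
      by_contra h
      exact hs ⟨(y, s), subset_tsupport _ (right_ne_zero_of_mul h), rfl⟩
  have hsm : ContDiff ℝ 1 fun s : ℝ => ((Real.exp (-lam * s) : ℝ) : ℂ) * u (y, s) := by
    refine ContDiff.mul ?_ ?_
    · exact Complex.ofRealCLM.contDiff.comp
        (Real.contDiff_exp.comp (contDiff_const.mul contDiff_id))
    · exact (hu.of_le (by simp)).comp (contDiff_const.prodMk contDiff_id)
  have := hsupp.integral_Ioi_deriv_eq hsm 0
  rw [integral_congr_ae (Eventually.of_forall fun s => (hd s).deriv), integral_neg, neg_inj] at this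
  rw [this]
  simp

/-- The previous formula after a horizontal Fourier transform, by Fubini; now `λ` may be chosen for
each `ξ` separately. -/
theorem fourier_slice_zero {u : R2 × ℝ → ℂ} (hu : ContDiff ℝ ∞ u) (hc : HasCompactSupport u)
    (lam : ℝ) (ξ : R2) : 𝓕 (slice hu hc 0) ξ = ∫ s in Set.Ioi (0 : ℝ), (Real.exp (-lam * s) : ℂ) *
      (lam * 𝓕 (slice hu hc s) ξ -
        𝓕 (slice (contDiff_vderiv hu) (hasCompactSupport_vderiv hc) s) ξ) := by
  have hE : Continuous fun y : R2 => planeWave (y, ξ) :=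
    continuous_planeWave.comp (continuous_id.prodMk continuous_const)
  have hv := (contDiff_vderiv hu).continuous
  have hint : ∀ (w : R2 × ℝ → ℂ), Continuous w → HasCompactSupport w → ∀ s,
      Integrable fun y : R2 => planeWave (y, ξ) * w (y, s) := by
    intro w hw hwc s
    refine Continuous.integrable_of_hasCompactSupport
      (hE.mul (hw.comp (continuous_id.prodMk continuous_const))) ?_
    exact HasCompactSupport.intro (hwc.image continuous_fst) fun y hy => by
      by_contra h
      exact hy ⟨(y, s), subset_tsupport _ (right_ne_zero_of_mul h), rfl⟩
  rw [fourier_slice]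
  calc ∫ y : R2, planeWave (y, ξ) * u (y, 0)
      = ∫ y : R2, ∫ s in Set.Ioi (0 : ℝ), planeWave (y, ξ) *
        ((Real.exp (-lam * s) : ℂ) * (lam * u (y, s) - vderiv u (y, s))) := by
        refine integral_congr_ae (Eventually.of_forall fun y => ?_)
        simp only
        rw [value_zero_eq_integral hu hc lam y, integral_const_mul]
    _ = ∫ s in Set.Ioi (0 : ℝ), ∫ y : R2, planeWave (y, ξ) *
        ((Real.exp (-lam * s) : ℂ) * (lam * u (y, s) - vderiv u (y, s))) := by
        refine integral_integral_swap ?_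
        have hcont : Continuous (Function.uncurry fun (y : R2) (s : ℝ) =>
            planeWave (y, ξ) *
            ((Real.exp (-lam * s) : ℂ) * (lam * u (y, s) - vderiv u (y, s)))) := by
          refine (hE.comp continuous_fst).mul (Continuous.mul ?_ ((continuous_const.mul
            hu.continuous).sub hv))
          exact Complex.continuous_ofReal.comp
            (Real.continuous_exp.comp (continuous_const.mul continuous_snd))
        have hi := hcont.integrable_of_hasCompactSupport (μ := (volume : Measure (R2 × ℝ)))
          (HasCompactSupport.intro hc fun q hq => by
            have h1 : u q = 0 := image_eq_zero_of_notMem_tsupport hq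
            have h2 : vderiv u q = 0 := by
              have : fderiv ℝ u q = 0 := by
                by_contra h
                exact hq (tsupport_fderiv_subset ℝ (subset_tsupport _ h))
              simp [vderiv, this]
            show _ * (_ * (_ * u q - vderiv u q)) = _
            simp [h1, h2])
        rw [Measure.volume_eq_prod] at hi
        have := hi.restrict (s := Set.univ ×ˢ Set.Ioi (0 : ℝ))
        rwa [← Measure.prod_restrict, Measure.restrict_univ] at this
    _ = _ := by
        refine integral_congr_ae (Eventually.of_forall fun s => ?_)
        simp only
        rw [fourier_slice, fourier_slice, ← integral_const_mul,
          ← integral_sub ((hint u hu.continuous hc s).const_mul _)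
            (hint _ hv (hasCompactSupport_vderiv hc) s), ← integral_const_mul]
        refine integral_congr_ae (Eventually.of_forall fun y => ?_)
        ring

theorem lintegral_exp_sq {lam : ℝ} (hl : 0 < lam) :
    ∫⁻ s in Set.Ioi (0 : ℝ), ENNReal.ofReal (Real.exp (-lam * s)) ^ 2 =
      ENNReal.ofReal (2 * lam)⁻¹ := by
  have h1 := integral_exp_mul_Ioi (a := -(2 * lam)) (by linarith) 0
  have h2 := integrableOn_exp_mul_Ioi (a := -(2 * lam)) (by linarith) 0
  have h3 : ∀ s : ℝ, ENNReal.ofReal (Real.exp (-lam * s)) ^ 2 =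
      ENNReal.ofReal (Real.exp (-(2 * lam) * s)) := fun s => by
    rw [← ENNReal.ofReal_pow (Real.exp_nonneg _), ← Real.exp_nat_mul]
    congr 2; push_cast; ring
  simp_rw [h3]
  rw [← ofReal_integral_eq_lintegral_ofReal h2 (Eventually.of_forall fun s => Real.exp_nonneg _), h1]
  congr 1
  simp [neg_div_neg_eq]

/-- Square of an `L²`-pairing bounded by Cauchy–Schwarz. -/
theorem lintegral_mul_sq_le {α : Type*} [MeasurableSpace α] (μ : Measure α) {f g : α → ℝ≥0∞}
    (hf : AEMeasurable f μ) (hg : AEMeasurable g μ) :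
    (∫⁻ a, f a * g a ∂μ) ^ 2 ≤ (∫⁻ a, f a ^ 2 ∂μ) * ∫⁻ a, g a ^ 2 ∂μ := by
  have h := ENNReal.lintegral_mul_le_Lp_mul_Lq μ Real.HolderConjugate.two_two hf hg
  calc (∫⁻ a, f a * g a ∂μ) ^ 2 ≤ ((∫⁻ a, f a ^ (2 : ℝ) ∂μ) ^ (1 / (2 : ℝ)) *
        (∫⁻ a, g a ^ (2 : ℝ) ∂μ) ^ (1 / (2 : ℝ))) ^ 2 := pow_le_pow_left' h 2
    _ = _ := by
      rw [mul_pow, ← ENNReal.rpow_natCast, ← ENNReal.rpow_natCast, ← ENNReal.rpow_mul,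
        ← ENNReal.rpow_mul]
      norm_num

theorem aemeasurable_ofReal_exp_mul (lam : ℝ) (μ : Measure ℝ) :
    AEMeasurable (fun s : ℝ => ENNReal.ofReal (Real.exp (-lam * s))) μ := by
  fun_prop

set_option maxHeartbeats 400000 in
/-- Trace estimate in `H^{-1/2}` for a function whose vertical derivative is a horizontal
divergence of `L²` functions. -/
theorem negHalf_slice_le {u v₁ v₂ w : R2 × ℝ → ℂ}
    (hu : ContDiff ℝ ∞ u) (hcu : HasCompactSupport u)
    (h₁ : ContDiff ℝ ∞ v₁) (hc₁ : HasCompactSupport v₁)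
    (h₂ : ContDiff ℝ ∞ v₂) (hc₂ : HasCompactSupport v₂)
    (hw : ContDiff ℝ ∞ w) (hcw : HasCompactSupport w)
    (heq : ∀ q, vderiv u q = fderiv ℝ v₁ q (e2 0, 0) + fderiv ℝ v₂ q (e2 1, 0) + w q) :
    negHalf (slice hu hcu 0) ≤ ENNReal.ofReal (8 * Real.pi ^ 2) *
      ∫⁻ s in Set.Ioi (0 : ℝ), ∫⁻ y, (‖u (y, s)‖ₑ ^ 2 + ‖v₁ (y, s)‖ₑ ^ 2 + ‖v₂ (y, s)‖ₑ ^ 2 +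
        ‖w (y, s)‖ₑ ^ 2) := by
  have hpi3 := Real.pi_gt_three
  have hslice : ∀ s, slice (contDiff_vderiv hu) (hasCompactSupport_vderiv hcu) s =
      ∂_{e2 0} (slice h₁ hc₁ s) + ∂_{e2 1} (slice h₂ hc₂ s) + slice hw hcw s := fun s => by
    ext y
    rw [slice_apply, heq, add_apply, add_apply, lineDeriv_slice,
      lineDeriv_slice, slice_apply]
  have hF : ∀ s ξ, ‖𝓕 (slice (contDiff_vderiv hu) (hasCompactSupport_vderiv hcu) s) ξ‖ ≤
      2 * Real.pi * ‖ξ‖ * (‖𝓕 (slice h₁ hc₁ s) ξ‖ + ‖𝓕 (slice h₂ hc₂ s) ξ‖) +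
        ‖𝓕 (slice hw hcw s) ξ‖ := by
    intro s ξ
    have hpinorm : ‖(2 * Real.pi * Complex.I : ℂ)‖ = 2 * Real.pi := by
      simp [abs_of_pos Real.pi_pos]
    have hc : ∀ (j : Fin 2) (f : 𝓢(R2, ℂ)), ‖𝓕 (∂_{e2 j} f) ξ‖ ≤ 2 * Real.pi * ‖ξ‖ * ‖𝓕 f ξ‖ := by
      intro j f
      rw [fourier_lineDeriv_apply, norm_mul, norm_mul, hpinorm]
      gcongr
      rw [EuclideanSpace.inner_single_right]
      simpa using norm_coord_le ξ j
    rw [hslice, FourierTransform.fourier_add, FourierTransform.fourier_add, add_apply, add_apply, mul_add]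
    exact (norm_add₃_le).trans (add_le_add_left (add_le_add (hc 0 _) (hc 1 _)) _)
  set A : R2 → ℝ → ℝ := fun ξ s => ‖𝓕 (slice hu hcu s) ξ‖ + 2 * Real.pi * ‖𝓕 (slice h₁ hc₁ s) ξ‖ +
    2 * Real.pi * ‖𝓕 (slice h₂ hc₂ s) ξ‖ + ‖𝓕 (slice hw hcw s) ξ‖ with hA
  have mu := measurable_fourier_slice hu hcu
  have m1 := measurable_fourier_slice h₁ hc₁
  have m2 := measurable_fourier_slice h₂ hc₂
  have mw := measurable_fourier_slice hw hcw
  have hAm : Measurable (Function.uncurry A) :=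
    ((mu.norm.add (m1.norm.const_mul _)).add (m2.norm.const_mul _)).add mw.norm
  have hA0 : ∀ ξ s, 0 ≤ A ξ s := fun ξ s => by simp only [hA]; positivity
  have hpt : ∀ ξ, ENNReal.ofReal ((1 + ‖ξ‖)⁻¹ * ‖𝓕 (slice hu hcu 0) ξ‖ ^ 2) ≤
      ∫⁻ s in Set.Ioi (0 : ℝ), ENNReal.ofReal (2⁻¹ * A ξ s ^ 2) := by
    intro ξ
    -- The decay rate matches the frequency. The exponential has squared `L²` norm `1/(2λ)`, and the
    -- factors `λ` and `|ξ|` in the integrand are at most `λ`. With the weight `1/λ` the powers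
    -- cancel, `λ⁻¹ (2λ)⁻¹ λ² = 1/2`, uniformly in `ξ`.
    set lam := 1 + ‖ξ‖ with hlam
    have hl : 0 < lam := by positivity
    have hAm' : Measurable (A ξ) := hAm.of_uncurry_left
    have h1 : ‖𝓕 (slice hu hcu 0) ξ‖ₑ ≤ ∫⁻ s in Set.Ioi (0 : ℝ),
        ENNReal.ofReal (Real.exp (-lam * s)) * ENNReal.ofReal (lam * A ξ s) := by
      rw [fourier_slice_zero hu hcu lam ξ]
      refine (enorm_integral_le_lintegral_enorm _).trans (lintegral_mono fun s => ?_)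
      rw [enorm_mul, ← ofReal_norm, ← ofReal_norm, Complex.norm_real,
        Real.norm_of_nonneg (Real.exp_nonneg _)]
      gcongr
      refine (norm_sub_le _ _).trans ((add_le_add le_rfl (hF s ξ)).trans ?_)
      rw [norm_mul, Complex.norm_real, Real.norm_of_nonneg hl.le]
      simp only [hA, hlam]
      have n1 := norm_nonneg (𝓕 (slice h₁ hc₁ s) ξ)
      have n2 := norm_nonneg (𝓕 (slice h₂ hc₂ s) ξ)
      have n3 := norm_nonneg (𝓕 (slice hw hcw s) ξ)
      have n4 : 0 ≤ ‖ξ‖ * ‖𝓕 (slice hw hcw s) ξ‖ := by positivity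
      have n5 : 0 ≤ Real.pi * ‖𝓕 (slice h₁ hc₁ s) ξ‖ := by positivity
      have n6 : 0 ≤ Real.pi * ‖𝓕 (slice h₂ hc₂ s) ξ‖ := by positivity
      nlinarith
    have h2 : ‖𝓕 (slice hu hcu 0) ξ‖ₑ ^ 2 ≤ ENNReal.ofReal (2 * lam)⁻¹ *
        ∫⁻ s in Set.Ioi (0 : ℝ), ENNReal.ofReal (lam * A ξ s) ^ 2 := by
      refine (pow_le_pow_left' h1 2).trans ?_
      rw [← lintegral_exp_sq hl]
      refine lintegral_mul_sq_le _ ?_ ?_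
      · exact aemeasurable_ofReal_exp_mul lam _
      · exact (hAm'.const_mul lam).ennreal_ofReal.aemeasurable
    rw [ENNReal.ofReal_mul (by positivity), ENNReal.ofReal_pow (norm_nonneg _), ofReal_norm]
    refine (mul_le_mul_right h2 _).trans ?_
    rw [← mul_assoc, ← ENNReal.ofReal_mul (by positivity),
      ← lintegral_const_mul' _ _ ENNReal.ofReal_ne_top]
    refine lintegral_mono fun s => ?_
    have := hA0 ξ s
    rw [← ENNReal.ofReal_pow (by positivity), ← ENNReal.ofReal_mul (by positivity)]
    refine ENNReal.ofReal_le_ofReal (le_of_eq ?_)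
    field_simp
  -- Squaring a sum of four terms costs 4 and the derivatives cost `4π²`, so the constant is `4 ·
  -- 4π² / 2 = 8π²`.
  have hS : ∀ ξ s, ENNReal.ofReal (2⁻¹ * A ξ s ^ 2) ≤ ENNReal.ofReal (8 * Real.pi ^ 2) *
      (‖𝓕 (slice hu hcu s) ξ‖ₑ ^ 2 + ‖𝓕 (slice h₁ hc₁ s) ξ‖ₑ ^ 2 + ‖𝓕 (slice h₂ hc₂ s) ξ‖ₑ ^ 2 +
        ‖𝓕 (slice hw hcw s) ξ‖ₑ ^ 2) := by
    intro ξ s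
    simp only [hA, ← ofReal_norm, ← ENNReal.ofReal_pow (norm_nonneg _)]
    rw [← ENNReal.ofReal_add (by positivity) (by positivity),
      ← ENNReal.ofReal_add (by positivity) (by positivity),
      ← ENNReal.ofReal_add (by positivity) (by positivity), ← ENNReal.ofReal_mul (by positivity)]
    refine ENNReal.ofReal_le_ofReal ?_
    generalize ‖𝓕 (slice hu hcu s) ξ‖ = a
    generalize ‖𝓕 (slice h₁ hc₁ s) ξ‖ = b
    generalize ‖𝓕 (slice h₂ hc₂ s) ξ‖ = c
    generalize ‖𝓕 (slice hw hcw s) ξ‖ = d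
    have hp1 : (1 : ℝ) ≤ 4 * Real.pi ^ 2 := by nlinarith
    have hq : (a + 2 * Real.pi * b + 2 * Real.pi * c + d) ^ 2 ≤
        4 * (a ^ 2 + (2 * Real.pi * b) ^ 2 + (2 * Real.pi * c) ^ 2 + d ^ 2) := by
      generalize 2 * Real.pi * b = b'
      generalize 2 * Real.pi * c = c'
      nlinarith [sq_nonneg (a - b'), sq_nonneg (a - c'), sq_nonneg (a - d), sq_nonneg (b' - c'),
        sq_nonneg (b' - d), sq_nonneg (c' - d)]
    have ha := mul_le_mul_of_nonneg_right hp1 (sq_nonneg a)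
    have hd := mul_le_mul_of_nonneg_right hp1 (sq_nonneg d)
    nlinarith
  have hE : ∀ {f : R2 × ℝ → ℂ} (hf : Measurable f), Measurable fun p => ‖f p‖ₑ ^ 2 :=
    fun hf => hf.enorm.pow_const 2
  calc negHalf (slice hu hcu 0) ≤ ∫⁻ ξ, ∫⁻ s in Set.Ioi (0 : ℝ), ENNReal.ofReal (2⁻¹ * A ξ s ^ 2) :=
        lintegral_mono hpt
    _ = ∫⁻ s in Set.Ioi (0 : ℝ), ∫⁻ ξ, ENNReal.ofReal (2⁻¹ * A ξ s ^ 2) := by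
        refine lintegral_lintegral_swap (Measurable.aemeasurable ?_)
        exact ((hAm.pow_const 2).const_mul _).ennreal_ofReal
    _ ≤ ∫⁻ s in Set.Ioi (0 : ℝ), ENNReal.ofReal (8 * Real.pi ^ 2) * ∫⁻ y, (‖u (y, s)‖ₑ ^ 2 +
        ‖v₁ (y, s)‖ₑ ^ 2 + ‖v₂ (y, s)‖ₑ ^ 2 + ‖w (y, s)‖ₑ ^ 2) := by
        refine lintegral_mono fun s => (lintegral_mono fun ξ => hS ξ s).trans ?_
        have hx : ∀ {f : R2 × ℝ → ℂ}, Measurable f → Measurable fun ξ => ‖f (ξ, s)‖ₑ ^ 2 :=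
          fun hf => (hE hf).comp measurable_prodMk_right
        rw [lintegral_const_mul' _ _ ENNReal.ofReal_ne_top]
        refine le_of_eq ?_
        congr 1
        rw [lintegral_add_right _ (hx mw), lintegral_add_right _ (hx m2),
          lintegral_add_right _ (hx m1)]
        dsimp only
        rw [lintegral_enorm_sq_fourier, lintegral_enorm_sq_fourier,
          lintegral_enorm_sq_fourier, lintegral_enorm_sq_fourier,
          lintegral_add_right _ (hx hw.continuous.measurable),
          lintegral_add_right _ (hx h₂.continuous.measurable),
          lintegral_add_right _ (hx h₁.continuous.measurable)]
        rfl
    _ = _ := lintegral_const_mul' _ _ ENNReal.ofReal_ne_top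

open scoped FourierTransform SchwartzMap LineDeriv

/-! ### Graph coordinates -/

theorem two_le_infty : (2 : WithTop ℕ∞) ≤ ((⊤ : ℕ∞) : WithTop ℕ∞) :=
  WithTop.coe_le_coe.mpr (le_top : (2 : ℕ∞) ≤ ⊤)

/-- The parametrization `(y, s) ↦ (y, g(y) + σ s)` of a neighbourhood of a graph. -/
def chartMap (k : Fin 3) (σ : ℝ) (g : R2 → ℝ) (q : R2 × ℝ) : R3 := axisLift k (q.1, g q.1 + σ * q.2)

theorem contDiff_chartMap {k : Fin 3} {σ : ℝ} {g : R2 → ℝ} (hg : ContDiff ℝ ∞ g) :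
    ContDiff ℝ ∞ (chartMap k σ g) :=
  (axisLift k).contDiff.comp (contDiff_fst.prodMk
    ((hg.comp contDiff_fst).add (contDiff_const.mul contDiff_snd)))

theorem hasCompactSupport_comp_chartMap {k : Fin 3} {σ : ℝ} (hσ : σ = 1 ∨ σ = -1) {g : R2 → ℝ}
    (hg : Continuous g) {F : Type*} [Zero F] {f : R3 → F} (hf : HasCompactSupport f) :
    HasCompactSupport fun q => f (chartMap k σ g q) := by
  have hc : Continuous fun x : R3 => (planeProj k x, σ * (x k - g (planeProj k x))) := by fun_prop
  refine HasCompactSupport.intro (hf.image hc) fun q hq => ?_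
  by_contra h
  refine hq ⟨chartMap k σ g q, subset_tsupport _ h, ?_⟩
  refine Prod.ext (by simp [chartMap]) ?_
  rcases hσ with rfl | rfl <;> simp [chartMap]

/-- The `j`-th partial derivative of the graph function, as a complex function of `(y, s)`. -/
def graphSlope (g : R2 → ℝ) (j : Fin 2) (q : R2 × ℝ) : ℂ := (fderiv ℝ g q.1 (e2 j) : ℝ)

theorem contDiff_graphSlope {g : R2 → ℝ} (hg : ContDiff ℝ ∞ g) (j : Fin 2) : ContDiff ℝ ∞ (graphSlope g j) :=
  Complex.ofRealCLM.contDiff.comp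
    (((hg.fderiv_right (m := ∞) (by simp)).clm_apply contDiff_const).comp contDiff_fst)

theorem fderiv_graphSlope {g : R2 → ℝ} (hg : ContDiff ℝ ∞ g) (j : Fin 2) (q v : R2 × ℝ) :
    fderiv ℝ (graphSlope g j) q v = ((fderiv ℝ (fderiv ℝ g) q.1 v.1 (e2 j) : ℝ) : ℂ) := by
  have h1 : HasFDerivAt (fderiv ℝ g) (fderiv ℝ (fderiv ℝ g) q.1) q.1 :=
    ((hg.fderiv_right (m := ∞) (by simp)).differentiable (by simp) _).hasFDerivAt
  have h2 := (h1.comp q (hasFDerivAt_fst (p := q))).clm_apply (hasFDerivAt_const (e2 j) q)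
  have h3 := Complex.ofRealCLM.hasFDerivAt.comp q h2
  have h4 : graphSlope g j = ⇑Complex.ofRealCLM ∘ fun y : R2 × ℝ => (fderiv ℝ g ∘ Prod.fst) y (e2 j) := rfl
  rw [h4, h3.fderiv]
  simp

theorem fderiv_graphSlope_vertical {g : R2 → ℝ} (hg : ContDiff ℝ ∞ g) (j : Fin 2) (q : R2 × ℝ) :
    fderiv ℝ (graphSlope g j) q (0, 1) = 0 := by
  rw [fderiv_graphSlope hg]; simp

theorem fderiv_graphSlope_comm {g : R2 → ℝ} (hg : ContDiff ℝ ∞ g) (q : R2 × ℝ) :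
    fderiv ℝ (graphSlope g 0) q (e2 1, 0) = fderiv ℝ (graphSlope g 1) q (e2 0, 0) := by
  rw [fderiv_graphSlope hg, fderiv_graphSlope hg]
  have := hg.contDiffAt.isSymmSndFDerivAt (x := q.1) (by simpa using two_le_infty)
  rw [this (e2 1) (e2 0)]

theorem fderiv_comp_chartMap {k : Fin 3} {σ : ℝ} {g : R2 → ℝ} (hg : ContDiff ℝ ∞ g) {Φ : R3 → C3}
    (hΦ : ContDiff ℝ ∞ Φ) (i : Fin 3) (q v : R2 × ℝ) :
    fderiv ℝ (fun q => Φ (chartMap k σ g q) i) q v =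
      (fderiv ℝ Φ (chartMap k σ g q) (axisLift k (v.1, fderiv ℝ g q.1 v.1 + σ * v.2))) i := by
  have hg1 : HasFDerivAt g (fderiv ℝ g q.1) q.1 := (hg.differentiable (by simp) _).hasFDerivAt
  have h1 : HasFDerivAt (fun q : R2 × ℝ => (q.1, g q.1 + σ * q.2))
      ((ContinuousLinearMap.fst ℝ R2 ℝ).prod ((fderiv ℝ g q.1).comp (ContinuousLinearMap.fst ℝ R2 ℝ) +
        σ • ContinuousLinearMap.snd ℝ R2 ℝ)) q :=
    hasFDerivAt_fst.prodMk ((hg1.comp q hasFDerivAt_fst).add (hasFDerivAt_snd.const_mul σ))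
  have h2 : HasFDerivAt (chartMap k σ g) _ q := (axisLift k).hasFDerivAt.comp q h1
  have h3 : HasFDerivAt Φ (fderiv ℝ Φ (chartMap k σ g q)) (chartMap k σ g q) :=
    (hΦ.differentiable (by simp) _).hasFDerivAt
  have h4 := ((EuclideanSpace.proj i : C3 →L[ℂ] ℂ).restrictScalars ℝ).hasFDerivAt.comp q (h3.comp q h2)
  have h5 := congrArg (fun T => T v) h4.fderiv
  refine Eq.trans ?_ (h5.trans ?_)
  · rfl
  · simp

theorem axisLift_eq (k : Fin 3) (y : R2) (t : ℝ) : axisLift k (y, t) =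
    t • EuclideanSpace.single k (1 : ℝ) + y 0 • EuclideanSpace.single (k + 1) (1 : ℝ) +
      y 1 • EuclideanSpace.single (k + 2) (1 : ℝ) := by
  have : (axisLift k (y, t)).ofLp = (t • EuclideanSpace.single k (1 : ℝ) +
      y 0 • EuclideanSpace.single (k + 1) (1 : ℝ) + y 1 • EuclideanSpace.single (k + 2) (1 : ℝ)).ofLp := by
    refine ext_cyclic k ?_ ?_ ?_ <;> fin_cases k <;> simp [axisLift]
  exact PiLp.ext (congrFun this)

theorem fderiv_comp_chartMap_vertical {k : Fin 3} {σ : ℝ} {g : R2 → ℝ} (hg : ContDiff ℝ ∞ g)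
    {Φ : R3 → C3} (hΦ : ContDiff ℝ ∞ Φ) (i : Fin 3) (q : R2 × ℝ) :
    fderiv ℝ (fun q => Φ (chartMap k σ g q) i) q (0, 1) =
      σ * partialDeriv k Φ (chartMap k σ g q) i := by
  rw [fderiv_comp_chartMap hg hΦ, axisLift_eq]
  simp [partialDeriv]

theorem fderiv_comp_chartMap_zero {k : Fin 3} {σ : ℝ} {g : R2 → ℝ} (hg : ContDiff ℝ ∞ g)
    {Φ : R3 → C3} (hΦ : ContDiff ℝ ∞ Φ) (i : Fin 3) (q : R2 × ℝ) :
    fderiv ℝ (fun q => Φ (chartMap k σ g q) i) q (e2 0, 0) =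
      partialDeriv (k + 1) Φ (chartMap k σ g q) i +
        graphSlope g 0 q * partialDeriv k Φ (chartMap k σ g q) i := by
  rw [fderiv_comp_chartMap hg hΦ, axisLift_eq]
  simp [partialDeriv, graphSlope]
  ring

theorem fderiv_comp_chartMap_one {k : Fin 3} {σ : ℝ} {g : R2 → ℝ} (hg : ContDiff ℝ ∞ g)
    {Φ : R3 → C3} (hΦ : ContDiff ℝ ∞ Φ) (i : Fin 3) (q : R2 × ℝ) :
    fderiv ℝ (fun q => Φ (chartMap k σ g q) i) q (e2 1, 0) =
      partialDeriv (k + 2) Φ (chartMap k σ g q) i +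
        graphSlope g 1 q * partialDeriv k Φ (chartMap k σ g q) i := by
  rw [fderiv_comp_chartMap hg hΦ, axisLift_eq]
  simp [partialDeriv, graphSlope]
  ring

/-- The first horizontal component of the covariant pullback of a field under `chartMap`. -/
def pullZero (k : Fin 3) (σ : ℝ) (g : R2 → ℝ) (Φ : R3 → C3) (q : R2 × ℝ) : ℂ :=
  Φ (chartMap k σ g q) (k + 1) + graphSlope g 0 q * Φ (chartMap k σ g q) k

/-- The second horizontal component of the covariant pullback of a field under `chartMap`. -/
def pullOne (k : Fin 3) (σ : ℝ) (g : R2 → ℝ) (Φ : R3 → C3) (q : R2 × ℝ) : ℂ :=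
  Φ (chartMap k σ g q) (k + 2) + graphSlope g 1 q * Φ (chartMap k σ g q) k

/-- The `i`-th component of a field in graph coordinates, multiplied by the constant `c`. -/
def pullComp (k : Fin 3) (σ : ℝ) (g : R2 → ℝ) (Φ : R3 → C3) (c : ℂ) (i : Fin 3) (q : R2 × ℝ) : ℂ :=
  c * Φ (chartMap k σ g q) i

/-- The flux of a field through the graph, in graph coordinates. -/
def pullFlux (k : Fin 3) (σ : ℝ) (g : R2 → ℝ) (Φ : R3 → C3) (q : R2 × ℝ) : ℂ :=
  Φ (chartMap k σ g q) k - graphSlope g 0 q * Φ (chartMap k σ g q) (k + 1) -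
    graphSlope g 1 q * Φ (chartMap k σ g q) (k + 2)

theorem contDiff_comp_chartMap {k : Fin 3} {σ : ℝ} {g : R2 → ℝ} (hg : ContDiff ℝ ∞ g)
    {Φ : R3 → C3} (hΦ : ContDiff ℝ ∞ Φ) (i : Fin 3) :
    ContDiff ℝ ∞ fun q => Φ (chartMap k σ g q) i :=
  (contDiff_coord hΦ i).comp (contDiff_chartMap hg)

theorem contDiff_pullZero {k : Fin 3} {σ : ℝ} {g : R2 → ℝ} (hg : ContDiff ℝ ∞ g)
    {Φ : R3 → C3} (hΦ : ContDiff ℝ ∞ Φ) : ContDiff ℝ ∞ (pullZero k σ g Φ) :=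
  (contDiff_comp_chartMap hg hΦ _).add
    ((contDiff_graphSlope hg 0).mul (contDiff_comp_chartMap hg hΦ _))

theorem contDiff_pullOne {k : Fin 3} {σ : ℝ} {g : R2 → ℝ} (hg : ContDiff ℝ ∞ g)
    {Φ : R3 → C3} (hΦ : ContDiff ℝ ∞ Φ) : ContDiff ℝ ∞ (pullOne k σ g Φ) :=
  (contDiff_comp_chartMap hg hΦ _).add
    ((contDiff_graphSlope hg 1).mul (contDiff_comp_chartMap hg hΦ _))

theorem contDiff_pullComp {k : Fin 3} {σ : ℝ} {g : R2 → ℝ} (hg : ContDiff ℝ ∞ g)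
    {Φ : R3 → C3} (hΦ : ContDiff ℝ ∞ Φ) (c : ℂ) (i : Fin 3) :
    ContDiff ℝ ∞ (pullComp k σ g Φ c i) :=
  contDiff_const.mul (contDiff_comp_chartMap hg hΦ _)

theorem contDiff_pullFlux {k : Fin 3} {σ : ℝ} {g : R2 → ℝ} (hg : ContDiff ℝ ∞ g)
    {Φ : R3 → C3} (hΦ : ContDiff ℝ ∞ Φ) : ContDiff ℝ ∞ (pullFlux k σ g Φ) :=
  ((contDiff_comp_chartMap hg hΦ _).sub
    ((contDiff_graphSlope hg 0).mul (contDiff_comp_chartMap hg hΦ _))).sub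
    ((contDiff_graphSlope hg 1).mul (contDiff_comp_chartMap hg hΦ _))

theorem fderiv_graphSlope_mul {g : R2 → ℝ} (hg : ContDiff ℝ ∞ g) {A : R2 × ℝ → ℂ}
    (hA : ContDiff ℝ ∞ A) (j : Fin 2) (q v : R2 × ℝ) :
    fderiv ℝ (fun q => graphSlope g j q * A q) q v =
      graphSlope g j q * fderiv ℝ A q v + fderiv ℝ (graphSlope g j) q v * A q := by
  have h1 := ((contDiff_graphSlope hg j).differentiable (by simp) q).hasFDerivAt
  have h2 := (hA.differentiable (by simp) q).hasFDerivAt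
  refine (congrArg (fun T : R2 × ℝ →L[ℝ] ℂ => T v) (h1.mul h2).fderiv).trans ?_
  simp [mul_comm]

theorem fderiv_pullComp {k : Fin 3} {σ : ℝ} {g : R2 → ℝ} (hg : ContDiff ℝ ∞ g)
    {Φ : R3 → C3} (hΦ : ContDiff ℝ ∞ Φ) (c : ℂ) (i : Fin 3) (q v : R2 × ℝ) :
    fderiv ℝ (pullComp k σ g Φ c i) q v = c * fderiv ℝ (fun q => Φ (chartMap k σ g q) i) q v := by
  have h2 := ((contDiff_comp_chartMap (k := k) (σ := σ) hg hΦ i).differentiable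
    (by simp) q).hasFDerivAt
  have := (h2.const_mul c).fderiv
  exact congrArg (fun T => T v) this

theorem fderiv_pullZero {k : Fin 3} {σ : ℝ} {g : R2 → ℝ} (hg : ContDiff ℝ ∞ g)
    {Φ : R3 → C3} (hΦ : ContDiff ℝ ∞ Φ) (q v : R2 × ℝ) :
    fderiv ℝ (pullZero k σ g Φ) q v = fderiv ℝ (fun q => Φ (chartMap k σ g q) (k + 1)) q v +
      (graphSlope g 0 q * fderiv ℝ (fun q => Φ (chartMap k σ g q) k) q v +
        fderiv ℝ (graphSlope g 0) q v * Φ (chartMap k σ g q) k) := by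
  have hA := fun i => contDiff_comp_chartMap (k := k) (σ := σ) hg hΦ i
  rw [← fderiv_graphSlope_mul hg (hA k)]
  exact congrArg (fun T : R2 × ℝ →L[ℝ] ℂ => T v) (fderiv_fun_add ((hA _).differentiable (by simp) q)
    (((contDiff_graphSlope hg 0).mul (hA k)).differentiable (by simp) q))

theorem fderiv_pullOne {k : Fin 3} {σ : ℝ} {g : R2 → ℝ} (hg : ContDiff ℝ ∞ g)
    {Φ : R3 → C3} (hΦ : ContDiff ℝ ∞ Φ) (q v : R2 × ℝ) :
    fderiv ℝ (pullOne k σ g Φ) q v = fderiv ℝ (fun q => Φ (chartMap k σ g q) (k + 2)) q v +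
      (graphSlope g 1 q * fderiv ℝ (fun q => Φ (chartMap k σ g q) k) q v +
        fderiv ℝ (graphSlope g 1) q v * Φ (chartMap k σ g q) k) := by
  have hA := fun i => contDiff_comp_chartMap (k := k) (σ := σ) hg hΦ i
  rw [← fderiv_graphSlope_mul hg (hA k)]
  exact congrArg (fun T : R2 × ℝ →L[ℝ] ℂ => T v) (fderiv_fun_add ((hA _).differentiable (by simp) q)
    (((contDiff_graphSlope hg 1).mul (hA k)).differentiable (by simp) q))

theorem fderiv_pullFlux {k : Fin 3} {σ : ℝ} {g : R2 → ℝ} (hg : ContDiff ℝ ∞ g)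
    {Φ : R3 → C3} (hΦ : ContDiff ℝ ∞ Φ) (q v : R2 × ℝ) :
    fderiv ℝ (pullFlux k σ g Φ) q v = fderiv ℝ (fun q => Φ (chartMap k σ g q) k) q v -
      (graphSlope g 0 q * fderiv ℝ (fun q => Φ (chartMap k σ g q) (k + 1)) q v +
        fderiv ℝ (graphSlope g 0) q v * Φ (chartMap k σ g q) (k + 1)) -
      (graphSlope g 1 q * fderiv ℝ (fun q => Φ (chartMap k σ g q) (k + 2)) q v +
        fderiv ℝ (graphSlope g 1) q v * Φ (chartMap k σ g q) (k + 2)) := by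
  have hA := fun i => contDiff_comp_chartMap (k := k) (σ := σ) hg hΦ i
  have d0 := ((contDiff_graphSlope hg 0).mul (hA (k + 1))).differentiable (by simp) q
  have d1 := ((contDiff_graphSlope hg 1).mul (hA (k + 2))).differentiable (by simp) q
  have dk := (hA k).differentiable (by simp) q
  rw [← fderiv_graphSlope_mul hg (hA _), ← fderiv_graphSlope_mul hg (hA _)]
  refine (congrArg (fun T => T v) (fderiv_fun_sub (dk.sub d0) d1)).trans ?_
  exact congrArg (fun T : R2 × ℝ →L[ℝ] ℂ => T v - _) (fderiv_fun_sub dk d0)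

theorem curl_apply_add_one (Φ : R3 → C3) (x : R3) (k : Fin 3) : classicalCurl Φ x (k + 1) =
    partialDeriv (k + 2) Φ x k - partialDeriv k Φ x (k + 2) := by
  fin_cases k <;> rfl

theorem curl_apply_add_two (Φ : R3 → C3) (x : R3) (k : Fin 3) : classicalCurl Φ x (k + 2) =
    partialDeriv k Φ x (k + 1) - partialDeriv (k + 1) Φ x k := by
  fin_cases k <;> rfl

/-- The covariant pullback commutes with the curl: the vertical derivative of a horizontal component
differs from the horizontal derivative of the vertical component by a component of `curl Φ`. This is
the form of equation that `negHalf_slice_le` requires. -/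
theorem vderiv_pullZero {k : Fin 3} {σ : ℝ} {g : R2 → ℝ} (hg : ContDiff ℝ ∞ g)
    {Φ : R3 → C3} (hΦ : ContDiff ℝ ∞ Φ) (q : R2 × ℝ) : vderiv (pullZero k σ g Φ) q =
      fderiv ℝ (pullComp k σ g Φ σ k) q (e2 0, 0) +
        pullComp k σ g (classicalCurl Φ) σ (k + 2) q := by
  rw [vderiv, fderiv_pullZero hg hΦ, fderiv_pullComp hg hΦ, fderiv_comp_chartMap_vertical hg hΦ,
    fderiv_comp_chartMap_vertical hg hΦ, fderiv_comp_chartMap_zero hg hΦ,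
    fderiv_graphSlope_vertical hg, pullComp, curl_apply_add_two]
  ring

theorem vderiv_pullOne {k : Fin 3} {σ : ℝ} {g : R2 → ℝ} (hg : ContDiff ℝ ∞ g)
    {Φ : R3 → C3} (hΦ : ContDiff ℝ ∞ Φ) (q : R2 × ℝ) : vderiv (pullOne k σ g Φ) q =
      fderiv ℝ (pullComp k σ g Φ σ k) q (e2 1, 0) +
        pullComp k σ g (classicalCurl Φ) (-σ) (k + 1) q := by
  rw [vderiv, fderiv_pullOne hg hΦ, fderiv_pullComp hg hΦ, fderiv_comp_chartMap_vertical hg hΦ,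
    fderiv_comp_chartMap_vertical hg hΦ, fderiv_comp_chartMap_one hg hΦ,
    fderiv_graphSlope_vertical hg, pullComp, curl_apply_add_one]
  ring

/-- The terms with second derivatives of `g` cancel by symmetry, so the planar rotation of the
tangential components involves `Φ` only through the flux of `curl Φ` through the graph. -/
theorem rot_pull {k : Fin 3} {σ : ℝ} {g : R2 → ℝ} (hg : ContDiff ℝ ∞ g)
    {Φ : R3 → C3} (hΦ : ContDiff ℝ ∞ Φ) (q : R2 × ℝ) :
    fderiv ℝ (pullOne k σ g Φ) q (e2 0, 0) - fderiv ℝ (pullZero k σ g Φ) q (e2 1, 0) =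
      pullFlux k σ g (classicalCurl Φ) q := by
  rw [fderiv_pullOne hg hΦ, fderiv_pullZero hg hΦ, fderiv_comp_chartMap_zero hg hΦ,
    fderiv_comp_chartMap_zero hg hΦ, fderiv_comp_chartMap_one hg hΦ, fderiv_comp_chartMap_one hg hΦ,
    fderiv_graphSlope_comm hg, pullFlux, curl_apply_add_two, curl_apply_add_one, classicalCurl_apply]
  ring

theorem partialDeriv_comm {Φ : R3 → C3} (hΦ : ContDiff ℝ ∞ Φ) (i j : Fin 3) (x : R3) :
    partialDeriv i (partialDeriv j Φ) x = partialDeriv j (partialDeriv i Φ) x := by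
  have h1 : HasFDerivAt (fderiv ℝ Φ) (fderiv ℝ (fderiv ℝ Φ) x) x :=
    ((hΦ.fderiv_right (m := ∞) (by simp)).differentiable (by simp) _).hasFDerivAt
  have h2 : ∀ i j, partialDeriv i (partialDeriv j Φ) x = fderiv ℝ (fderiv ℝ Φ) x
      (EuclideanSpace.single i 1) (EuclideanSpace.single j 1) := fun i j => by
    have := (h1.clm_apply (hasFDerivAt_const (EuclideanSpace.single j (1 : ℝ)) x)).fderiv
    refine (congrArg (fun T => T (EuclideanSpace.single i 1)) this).trans ?_
    simp
  rw [h2, h2]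
  exact hΦ.contDiffAt.isSymmSndFDerivAt
    (by simpa using two_le_infty) _ _

theorem div_curl_eq_zero {Φ : R3 → C3} (hΦ : ContDiff ℝ ∞ Φ) (k : Fin 3) (x : R3) :
    partialDeriv k (classicalCurl Φ) x k + partialDeriv (k + 1) (classicalCurl Φ) x (k + 1) +
      partialDeriv (k + 2) (classicalCurl Φ) x (k + 2) = 0 := by
  have hd : ∀ i j, DifferentiableAt ℝ (fun y => partialDeriv i Φ y j) x := fun i j =>
    (contDiff_coord (contDiff_partialDeriv hΦ i) j).differentiable (by simp) x
  have hs : ∀ i m a b c d, (∀ y, classicalCurl Φ y m = partialDeriv a Φ y b - partialDeriv c Φ y d) →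
      partialDeriv i (classicalCurl Φ) x m = partialDeriv i (partialDeriv a Φ) x b -
        partialDeriv i (partialDeriv c Φ) x d := by
    intro i m a b c d h
    rw [partialDeriv_coord ((contDiff_classicalCurl hΦ).differentiable (by simp) x), funext h,
      partialDeriv_coord ((contDiff_partialDeriv hΦ a).differentiable (by simp) x),
      partialDeriv_coord ((contDiff_partialDeriv hΦ c).differentiable (by simp) x)]
    exact congrArg (fun T => T (EuclideanSpace.single i 1)) (fderiv_fun_sub (hd a b) (hd c d))
  rw [hs _ _ _ _ _ _ fun y => classicalCurl_apply Φ y k,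
    hs _ _ _ _ _ _ fun y => curl_apply_add_one Φ y k,
    hs _ _ _ _ _ _ fun y => curl_apply_add_two Φ y k,
    partialDeriv_comm hΦ k (k + 1), partialDeriv_comm hΦ k (k + 2),
    partialDeriv_comm hΦ (k + 1) (k + 2)]
  ring

/-- Since `curl Φ` is divergence free, its flux changes vertically only by a horizontal divergence.
Thus the flux also has a trace in `H^{-1/2}` controlled by the `L²` norm of `curl Φ` alone. -/
theorem vderiv_pullFlux {k : Fin 3} {σ : ℝ} {g : R2 → ℝ} (hg : ContDiff ℝ ∞ g)
    {Φ : R3 → C3} (hΦ : ContDiff ℝ ∞ Φ) (q : R2 × ℝ) : vderiv (pullFlux k σ g (classicalCurl Φ)) q =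
      fderiv ℝ (pullComp k σ g (classicalCurl Φ) (-σ) (k + 1)) q (e2 0, 0) +
      fderiv ℝ (pullComp k σ g (classicalCurl Φ) (-σ) (k + 2)) q (e2 1, 0) := by
  have hc := contDiff_classicalCurl hΦ
  rw [vderiv, fderiv_pullFlux hg hc, fderiv_pullComp hg hc, fderiv_pullComp hg hc,
    fderiv_comp_chartMap_vertical hg hc, fderiv_comp_chartMap_vertical hg hc,
    fderiv_comp_chartMap_vertical hg hc, fderiv_comp_chartMap_zero hg hc,
    fderiv_comp_chartMap_one hg hc, fderiv_graphSlope_vertical hg, fderiv_graphSlope_vertical hg]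
  linear_combination σ * div_curl_eq_zero hΦ k (chartMap k σ g q)

/-! ### Integration in graph coordinates and the local decomposition -/

open scoped FourierTransform SchwartzMap LineDeriv

/-- The linear coordinates `(planeProj k, k-th coordinate)`. -/
def axisEquiv (k : Fin 3) : (R2 × ℝ) ≃L[ℝ] R3 :=
  ContinuousLinearEquiv.equivOfInverse (axisLift k)
    ((planeProj k).prod (EuclideanSpace.proj k : R3 →L[ℝ] ℝ))
    (fun p => Prod.ext (planeProj_axisLift k p) (axisLift_self k p))
    (fun x => axisLift_planeProj k x)

/-- The image of Lebesgue measure under a linear isomorphism is a Haar measure, hence a multiple of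
Lebesgue measure. Only finiteness of the factor matters. -/
theorem exists_lintegral_axisLift (k : Fin 3) : ∃ c : ℝ≥0∞, c ≠ ⊤ ∧ ∀ f : R3 → ℝ≥0∞, Measurable f →
    ∫⁻ y : R2, ∫⁻ t : ℝ, f (axisLift k (y, t)) = c * ∫⁻ x, f x := by
  have hvol : (volume : Measure (R2 × ℝ)).IsAddHaarMeasure := by
    rw [Measure.volume_eq_prod]; infer_instance
  have hH : (Measure.map (axisEquiv k) (volume : Measure (R2 × ℝ))).IsAddHaarMeasure :=
    (axisEquiv k).isAddHaarMeasure_map _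
  refine ⟨(Measure.addHaarScalarFactor (Measure.map (axisEquiv k) volume) volume : NNReal),
    ENNReal.coe_ne_top, fun f hf => ?_⟩
  have h1 := Measure.isAddLeftInvariant_eq_smul (Measure.map (axisEquiv k) (volume : Measure (R2 × ℝ)))
    (volume : Measure R3)
  have h2 : ∫⁻ x, f x ∂(Measure.map (axisEquiv k) (volume : Measure (R2 × ℝ))) =
      ∫⁻ p : R2 × ℝ, f (axisLift k p) := lintegral_map hf (axisLift k).continuous.measurable
  have h3 : ∫⁻ p : R2 × ℝ, f (axisLift k p) = ∫⁻ y : R2, ∫⁻ t : ℝ, f (axisLift k (y, t)) := by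
    rw [Measure.volume_eq_prod]
    exact lintegral_prod _ (hf.comp (axisLift k).continuous.measurable).aemeasurable
  rw [← h3, ← h2]
  refine (congrArg (fun μ => ∫⁻ x, f x ∂μ) h1).trans ?_
  rw [lintegral_smul_measure]
  rfl

theorem lintegral_affine_sign {σ : ℝ} (hσ : σ = 1 ∨ σ = -1) (a : ℝ) (f : ℝ → ℝ≥0∞) :
    ∫⁻ s, f (a + σ * s) = ∫⁻ t, f t := by
  rcases hσ with rfl | rfl
  · simpa using lintegral_add_left_eq_self f a
  · simpa [sub_eq_add_neg] using lintegral_sub_left_eq_self f a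

/-- `chartMap` is a shear with a possible reflection composed with a linear isomorphism. The
half-space `s > 0` goes to the side `σ` of the graph, which inside `V` is `Ω`. -/
theorem IsGraphChart.exists_lintegral_chartMap_le {Ω : Set R3} {k : Fin 3} {σ : ℝ} {g : R2 → ℝ}
    {V : Set R3} (h : IsGraphChart Ω k σ g V) (hΩ : IsOpen Ω) : ∃ c : ℝ≥0∞, c ≠ ⊤ ∧
    ∀ H : R3 → ℝ≥0∞, Measurable H → (∀ x ∉ V, H x = 0) →
      ∫⁻ s in Set.Ioi (0 : ℝ), ∫⁻ y, H (chartMap k σ g (y, s)) ≤ c * ∫⁻ x in Ω, H x := by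
  obtain ⟨c, hc, hcf⟩ := exists_lintegral_axisLift k
  refine ⟨c, hc, fun H hH hV => ?_⟩
  have hgc := h.smooth.continuous
  have hσσ : σ * σ = 1 := by rcases h.sign with rfl | rfl <;> norm_num
  set S : Set R3 := {x | 0 < σ * (x k - g (planeProj k x))} with hS
  have hSm : MeasurableSet S := by
    have : Continuous fun x : R3 => σ * (x k - g (planeProj k x)) := by fun_prop
    exact measurableSet_lt measurable_const this.measurable
  have hf : Measurable (S.indicator H) := hH.indicator hSm
  have hFm : Measurable (chartMap k σ g) := (contDiff_chartMap h.smooth).continuous.measurable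
  calc ∫⁻ s in Set.Ioi (0 : ℝ), ∫⁻ y, H (chartMap k σ g (y, s))
      = ∫⁻ s : ℝ, ∫⁻ y, S.indicator H (chartMap k σ g (y, s)) := by
        rw [← lintegral_indicator measurableSet_Ioi]
        refine lintegral_congr fun s => ?_
        have hiff : ∀ y, chartMap k σ g (y, s) ∈ S ↔ 0 < s := fun y => by
          simp only [hS]
          show 0 < σ * (chartMap k σ g (y, s) k - g (planeProj k (chartMap k σ g (y, s)))) ↔ 0 < s
          simp [chartMap, ← mul_assoc, hσσ]
        by_cases hs : s ∈ Set.Ioi (0 : ℝ)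
        · rw [Set.indicator_of_mem hs]
          refine lintegral_congr fun y => ?_
          rw [Set.indicator_of_mem ((hiff y).mpr hs)]
        · rw [Set.indicator_of_notMem hs]
          refine ((lintegral_congr fun y => ?_).trans lintegral_zero).symm
          exact Set.indicator_of_notMem (fun hy => hs ((hiff y).mp hy)) _
    _ = ∫⁻ y : R2, ∫⁻ s : ℝ, S.indicator H (chartMap k σ g (y, s)) :=
        lintegral_lintegral_swap (hf.comp (hFm.comp measurable_swap)).aemeasurable
    _ = ∫⁻ y : R2, ∫⁻ t : ℝ, S.indicator H (axisLift k (y, t)) :=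
        lintegral_congr fun y =>
          lintegral_affine_sign h.sign (g y) fun t => S.indicator H (axisLift k (y, t))
    _ = c * ∫⁻ x, S.indicator H x := hcf _ hf
    _ ≤ _ := by
        rw [← lintegral_indicator hΩ.measurableSet]
        refine mul_le_mul_right (lintegral_mono fun x => ?_) c
        by_cases hxV : x ∈ V
        · by_cases hx : x ∈ Ω
          · rw [Set.indicator_of_mem hx]
            exact Set.indicator_le_self _ _ _
          · have : x ∉ S := fun hxS => hx ((h.mem_iff x hxV).mpr hxS)
            simp [this]
        · exact (Set.indicator_le_self _ _ _).trans (by simp [hV x hxV])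

/-- The squared `H^{1/2}` norm on the plane. -/
def planeNorm (q : R2 → ℂ) : ℝ≥0∞ := (∫⁻ y, ‖q y‖ₑ ^ 2) + gagliardo q

theorem hasCompactSupport_classicalCurl {Φ : R3 → C3} (h : HasCompactSupport Φ) :
    HasCompactSupport (classicalCurl Φ) :=
  h.mono' ((subset_tsupport _).trans (tsupport_classicalCurl_subset Φ))

theorem exists_norm_graphSlope_le {g : R2 → ℝ} (hg : ContDiff ℝ ∞ g) (hc : HasCompactSupport g) :
    ∃ M : ℝ, 0 ≤ M ∧ ∀ j q, ‖graphSlope g j q‖ ≤ M := by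
  obtain ⟨L, hL⟩ := hg.lipschitzWith_of_hasCompactSupport hc (by simp)
  refine ⟨L, L.2, fun j q => ?_⟩
  rw [graphSlope, Complex.norm_real]
  refine (ContinuousLinearMap.le_opNorm _ _).trans ?_
  simpa using norm_fderiv_le_of_lipschitz ℝ hL

theorem enorm_sq_le_of_norm_le {B : ℝ} {z : ℂ} {a b : C3} (hz : ‖z‖ ≤ B * (‖a‖ + ‖b‖)) :
    ‖z‖ₑ ^ 2 ≤ ENNReal.ofReal (2 * B ^ 2) * (‖a‖ₑ ^ 2 + ‖b‖ₑ ^ 2) := by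
  simp only [← ofReal_norm, ← ENNReal.ofReal_pow (norm_nonneg _)]
  rw [← ENNReal.ofReal_add (by positivity) (by positivity), ← ENNReal.ofReal_mul (by positivity)]
  refine ENNReal.ofReal_le_ofReal ((pow_le_pow_left₀ (norm_nonneg _) hz 2).trans ?_)
  rw [mul_pow]
  nlinarith [mul_nonneg (sq_nonneg B) (sq_nonneg (‖a‖ - ‖b‖))]

/-- The tangential components of a field on a piece of the boundary decompose into a gradient and a
field in `H^{1/2}`, with norms controlled by the energy of the field in `Ω`. -/
theorem IsGraphChart.exists_decomposition {Ω : Set R3} {k : Fin 3} {σ : ℝ} {g : R2 → ℝ}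
    {V : Set R3} (h : IsGraphChart Ω k σ g V) (hΩ : IsOpen Ω) : ∃ C : ℝ≥0∞, C ≠ ⊤ ∧
    ∀ Φ : R3 → C3, ContDiff ℝ ∞ Φ → HasCompactSupport Φ → tsupport Φ ⊆ V →
      ∃ p ψ₀ ψ₁ : 𝓢(R2, ℂ),
        (∀ y, pullZero k σ g Φ (y, 0) = ψ₀ y + fderiv ℝ p y (e2 0)) ∧
        (∀ y, pullOne k σ g Φ (y, 0) = ψ₁ y + fderiv ℝ p y (e2 1)) ∧
        ∀ q ∈ ({p, ψ₀, ψ₁} : Set 𝓢(R2, ℂ)), planeNorm q ≤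
          C * ∫⁻ x in Ω, (‖Φ x‖ₑ ^ 2 + ‖classicalCurl Φ x‖ₑ ^ 2) := by
  obtain ⟨c, hc, hcH⟩ := h.exists_lintegral_chartMap_le hΩ
  obtain ⟨M, hM0, hM⟩ := exists_norm_graphSlope_le h.smooth h.compact
  have hg := h.smooth
  have hgc := hg.continuous
  have hσ := h.sign
  -- Every pulled-back component is a combination of at most three coordinates, one with coefficient
  -- of modulus 1 and the others with slopes bounded by `M`.
  set B : ℝ := 1 + 2 * M with hB
  set D : ℝ≥0∞ := ENNReal.ofReal (8 * Real.pi ^ 2) * (4 * ENNReal.ofReal (2 * B ^ 2) * c) with hD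
  set S : ℝ≥0∞ := 1 + ENNReal.ofReal (4 * Real.pi ^ 2) * slobMass with hSdef
  have hSt : S ≠ ⊤ := ENNReal.add_ne_top.mpr ⟨by simp,
    ENNReal.mul_ne_top ENNReal.ofReal_ne_top slobMass_lt_top.ne⟩
  have hDt : D ≠ ⊤ := ENNReal.mul_ne_top ENNReal.ofReal_ne_top (ENNReal.mul_ne_top
    (ENNReal.mul_ne_top (by simp) ENNReal.ofReal_ne_top) hc)
  refine ⟨S * (4 * (D + D)), ENNReal.mul_ne_top hSt
    (ENNReal.mul_ne_top (by simp) (ENNReal.add_ne_top.mpr ⟨hDt, hDt⟩)), fun Φ hΦ hcΦ hsΦ => ?_⟩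
  have hC := contDiff_classicalCurl hΦ
  have hcC := hasCompactSupport_classicalCurl hcΦ
  set E := ∫⁻ x in Ω, (‖Φ x‖ₑ ^ 2 + ‖classicalCurl Φ x‖ₑ ^ 2) with hE
  have hEn := hcH (fun x => ‖Φ x‖ₑ ^ 2 + ‖classicalCurl Φ x‖ₑ ^ 2)
    ((hΦ.continuous.enorm.measurable.pow_const 2).add (hC.continuous.enorm.measurable.pow_const 2))
    fun x hx => by
      have h1 : Φ x = 0 := image_eq_zero_of_notMem_tsupport fun hx' => hx (hsΦ hx')
      have h2 : classicalCurl Φ x = 0 := image_eq_zero_of_notMem_tsupport fun hx' =>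
        hx (hsΦ (tsupport_classicalCurl_subset Φ hx'))
      simp [h1, h2]
  have key : ∀ {u v₁ v₂ w : R2 × ℝ → ℂ}
      (hu : ContDiff ℝ ∞ u) (hcu : HasCompactSupport u)
      (h₁ : ContDiff ℝ ∞ v₁) (hc₁ : HasCompactSupport v₁)
      (h₂ : ContDiff ℝ ∞ v₂) (hc₂ : HasCompactSupport v₂)
      (hw : ContDiff ℝ ∞ w) (hcw : HasCompactSupport w)
      (heq : ∀ q, vderiv u q = fderiv ℝ v₁ q (e2 0, 0) + fderiv ℝ v₂ q (e2 1, 0) + w q)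
      (hbd : ∀ f ∈ ({u, v₁, v₂, w} : Set (R2 × ℝ → ℂ)), ∀ q, ‖f q‖ ≤
        B * (‖Φ (chartMap k σ g q)‖ + ‖classicalCurl Φ (chartMap k σ g q)‖)),
      negHalf (slice hu hcu 0) ≤ D * E := by
    intro u v₁ v₂ w hu hcu h₁ hc₁ h₂ hc₂ hw hcw heq hbd
    refine (negHalf_slice_le hu hcu h₁ hc₁ h₂ hc₂ hw hcw heq).trans ?_
    rw [hD, mul_assoc]
    refine mul_le_mul_right ?_ _
    rw [mul_assoc]
    refine le_trans ?_ (mul_le_mul_right hEn _)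
    have hfin : 4 * ENNReal.ofReal (2 * B ^ 2) ≠ ⊤ :=
      ENNReal.mul_ne_top (by simp) ENNReal.ofReal_ne_top
    rw [← lintegral_const_mul' _ _ hfin]
    refine lintegral_mono fun s => ?_
    rw [← lintegral_const_mul' _ _ hfin]
    refine lintegral_mono fun y => ?_
    refine (add_le_add (add_le_add (add_le_add
      (enorm_sq_le_of_norm_le (hbd u (by simp) (y, s))) (enorm_sq_le_of_norm_le (hbd v₁ (by simp) (y, s))))
      (enorm_sq_le_of_norm_le (hbd v₂ (by simp) (y, s))))
      (enorm_sq_le_of_norm_le (hbd w (by simp) (y, s)))).trans (le_of_eq ?_)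
    ring
  have hcomp : ∀ {F : R3 → C3}, HasCompactSupport F → ∀ i, HasCompactSupport
      fun q => F (chartMap k σ g q) i := fun hF i =>
    (hasCompactSupport_comp_chartMap hσ hgc hF).comp_left (g := fun v : C3 => v i) rfl
  have hc0 : HasCompactSupport (pullZero k σ g Φ) := (hcomp hcΦ _).add (hcomp hcΦ _).mul_left
  have hc1 : HasCompactSupport (pullOne k σ g Φ) := (hcomp hcΦ _).add (hcomp hcΦ _).mul_left
  have hcF : HasCompactSupport (pullFlux k σ g (classicalCurl Φ)) :=
    ((hcomp hcC _).sub (hcomp hcC _).mul_left).sub (hcomp hcC _).mul_left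
  have hcc : ∀ {F : R3 → C3} (hF : HasCompactSupport F) c i,
      HasCompactSupport (pullComp k σ g F c i) := fun hF c i => (hcomp hF i).mul_left
  have hB1 : 1 ≤ B := by linarith
  have hσn : ‖(σ : ℂ)‖ = 1 := by rcases hσ with rfl | rfl <;> simp
  have coordle : ∀ (v : C3) i, ‖v i‖ ≤ ‖v‖ := fun v i => PiLp.norm_apply_le v i
  have bZ : ∀ q, ‖(0 : ℂ)‖ ≤ B * (‖Φ (chartMap k σ g q)‖ + ‖classicalCurl Φ (chartMap k σ g q)‖) :=
    fun q => by rw [norm_zero]; positivity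
  have b2 : ∀ (v : C3) (j : Fin 2) (i i' : Fin 3) q, ‖v i + graphSlope g j q * v i'‖ ≤ B * ‖v‖ := by
    intro v j i i' q
    refine (norm_add_le _ _).trans ?_
    rw [norm_mul]
    have := mul_le_mul (hM j q) (coordle v i') (norm_nonneg _) hM0
    have := coordle v i
    have := mul_nonneg hM0 (norm_nonneg v)
    rw [hB]; linarith
  have bF : ∀ (v : C3) q, ‖v k - graphSlope g 0 q * v (k + 1) - graphSlope g 1 q * v (k + 2)‖ ≤
      B * ‖v‖ := by
    intro v q
    refine (norm_sub_le _ _).trans ((add_le_add_left (norm_sub_le _ _) _).trans ?_)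
    rw [norm_mul, norm_mul]
    have := mul_le_mul (hM 0 q) (coordle v (k + 1)) (norm_nonneg _) hM0
    have := mul_le_mul (hM 1 q) (coordle v (k + 2)) (norm_nonneg _) hM0
    have := coordle v k
    rw [hB]; linarith
  have bC : ∀ (c : ℂ), ‖c‖ = 1 → ∀ (v : C3) i, ‖c * v i‖ ≤ B * ‖v‖ := by
    intro c hc v i
    rw [norm_mul, hc, one_mul]
    exact (coordle v i).trans (le_mul_of_one_le_left (norm_nonneg _) hB1)
  have toL : ∀ {z : ℂ} {q}, ‖z‖ ≤ B * ‖Φ (chartMap k σ g q)‖ →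
      ‖z‖ ≤ B * (‖Φ (chartMap k σ g q)‖ + ‖classicalCurl Φ (chartMap k σ g q)‖) :=
    fun hz => hz.trans (by gcongr; exact le_add_of_nonneg_right (norm_nonneg _))
  have toR : ∀ {z : ℂ} {q}, ‖z‖ ≤ B * ‖classicalCurl Φ (chartMap k σ g q)‖ →
      ‖z‖ ≤ B * (‖Φ (chartMap k σ g q)‖ + ‖classicalCurl Φ (chartMap k σ g q)‖) :=
    fun hz => hz.trans (by gcongr; exact le_add_of_nonneg_left (norm_nonneg _))
  have hz : ContDiff ℝ ∞ (fun _ : R2 × ℝ => (0 : ℂ)) := contDiff_const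
  have hcz : HasCompactSupport (fun _ : R2 × ℝ => (0 : ℂ)) := HasCompactSupport.zero
  have hσn' : ‖-(σ : ℂ)‖ = 1 := by rw [norm_neg, hσn]
  have n0 : negHalf (slice (contDiff_pullZero (k := k) (σ := σ) hg hΦ) hc0 0) ≤ D * E := by
    refine key _ _ (contDiff_pullComp (k := k) (σ := σ) hg hΦ σ k) (hcc hcΦ _ _) hz hcz
      (contDiff_pullComp (k := k) (σ := σ) hg hC σ (k + 2)) (hcc hcC _ _) (fun q => ?_) ?_
    · rw [vderiv_pullZero hg hΦ]; simp
    · rintro f (rfl | rfl | rfl | rfl) q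
      · exact toL (b2 _ _ _ _ _)
      · exact toL (bC _ hσn _ _)
      · exact bZ q
      · exact toR (bC _ hσn _ _)
  have n1 : negHalf (slice (contDiff_pullOne (k := k) (σ := σ) hg hΦ) hc1 0) ≤ D * E := by
    refine key _ _ hz hcz (contDiff_pullComp (k := k) (σ := σ) hg hΦ σ k) (hcc hcΦ _ _)
      (contDiff_pullComp (k := k) (σ := σ) hg hC (-σ) (k + 1)) (hcc hcC _ _) (fun q => ?_) ?_
    · rw [vderiv_pullOne hg hΦ]; simp
    · rintro f (rfl | rfl | rfl | rfl) q
      · exact toL (b2 _ _ _ _ _)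
      · exact bZ q
      · exact toL (bC _ hσn _ _)
      · exact toR (bC _ hσn' _ _)
  have nF : negHalf (slice (contDiff_pullFlux (k := k) (σ := σ) hg hC) hcF 0) ≤ D * E := by
    refine key _ _ (contDiff_pullComp (k := k) (σ := σ) hg hC (-σ) (k + 1)) (hcc hcC _ _)
      (contDiff_pullComp (k := k) (σ := σ) hg hC (-σ) (k + 2)) (hcc hcC _ _) hz hcz (fun q => ?_) ?_
    · rw [vderiv_pullFlux hg hΦ, add_zero]
    · rintro f (rfl | rfl | rfl | rfl) q
      · exact toR (bF _ _)
      · exact toR (bC _ hσn' _ _)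
      · exact toR (bC _ hσn' _ _)
      · exact bZ q
  obtain ⟨p, ψ₀, ψ₁, e₀, e₁, m, m₀, m₁⟩ := exists_plane_decomposition
    (slice (contDiff_pullZero (k := k) (σ := σ) hg hΦ) hc0 0)
    (slice (contDiff_pullOne (k := k) (σ := σ) hg hΦ) hc1 0)
  -- The rotation occurring in the bounds for `ψ₀` and `ψ₁` is the flux of the curl, whose trace is
  -- bounded by `nF`.
  have hrot : ∂_{e2 0} (slice (contDiff_pullOne (k := k) (σ := σ) hg hΦ) hc1 0) -
      ∂_{e2 1} (slice (contDiff_pullZero (k := k) (σ := σ) hg hΦ) hc0 0) =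
      slice (contDiff_pullFlux (k := k) (σ := σ) hg hC) hcF 0 := by
    ext y
    rw [sub_apply, lineDeriv_slice, lineDeriv_slice, slice_apply, rot_pull hg hΦ]
  rw [hrot] at m₀ m₁
  have fin : ∀ {q : 𝓢(R2, ℂ)} {a b : ℝ≥0∞}, a ≤ D * E → b ≤ D * E → posHalf q ≤ 4 * (a + b) →
      planeNorm q ≤ S * (4 * (D + D)) * E := by
    intro q a b ha hb hq
    refine (lintegral_enorm_sq_add_gagliardo_le q).trans ?_
    rw [mul_assoc]
    refine mul_le_mul_right (hq.trans ?_) _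
    rw [mul_assoc, add_mul]
    exact mul_le_mul_right (add_le_add ha hb) _
  refine ⟨p, ψ₀, ψ₁, fun y => ?_, fun y => ?_, ?_⟩
  · have := congrArg (fun f : 𝓢(R2, ℂ) => f y) e₀
    simpa only [slice_apply, add_apply, SchwartzMap.lineDerivOp_apply_eq_fderiv] using this
  · have := congrArg (fun f : 𝓢(R2, ℂ) => f y) e₁
    simpa only [slice_apply, add_apply, SchwartzMap.lineDerivOp_apply_eq_fderiv] using this
  · rintro q (rfl | rfl | rfl)
    · exact fin n0 n1 m
    · exact fin n0 nF m₀
    · exact fin n1 nF m₁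

/-! ### The boundary surface in a graph chart -/

theorem IsGraphChart.eq_of_mem_frontier {Ω : Set R3} {k : Fin 3} {σ : ℝ} {g : R2 → ℝ}
    {V : Set R3} (h : IsGraphChart Ω k σ g V) (hΩ : IsOpen Ω) {x : R3} (hV : x ∈ V)
    (hx : x ∈ frontier Ω) : x k = g (planeProj k x) := by
  have h1 := h.nonneg_of_mem_closure hV hx.1
  have h2 : ¬ 0 < σ * (x k - g (planeProj k x)) := fun hlt =>
    hx.2 (hΩ.interior_eq.symm ▸ (h.mem_iff x hV).mpr hlt)
  have h3 : σ * (x k - g (planeProj k x)) = 0 := le_antisymm (not_lt.mp h2) h1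
  have hσ : σ ≠ 0 := by rcases h.sign with rfl | rfl <;> norm_num
  exact sub_eq_zero.mp ((mul_eq_zero.mp h3).resolve_left hσ)

theorem IsGraphChart.axisLift_graph {Ω : Set R3} {k : Fin 3} {σ : ℝ} {g : R2 → ℝ}
    {V : Set R3} (h : IsGraphChart Ω k σ g V) (hΩ : IsOpen Ω) {x : R3} (hV : x ∈ V)
    (hx : x ∈ frontier Ω) : axisLift k (planeProj k x, g (planeProj k x)) = x := by
  rw [← h.eq_of_mem_frontier hΩ hV hx, axisLift_planeProj]

theorem euclideanHausdorffMeasure_image_le {X Y : Type*} [EMetricSpace X] [EMetricSpace Y]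
    [MeasurableSpace X] [BorelSpace X] [MeasurableSpace Y] [BorelSpace Y] {K : NNReal} {f : X → Y}
    (hf : LipschitzWith K f) (s : Set X) :
    (Measure.euclideanHausdorffMeasure 2 : Measure Y) (f '' s) ≤
      (K : ℝ≥0∞) ^ 2 * (Measure.euclideanHausdorffMeasure 2 : Measure X) s := by
  rw [Measure.euclideanHausdorffMeasure_def, Measure.euclideanHausdorffMeasure_def,
    Measure.smul_apply, Measure.smul_apply, ENNReal.smul_def, ENNReal.smul_def, smul_eq_mul,
    smul_eq_mul, mul_left_comm]
  refine mul_le_mul_right ((hf.hausdorffMeasure_image_le (by simp) s).trans (le_of_eq ?_)) _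
  simp

/-- The coordinate projection of the boundary to the plane. -/
def bdryProj (Ω : Set R3) (k : Fin 3) (x : frontier Ω) : R2 := planeProj k x

theorem continuous_bdryProj (Ω : Set R3) (k : Fin 3) : Continuous (bdryProj Ω k) :=
  (planeProj k).continuous.comp continuous_subtype_val

/-- The part of the boundary in `V`. -/
def bdryPart (Ω V : Set R3) : Set (frontier Ω) := Subtype.val ⁻¹' V

theorem IsGraphChart.isOpen_bdryPart {Ω : Set R3} {k : Fin 3} {σ : ℝ} {g : R2 → ℝ}
    {V : Set R3} (h : IsGraphChart Ω k σ g V) : IsOpen (bdryPart Ω V) :=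
  h.isOpen.preimage continuous_subtype_val

/-- The part of the boundary in the chart lies in a Lipschitz image of the plane, and the
two-dimensional Hausdorff measure grows at most by the square of the Lipschitz constant. -/
theorem IsGraphChart.exists_map_le {Ω : Set R3} {k : Fin 3} {σ : ℝ} {g : R2 → ℝ}
    {V : Set R3} (h : IsGraphChart Ω k σ g V) (hΩ : IsOpen Ω) : ∃ L : ℝ≥0∞, L ≠ ⊤ ∧
      Measure.map (bdryProj Ω k) ((surfaceMeasure Ω).restrict (bdryPart Ω V)) ≤ L • volume := by
  obtain ⟨K, hK⟩ := lipschitz_of_graphChart h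
  have hγ : LipschitzWith (‖axisLift k‖₊ * max 1 K) fun y : R2 => axisLift k (y, g y) :=
    (axisLift k).lipschitz.comp (LipschitzWith.id.prodMk hK)
  set K' : NNReal := ‖axisLift k‖₊ * max 1 K
  refine ⟨(K' : ℝ≥0∞) ^ 2, by simp, Measure.le_iff.mpr fun t ht => ?_⟩
  have hm := (continuous_bdryProj Ω k).measurable
  rw [Measure.map_apply hm ht, Measure.restrict_apply (hm ht), Measure.smul_apply, smul_eq_mul,
    surfaceMeasure, ← (isometry_subtype_coe (s := frontier Ω)).euclideanHausdorffMeasure_image,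
    ← EuclideanSpace.euclideanHausdorffMeasure_eq_volume]
  refine (measure_mono ?_).trans (euclideanHausdorffMeasure_image_le hγ t)
  rintro _ ⟨x, ⟨hx1, hx2⟩, rfl⟩
  exact ⟨bdryProj Ω k x, hx1, h.axisLift_graph hΩ hx2 x.2⟩

theorem IsGraphChart.exists_lintegral_bdry_le {Ω : Set R3} {k : Fin 3} {σ : ℝ} {g : R2 → ℝ}
    {V : Set R3} (h : IsGraphChart Ω k σ g V) (hΩ : IsOpen Ω) : ∃ L : ℝ≥0∞, L ≠ ⊤ ∧
      ∀ f : R2 → ℝ≥0∞, Measurable f →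
        ∫⁻ x in bdryPart Ω V, f (bdryProj Ω k x) ∂surfaceMeasure Ω ≤ L * ∫⁻ y, f y := by
  obtain ⟨L, hL, hle⟩ := h.exists_map_le hΩ
  refine ⟨L, hL, fun f hf => ?_⟩
  rw [← lintegral_map hf (continuous_bdryProj Ω k).measurable, ← smul_eq_mul,
    ← lintegral_smul_measure]
  exact lintegral_mono' hle le_rfl

theorem surfaceMeasure_univ_lt_top {Ω : Set R3} (hΩ : IsSmoothBoundedDomain Ω) :
    surfaceMeasure Ω Set.univ < ⊤ := by
  have hcomp : IsCompact (frontier Ω) :=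
    hΩ.isBounded.isCompact_closure.of_isClosed_subset isClosed_frontier frontier_subset_closure
  have : CompactSpace (frontier Ω) := isCompact_iff_compactSpace.mp hcomp
  refine isCompact_univ.measure_lt_top_of_nhdsWithin fun x _ => ?_
  obtain ⟨k, σ, g, V, h, hx⟩ := exists_isGraphChart hΩ x.2
  obtain ⟨L, hL, hle⟩ := h.exists_map_le hΩ.isOpen
  have hB : Bornology.IsBounded (planeProj k '' closure Ω) :=
    (hΩ.isBounded.isCompact_closure.image (planeProj k).continuous).isBounded
  have hcl := (hΩ.isBounded.isCompact_closure.image (planeProj k).continuous)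
  refine ⟨bdryPart Ω V, mem_nhdsWithin_of_mem_nhds (h.isOpen_bdryPart.mem_nhds hx), ?_⟩
  have h1 := hle (planeProj k '' closure Ω)
  rw [Measure.map_apply (continuous_bdryProj Ω k).measurable hcl.measurableSet,
    Measure.restrict_apply ((continuous_bdryProj Ω k).measurable hcl.measurableSet)] at h1
  refine lt_of_le_of_lt ?_ (h1.trans_lt (ENNReal.mul_lt_top hL.lt_top hcl.measure_lt_top))
  refine measure_mono fun y hy => ⟨?_, hy⟩
  exact ⟨y, y.2.1, rfl⟩

theorem edist_planeProj_le (k : Fin 3) (x y : R3) : edist (planeProj k x) (planeProj k y) ≤ edist x y := by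
  rw [edist_eq_enorm_sub, edist_eq_enorm_sub, ← map_sub, ← ofReal_norm, ← ofReal_norm]
  refine ENNReal.ofReal_le_ofReal ?_
  rw [EuclideanSpace.norm_eq, EuclideanSpace.norm_eq]
  refine Real.sqrt_le_sqrt ?_
  rw [Fin.sum_univ_two, sum_cyclic _ k, planeProj_zero, planeProj_one]
  nlinarith [sq_nonneg ‖(x - y) k‖]

/-- The capped Lipschitz bound turns the quotient into `slobKernel` of the distance in space;
passing to the shorter distance of the projections only increases it, as the kernel is antitone. -/
theorem slobKernel_term_le {F : Type*} [NormedAddCommGroup F] {K : ℝ} (hK : 0 ≤ K) {a b : F}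
    {x y : R3} (h1 : ‖a - b‖ ^ 2 ≤ K * min 1 (dist x y ^ 2)) {s t : R2} (hst : dist s t ≤ dist x y)
    (hne : s = t → x = y) :
    ‖a - b‖ₑ ^ 2 / edist x y ^ 3 ≤ ENNReal.ofReal K * ENNReal.ofReal (slobKernel (dist s t)) := by
  rcases eq_or_ne x y with rfl | hxy
  · have : ‖a - b‖ ^ 2 ≤ 0 := by simpa using h1
    have : ‖a - b‖ = 0 := by nlinarith [norm_nonneg (a - b)]
    rw [← ofReal_norm, this]; simp
  · have hd : 0 < dist x y := dist_pos.mpr hxy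
    have hds : 0 < dist s t := dist_pos.mpr fun h => hxy (hne h)
    rw [edist_dist, ← ofReal_norm, ← ENNReal.ofReal_pow (norm_nonneg _),
      ← ENNReal.ofReal_pow dist_nonneg, ← ENNReal.ofReal_div_of_pos (by positivity),
      ← ENNReal.ofReal_mul hK]
    refine ENNReal.ofReal_le_ofReal ?_
    calc ‖a - b‖ ^ 2 / dist x y ^ 3 ≤ K * min 1 (dist x y ^ 2) / dist x y ^ 3 := by gcongr
      _ = K * slobKernel (dist x y) := by rw [slobKernel, mul_div_assoc]
      _ ≤ _ := mul_le_mul_of_nonneg_left (slobKernel_antitone hds hst) hK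

theorem lintegral_slobKernel_dist (t : R2) :
    ∫⁻ s, ENNReal.ofReal (slobKernel (dist s t)) = slobMass := by
  have := lintegral_sub_right_eq_self (μ := volume) (fun h : R2 => ENNReal.ofReal (slobKernel ‖h‖)) t
  rw [slobMass, ← this]
  simp only [dist_eq_norm]

theorem enorm_smul_sub_smul_sq_le {F : Type*} [NormedAddCommGroup F] [NormedSpace ℂ F] (a b : ℂ)
    (v w : F) {M : ℝ} (hv : ‖v‖ ≤ M) : ‖a • v - b • w‖ₑ ^ 2 ≤
      ENNReal.ofReal (2 * M ^ 2) * ‖a - b‖ₑ ^ 2 + 2 * (‖b‖ₑ ^ 2 * ‖v - w‖ₑ ^ 2) := by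
  have h2 : (2 : ℝ≥0∞) = ENNReal.ofReal 2 := by simp
  simp only [← ofReal_norm, ← ENNReal.ofReal_pow (norm_nonneg _)]
  rw [h2, ← ENNReal.ofReal_mul (by positivity), ← ENNReal.ofReal_mul (by positivity),
    ← ENNReal.ofReal_mul (by positivity), ← ENNReal.ofReal_add (by positivity) (by positivity)]
  refine ENNReal.ofReal_le_ofReal ?_
  have h1 : ‖a • v - b • w‖ ≤ ‖a - b‖ * M + ‖b‖ * ‖v - w‖ := by
    have : a • v - b • w = (a - b) • v + b • (v - w) := by module
    rw [this]
    refine (norm_add_le _ _).trans ?_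
    rw [norm_smul, norm_smul]
    gcongr
  refine (pow_le_pow_left₀ (norm_nonneg _) h1 2).trans ?_
  nlinarith [sq_nonneg (‖a - b‖ * M - ‖b‖ * ‖v - w‖)]

/-- Boundedness serves distant pairs and the Lipschitz bound near ones; the resulting cap is what
makes the planar kernel integrable both at 0 and at infinity. -/
theorem exists_lipschitz_cap {F : Type*} [NormedAddCommGroup F] [NormedSpace ℝ F] {w : R3 → F}
    (hw : ContDiff ℝ ∞ w) (hc : HasCompactSupport w) : ∃ M K : ℝ, 0 ≤ M ∧ 0 ≤ K ∧
      (∀ x, ‖w x‖ ≤ M) ∧ ∀ x y, ‖w x - w y‖ ^ 2 ≤ K * min 1 (dist x y ^ 2) := by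
  obtain ⟨M, hM⟩ := hc.exists_bound_of_continuous hw.continuous
  obtain ⟨L, hL⟩ := hw.lipschitzWith_of_hasCompactSupport hc (by simp)
  have hM0 : 0 ≤ M := (norm_nonneg _).trans (hM 0)
  refine ⟨M, max ((2 * M) ^ 2) (L ^ 2), hM0, by positivity, hM, fun x y => ?_⟩
  have h1 : ‖w x - w y‖ ≤ 2 * M := (norm_sub_le _ _).trans (by linarith [hM x, hM y])
  have h2 : ‖w x - w y‖ ≤ L * dist x y := by
    rw [← dist_eq_norm]; exact hL.dist_le_mul x y
  rcases min_cases 1 (dist x y ^ 2) with ⟨h, -⟩ | ⟨h, -⟩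
  · rw [h, mul_one]
    exact (pow_le_pow_left₀ (norm_nonneg _) h1 2).trans (le_max_left _ _)
  · rw [h]
    refine (pow_le_pow_left₀ (norm_nonneg _) h2 2).trans ?_
    rw [mul_pow]
    exact mul_le_mul_of_nonneg_right (le_max_right _ _) (sq_nonneg _)

theorem lintegral_slobKernel_weight {q : R2 → ℂ} (hq : Continuous q) :
    ∫⁻ s, ∫⁻ t, ‖q t‖ₑ ^ 2 * ENNReal.ofReal (slobKernel (dist s t)) = slobMass * ∫⁻ t, ‖q t‖ₑ ^ 2 := by
  have hm : Measurable fun p : R2 × R2 => ‖q p.2‖ₑ ^ 2 * ENNReal.ofReal (slobKernel (dist p.1 p.2)) :=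
    ((hq.comp continuous_snd).measurable.enorm.pow_const 2).mul
      (measurable_slobKernel.comp (measurable_fst.dist measurable_snd)).ennreal_ofReal
  rw [lintegral_lintegral_swap hm.aemeasurable]
  simp_rw [lintegral_const_mul' _ _ (ENNReal.pow_ne_top enorm_ne_top), lintegral_slobKernel_dist]
  rw [lintegral_mul_const _ (hq.measurable.enorm.pow_const 2), mul_comm]

/-- Functions on the plane, cut off to a chart, are bounded in `H^{1/2}(∂Ω)` by their norm in
`H^{1/2}(ℝ²)`. -/
theorem IsGraphChart.exists_hHalfNorm_le {Ω : Set R3} {k : Fin 3} {σ : ℝ} {g : R2 → ℝ}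
    {V : Set R3} (h : IsGraphChart Ω k σ g V) (hΩ : IsSmoothBoundedDomain Ω)
    {F : Type*} [NormedAddCommGroup F] [NormedSpace ℂ F] {w : R3 → F} (hw : ContDiff ℝ ∞ w)
    (hc : HasCompactSupport w) (hs : tsupport w ⊆ V) : ∃ C : ℝ≥0∞, C ≠ ⊤ ∧ ∀ q : R2 → ℂ,
      Continuous q → hHalfNorm (fun x : frontier Ω => q (planeProj k x) • w x) ≤
        (C * planeNorm q) ^ (1 / 2 : ℝ) := by
  obtain ⟨L, hL, hLf⟩ := h.exists_lintegral_bdry_le hΩ.isOpen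
  obtain ⟨M, K, hM0, hK0, hM, hK⟩ := exists_lipschitz_cap hw hc
  have hST := surfaceMeasure_univ_lt_top hΩ
  -- A boundary point outside `V` is at distance at least `δ` from the support of `w`, so for such
  -- mixed pairs the singular kernel is at most `δ⁻³`.
  obtain ⟨δ, hδ, hδV⟩ := hc.isCompact.exists_thickening_subset_open h.isOpen hs
  set A := bdryPart Ω V with hA
  have hAm : MeasurableSet A := h.isOpen_bdryPart.measurableSet
  set S := surfaceMeasure Ω with hS
  set D : ℝ≥0∞ := ENNReal.ofReal (M ^ 2) * (ENNReal.ofReal δ ^ 3)⁻¹ with hD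
  have hDt : D ≠ ⊤ := by
    refine ENNReal.mul_ne_top ENNReal.ofReal_ne_top (ENNReal.inv_ne_top.mpr ?_)
    exact pow_ne_zero _ (ENNReal.ofReal_pos.mpr hδ).ne'
  set c₁ : ℝ≥0∞ := ENNReal.ofReal (2 * M ^ 2)
  set c₂ : ℝ≥0∞ := 2 * ENNReal.ofReal K
  set C : ℝ≥0∞ := ENNReal.ofReal (M ^ 2) * L + (L * L * c₁ + L * L * c₂ * slobMass +
    (D * L * S Set.univ + D * L * S Set.univ)) with hC
  have hCt : C ≠ ⊤ := by
    have := slobMass_lt_top.ne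
    have := hST.ne
    have h1 : c₁ ≠ ⊤ := ENNReal.ofReal_ne_top
    have h2 : c₂ ≠ ⊤ := ENNReal.mul_ne_top (by simp) ENNReal.ofReal_ne_top
    simp only [hC]
    finiteness
  refine ⟨C, hCt, fun q hq => ?_⟩
  unfold hHalfNorm
  refine ENNReal.rpow_le_rpow ?_ (by norm_num)
  set π := bdryProj Ω k with hπ
  have hπm : Measurable π := (continuous_bdryProj Ω k).measurable
  have hw0 : ∀ x : frontier Ω, x ∉ A → w x = 0 := fun x hx =>
    image_eq_zero_of_notMem_tsupport fun hx' => hx (hs hx')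
  set N := ∫⁻ y, ‖q y‖ₑ ^ 2 with hN
  have hqm : Measurable fun y => ‖q y‖ₑ ^ 2 := hq.measurable.enorm.pow_const 2
  have hpt0 : ∀ x : frontier Ω, ‖q (planeProj k x) • w x‖ₑ ^ 2 ≤
      ENNReal.ofReal (M ^ 2) * ‖q (π x)‖ₑ ^ 2 := by
    intro x
    rw [enorm_smul, mul_pow, mul_comm, ENNReal.ofReal_pow hM0]
    refine mul_le_mul_left (pow_le_pow_left' ?_ 2) _
    rw [← ofReal_norm]
    exact ENNReal.ofReal_le_ofReal (hM x)
  have hT : ∀ f : R2 → ℝ≥0∞, Measurable f → ∫⁻ x, A.indicator (fun x => f (π x)) x ∂S ≤ L * ∫⁻ y, f y := by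
    intro f hf
    rw [lintegral_indicator hAm]
    exact hLf f hf
  have hI1 : ∫⁻ x, ‖q (planeProj k x) • w x‖ₑ ^ 2 ∂S ≤ ENNReal.ofReal (M ^ 2) * L * N := by
    refine (lintegral_mono (g := fun x => ENNReal.ofReal (M ^ 2) *
      A.indicator (fun x => ‖q (π x)‖ₑ ^ 2) x) fun x => ?_).trans ?_
    · by_cases hx : x ∈ A
      · simpa only [Set.indicator_of_mem hx] using hpt0 x
      · simp [hw0 x hx]
    · rw [lintegral_const_mul' _ _ ENNReal.ofReal_ne_top, mul_assoc]
      exact mul_le_mul_right (hT _ hqm) _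
  -- Majorant for two points of the chart: the difference of the products splits into the Gagliardo
  -- quotient of `q` and the difference of `w`, the latter weighted by the integrable kernel.
  set G : R2 → R2 → ℝ≥0∞ := fun s t => c₁ * (‖q s - q t‖ₑ ^ 2 / edist s t ^ 3) +
    c₂ * (‖q t‖ₑ ^ 2 * ENNReal.ofReal (slobKernel (dist s t))) with hG
  have hGm1 : Measurable fun p : R2 × R2 => ‖q p.1 - q p.2‖ₑ ^ 2 / edist p.1 p.2 ^ 3 :=
    ((((hq.comp continuous_fst).sub (hq.comp continuous_snd)).measurable.enorm.pow_const 2).div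
      ((measurable_fst.edist measurable_snd).pow_const 3))
  have hGm2 : Measurable fun p : R2 × R2 =>
      ‖q p.2‖ₑ ^ 2 * ENNReal.ofReal (slobKernel (dist p.1 p.2)) :=
    ((hq.comp continuous_snd).measurable.enorm.pow_const 2).mul
      (measurable_slobKernel.comp (measurable_fst.dist measurable_snd)).ennreal_ofReal
  have hGm : Measurable (Function.uncurry G) := (hGm1.const_mul c₁).add (hGm2.const_mul c₂)
  have hGint : ∫⁻ s, ∫⁻ t, G s t = c₁ * gagliardo q + c₂ * (slobMass * N) := by
    have hc1 : c₁ ≠ ⊤ := ENNReal.ofReal_ne_top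
    have hc2 : c₂ ≠ ⊤ := ENNReal.mul_ne_top (by simp) ENNReal.ofReal_ne_top
    have e : ∀ s, ∫⁻ t, G s t = c₁ * (∫⁻ t, ‖q s - q t‖ₑ ^ 2 / edist s t ^ 3) +
        c₂ * ∫⁻ t, ‖q t‖ₑ ^ 2 * ENNReal.ofReal (slobKernel (dist s t)) := fun s => by
      have m1 : Measurable fun t => c₁ * (‖q s - q t‖ₑ ^ 2 / edist s t ^ 3) :=
        (hGm1.comp (measurable_prodMk_left (x := s))).const_mul c₁
      simp only [hG]
      rw [lintegral_add_left m1, lintegral_const_mul' _ _ hc1, lintegral_const_mul' _ _ hc2]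
    rw [lintegral_congr e, lintegral_add_left, lintegral_const_mul' _ _ hc1,
      lintegral_const_mul' _ _ hc2, lintegral_slobKernel_weight hq]
    · rfl
    · exact (hGm1.lintegral_prod_right').const_mul c₁
  have hfar : ∀ x y : frontier Ω, x ∈ A → y ∉ A → ‖q (planeProj k x) • w x‖ₑ ^ 2 / edist x y ^ 3 ≤
      D * ‖q (π x)‖ₑ ^ 2 := by
    intro x y hx hy
    by_cases hwx : w x = 0
    · simp [hwx]
    have hxy : ENNReal.ofReal δ ≤ edist x y := by
      by_contra! hlt
      refine hy (hδV (Metric.mem_thickening_iff_exists_edist_lt _ _ |>.mpr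
        ⟨x, subset_tsupport _ hwx, ?_⟩))
      rw [edist_comm]; exact hlt
    rw [div_eq_mul_inv, hD, mul_right_comm]
    exact mul_le_mul' (hpt0 x) (ENNReal.inv_le_inv.mpr (pow_le_pow_left' hxy 3))
  have hpt : ∀ x y : frontier Ω,
      ‖q (planeProj k x) • w x - q (planeProj k y) • w y‖ₑ ^ 2 / edist x y ^ 3 ≤
        A.indicator (fun x => A.indicator (fun y => G (π x) (π y)) y) x +
        (D * A.indicator (fun x => ‖q (π x)‖ₑ ^ 2) x + D * A.indicator (fun y => ‖q (π y)‖ₑ ^ 2) y) := by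
    intro x y
    by_cases hx : x ∈ A <;> by_cases hy : y ∈ A
    · refine le_trans ?_ le_self_add
      rw [Set.indicator_of_mem hx, Set.indicator_of_mem hy]
      refine (ENNReal.div_le_div_right (enorm_smul_sub_smul_sq_le _ _ _ _ (hM x)) _).trans ?_
      rw [ENNReal.add_div]
      refine add_le_add ?_ ?_
      · rw [mul_div_assoc]
        refine mul_le_mul_right (ENNReal.div_le_div_left (pow_le_pow_left' ?_ 3) _) _
        exact edist_planeProj_le k x y
      · rw [mul_div_assoc, mul_div_assoc, mul_assoc, mul_left_comm (ENNReal.ofReal K)]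
        refine mul_le_mul_right (mul_le_mul_right ?_ _) _
        refine slobKernel_term_le hK0 (hK x y) ?_ fun hst => ?_
        · have := edist_planeProj_le k (x : R3) y
          rw [edist_dist, edist_dist] at this
          exact (ENNReal.ofReal_le_ofReal_iff dist_nonneg).mp this
        · have h1 := h.axisLift_graph hΩ.isOpen hx x.2
          have h2 := h.axisLift_graph hΩ.isOpen hy y.2
          rw [← h1, ← h2]
          have : planeProj k (x : R3) = planeProj k (y : R3) := hst
          rw [this]
    · refine le_trans ?_ (le_add_left le_self_add)
      rw [hw0 y hy, smul_zero, sub_zero, Set.indicator_of_mem hx]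
      exact hfar x y hx hy
    · refine le_trans ?_ (le_add_left (le_add_left le_rfl))
      rw [hw0 x hx, smul_zero, zero_sub, enorm_neg, Set.indicator_of_mem hy, edist_comm]
      exact hfar y x hy hx
    · simp [hw0 x hx, hw0 y hy]
  have hind : Measurable fun x => A.indicator (fun x => ‖q (π x)‖ₑ ^ 2) x :=
    (hqm.comp hπm).indicator hAm
  have hinner : ∀ x : frontier Ω,
      ∫⁻ y, ‖q (planeProj k x) • w x - q (planeProj k y) • w y‖ₑ ^ 2 / edist x y ^ 3 ∂S ≤
        L * A.indicator (fun x => ∫⁻ t, G (π x) t) x +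
        (D * S Set.univ * A.indicator (fun x => ‖q (π x)‖ₑ ^ 2) x + D * (L * N)) := by
    intro x
    refine (lintegral_mono (hpt x)).trans ?_
    have m1 : Measurable fun y => D * A.indicator (fun x => ‖q (π x)‖ₑ ^ 2) x +
        D * A.indicator (fun y => ‖q (π y)‖ₑ ^ 2) y := measurable_const.add (hind.const_mul D)
    rw [lintegral_add_right _ m1,
      lintegral_add_left measurable_const, lintegral_const, lintegral_const_mul' _ _ hDt]
    refine add_le_add ?_ (add_le_add (le_of_eq (by ring)) (mul_le_mul_right (hT _ hqm) _))
    by_cases hx : x ∈ A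
    · simp only [Set.indicator_of_mem hx]
      exact hT (fun t => G (π x) t) hGm.of_uncurry_left
    · simp [Set.indicator_of_notMem hx]
  have hout : Measurable fun s => ∫⁻ t, G s t := hGm.lintegral_prod_right'
  have hI2 : ∫⁻ x, ∫⁻ y, ‖q (planeProj k x) • w x - q (planeProj k y) • w y‖ₑ ^ 2 /
      edist x y ^ 3 ∂S ∂S ≤ L * (L * (c₁ * gagliardo q + c₂ * (slobMass * N))) +
        (D * S Set.univ * (L * N) + D * (L * N) * S Set.univ) := by
    refine (lintegral_mono hinner).trans ?_
    have m1 : Measurable fun x => D * S Set.univ * A.indicator (fun x => ‖q (π x)‖ₑ ^ 2) x :=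
      hind.const_mul _
    have m2 : Measurable fun x => D * S Set.univ * A.indicator (fun x => ‖q (π x)‖ₑ ^ 2) x +
      D * (L * N) := m1.add measurable_const
    rw [lintegral_add_right _ m2, lintegral_add_left m1, lintegral_const, lintegral_const_mul' _ _ hL,
      lintegral_const_mul' _ _ (ENNReal.mul_ne_top hDt hST.ne)]
    refine add_le_add (mul_le_mul_right ?_ _) (add_le_add (mul_le_mul_right (hT _ hqm) _) le_rfl)
    rw [← hGint]
    exact hT _ hout
  refine (add_le_add hI1 hI2).trans ?_
  have hNle : N ≤ planeNorm q := le_self_add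
  have hgle : gagliardo q ≤ planeNorm q := le_add_left le_rfl
  calc _ ≤ ENNReal.ofReal (M ^ 2) * L * planeNorm q +
        (L * (L * (c₁ * planeNorm q + c₂ * (slobMass * planeNorm q))) +
        (D * S Set.univ * (L * planeNorm q) + D * (L * planeNorm q) * S Set.univ)) := by gcongr
    _ = C * planeNorm q := by rw [hC]; ring

/-! ### The normal field and the tangential gradient in a chart -/

theorem planeProj_single_self (k : Fin 3) : planeProj k (EuclideanSpace.single k (1 : ℝ)) = 0 := by
  ext j; fin_cases k <;> fin_cases j <;> simp

theorem planeProj_single_add_one (k : Fin 3) :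
    planeProj k (EuclideanSpace.single (k + 1) (1 : ℝ)) = e2 0 := by
  ext j; fin_cases k <;> fin_cases j <;> simp

theorem planeProj_single_add_two (k : Fin 3) :
    planeProj k (EuclideanSpace.single (k + 2) (1 : ℝ)) = e2 1 := by
  ext j; fin_cases k <;> fin_cases j <;> simp

/-- The (unnormalized) normal field `e_k - ∇g` of a graph. -/
def graphNormal (k : Fin 3) (g : R2 → ℝ) (x : R3) : C3 :=
  EuclideanSpace.single k 1 - graphSlope g 0 (planeProj k x, 0) • EuclideanSpace.single (k + 1) 1 -
    graphSlope g 1 (planeProj k x, 0) • EuclideanSpace.single (k + 2) 1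

theorem graphNormal_self (k : Fin 3) (g : R2 → ℝ) (x : R3) : graphNormal k g x k = 1 := by
  fin_cases k <;> simp [graphNormal]

theorem graphNormal_add_one (k : Fin 3) (g : R2 → ℝ) (x : R3) :
    graphNormal k g x (k + 1) = -graphSlope g 0 (planeProj k x, 0) := by
  fin_cases k <;> simp [graphNormal]

theorem graphNormal_add_two (k : Fin 3) (g : R2 → ℝ) (x : R3) :
    graphNormal k g x (k + 2) = -graphSlope g 1 (planeProj k x, 0) := by
  fin_cases k <;> simp [graphNormal]

theorem contDiff_graphNormal (k : Fin 3) {g : R2 → ℝ} (hg : ContDiff ℝ ∞ g) :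
    ContDiff ℝ ∞ (graphNormal k g) := by
  have h : ∀ j, ContDiff ℝ ∞ fun x : R3 => graphSlope g j (planeProj k x, 0) := fun j =>
    (contDiff_graphSlope hg j).comp ((planeProj k).contDiff.prodMk contDiff_const)
  exact (contDiff_const.sub ((h 0).smul contDiff_const)).sub ((h 1).smul contDiff_const)

theorem dot_graphNormal_self (k : Fin 3) (g : R2 → ℝ) (x : R3) :
    dot (graphNormal k g x) (graphNormal k g x) =
      ((1 + fderiv ℝ g (planeProj k x) (e2 0) ^ 2 + fderiv ℝ g (planeProj k x) (e2 1) ^ 2 : ℝ) : ℂ) := by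
  rw [dot, sum_cyclic _ k, graphNormal_self, graphNormal_add_one, graphNormal_add_two]
  simp only [graphSlope]
  push_cast
  ring

theorem dot_graphNormal_self_ne_zero (k : Fin 3) (g : R2 → ℝ) (x : R3) :
    dot (graphNormal k g x) (graphNormal k g x) ≠ 0 := by
  rw [dot_graphNormal_self]
  have : 0 < 1 + fderiv ℝ g (planeProj k x) (e2 0) ^ 2 + fderiv ℝ g (planeProj k x) (e2 1) ^ 2 := by
    positivity
  exact_mod_cast this.ne'

/-- The defining function of `Ω` given by a graph chart. -/
def graphDefining (k : Fin 3) (σ : ℝ) (g : R2 → ℝ) (x : R3) : ℝ := -σ * (x k - g (planeProj k x))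

theorem contDiff_graphDefining {k : Fin 3} {σ : ℝ} {g : R2 → ℝ} (hg : ContDiff ℝ ∞ g) :
    ContDiff ℝ ∞ (graphDefining k σ g) :=
  contDiff_const.mul (((EuclideanSpace.proj k : R3 →L[ℝ] ℝ).contDiff).sub
    (hg.comp (planeProj k).contDiff))

theorem gradient_graphDefining {k : Fin 3} {σ : ℝ} {g : R2 → ℝ} (hg : ContDiff ℝ ∞ g) (x : R3)
    (i : Fin 3) : ((gradient (graphDefining k σ g) x i : ℝ) : ℂ) = -σ * graphNormal k g x i := by
  have h0 : HasFDerivAt g (fderiv ℝ g (planeProj k x)) (planeProj k x) :=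
    (hg.differentiable (by simp) _).hasFDerivAt
  have h1 : HasFDerivAt (graphDefining k σ g) (-σ • ((EuclideanSpace.proj k : R3 →L[ℝ] ℝ) -
      (fderiv ℝ g (planeProj k x)).comp (planeProj k))) x :=
    (((EuclideanSpace.proj k : R3 →L[ℝ] ℝ).hasFDerivAt).sub
      (h0.comp x (planeProj k).hasFDerivAt)).const_mul (-σ)
  have h2 : ∀ i, gradient (graphDefining k σ g) x i = -σ * (EuclideanSpace.single i (1 : ℝ) k -
      fderiv ℝ g (planeProj k x) (planeProj k (EuclideanSpace.single i (1 : ℝ)))) := by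
    intro i
    have h3 : inner ℝ (gradient (graphDefining k σ g) x) (EuclideanSpace.single i (1 : ℝ)) =
        fderiv ℝ (graphDefining k σ g) x (EuclideanSpace.single i 1) := by
      rw [gradient, InnerProductSpace.toDual_symm_apply]
    rw [h1.fderiv, EuclideanSpace.inner_single_right] at h3
    simpa using h3
  have q1 : (EuclideanSpace.single (k + 1) (1 : ℝ) : R3) k = 0 := by fin_cases k <;> simp
  have q2 : (EuclideanSpace.single (k + 2) (1 : ℝ) : R3) k = 0 := by fin_cases k <;> simp
  have main : (fun i => ((gradient (graphDefining k σ g) x i : ℝ) : ℂ)) =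
      fun i => -σ * graphNormal k g x i := by
    refine ext_cyclic k ?_ ?_ ?_
    · simp only [h2, planeProj_single_self, graphNormal_self]; simp
    · simp only [h2, planeProj_single_add_one, q1, graphNormal_add_one, graphSlope]; simp
    · simp only [h2, planeProj_single_add_two, q2, graphNormal_add_two, graphSlope]; simp
  exact congrFun main i

/-- A chart supplies a defining function of its own, from which the normal can be computed;
uniqueness of the outward normal then identifies it with `outwardNormal`. -/
theorem IsGraphChart.isLocalDefiningFunction {Ω : Set R3} {k : Fin 3} {σ : ℝ} {g : R2 → ℝ}
    {V : Set R3} (h : IsGraphChart Ω k σ g V) {x : R3} (hV : x ∈ V) :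
    IsLocalDefiningFunction Ω x V (graphDefining k σ g) where
  mem_nhds := h.isOpen.mem_nhds hV
  smooth := contDiff_graphDefining h.smooth
  gradient_ne_zero h0 := by
    have := gradient_graphDefining (k := k) (σ := σ) h.smooth x k
    rw [h0, graphNormal_self] at this
    rcases h.sign with rfl | rfl <;> simp at this
  mem_iff y hy := by
    rw [h.mem_iff y hy, graphDefining, neg_mul, neg_lt_zero]

/-- In a graph chart the outward normal is a multiple of the normal of the graph. -/
theorem IsGraphChart.exists_outwardNormalC_eq {Ω : Set R3} {k : Fin 3} {σ : ℝ} {g : R2 → ℝ}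
    {V : Set R3} (h : IsGraphChart Ω k σ g V) (hΩ : IsOpen Ω) {x : R3} (hV : x ∈ V)
    (hx : x ∈ frontier Ω) : ∃ c : ℂ, outwardNormalC Ω x = c • graphNormal k g x ∧
      c * c * dot (graphNormal k g x) (graphNormal k g x) = 1 := by
  have hd := h.isLocalDefiningFunction hV
  set v := gradient (graphDefining k σ g) x with hv
  have hv0 : 0 < ‖v‖ := norm_pos_iff.mpr hd.gradient_ne_zero
  have hn : IsOutwardUnitNormal Ω x (‖v‖⁻¹ • v) := by
    refine ⟨?_, V, _, hd, ‖v‖, hv0, ?_⟩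
    · rw [norm_smul, norm_inv, norm_norm, inv_mul_cancel₀ hv0.ne']
    · rw [← hv, smul_smul, mul_inv_cancel₀ hv0.ne', one_smul]
  have hex : ∃ n, IsOutwardUnitNormal Ω x n := ⟨_, hn⟩
  have hout : outwardNormal Ω x = ‖v‖⁻¹ • v := by
    rw [outwardNormal, dif_pos hex]
    exact IsOutwardUnitNormal.unique hΩ hx hex.choose_spec hn
  have hvc : ∀ i, ((v i : ℝ) : ℂ) = -σ * graphNormal k g x i :=
    gradient_graphDefining (k := k) (σ := σ) h.smooth x
  refine ⟨(‖v‖⁻¹ : ℝ) * -σ, ?_, ?_⟩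
  · ext i
    rw [outwardNormalC]
    simp only [hout, PiLp.smul_apply, smul_eq_mul]
    rw [mul_assoc, ← hvc]
    push_cast
    rfl
  · have h1 : ∑ i, ((v i : ℝ) : ℂ) ^ 2 = ((‖v‖ ^ 2 : ℝ) : ℂ) := by
      rw [EuclideanSpace.real_norm_sq_eq]; push_cast; rfl
    have h2 : ∑ i, ((v i : ℝ) : ℂ) ^ 2 =
        (-σ : ℂ) * -σ * dot (graphNormal k g x) (graphNormal k g x) := by
      simp only [hvc, dot, Finset.mul_sum]
      exact Finset.sum_congr rfl fun i _ => by ring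
    calc _ = ((‖v‖⁻¹ : ℝ) : ℂ) * ((‖v‖⁻¹ : ℝ) : ℂ) *
          ((-σ : ℂ) * -σ * dot (graphNormal k g x) (graphNormal k g x)) := by ring
      _ = (((‖v‖⁻¹ * ‖v‖⁻¹) * ‖v‖ ^ 2 : ℝ) : ℂ) := by rw [← h2, h1]; push_cast; ring
      _ = 1 := by
        rw [sq, mul_assoc, inv_mul_cancel_left₀ hv0.ne', inv_mul_cancel₀ hv0.ne']; simp

/-- A vector orthogonal to the coordinate tangents of the graph is normal. -/
theorem IsGraphChart.exists_smul_outwardNormalC {Ω : Set R3} {k : Fin 3} {σ : ℝ} {g : R2 → ℝ}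
    {V : Set R3} (h : IsGraphChart Ω k σ g V) (hΩ : IsOpen Ω) {x : R3} (hV : x ∈ V)
    (hx : x ∈ frontier Ω) {v : C3} (h0 : v (k + 1) + graphSlope g 0 (planeProj k x, 0) * v k = 0)
    (h1 : v (k + 2) + graphSlope g 1 (planeProj k x, 0) * v k = 0) :
    ∃ c : ℂ, v = c • outwardNormalC Ω x := by
  obtain ⟨c, hc, hc1⟩ := h.exists_outwardNormalC_eq hΩ hV hx
  have hc0 : c ≠ 0 := by rintro rfl; simp at hc1
  refine ⟨v k * c⁻¹, ?_⟩
  rw [hc, smul_smul, inv_mul_cancel_right₀ hc0]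
  refine PiLp.ext (congrFun (ext_cyclic (u := v.ofLp) (v := (v k • graphNormal k g x).ofLp) k ?_ ?_ ?_))
  · simp [graphNormal_self]
  · rw [PiLp.smul_apply, graphNormal_add_one, smul_eq_mul]; linear_combination h0
  · rw [PiLp.smul_apply, graphNormal_add_two, smul_eq_mul]; linear_combination h1

/-- The tangential gradient of a function supported in a graph chart is smooth. -/
theorem IsGraphChart.exists_tangentialGrad {Ω : Set R3} {k : Fin 3} {σ : ℝ} {g : R2 → ℝ}
    {V : Set R3} (h : IsGraphChart Ω k σ g V) (hΩ : IsOpen Ω) {G : R3 → ℂ} (hG : ContDiff ℝ ∞ G)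
    (hs : tsupport G ⊆ V) : ∃ Φ : SmoothBdry Ω C3, (Φ : frontier Ω → C3) = tangentialGrad Ω G := by
  have hN := contDiff_graphNormal k h.smooth
  have hgr := contDiff_grad hG
  have hdd : ∀ {u v : R3 → C3}, ContDiff ℝ ∞ u → ContDiff ℝ ∞ v →
      ContDiff ℝ ∞ fun x => dot (u x) (v x) := fun hu hv =>
    ContDiff.sum fun j _ => (contDiff_coord hu j).mul (contDiff_coord hv j)
  -- Projection off the normal does not depend on its length, so the unnormalized `graphNormal`
  -- serves after division by `N · N = 1 + |∇g|²`. This gives a smooth extension to all of `ℝ³`, and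
  -- outside `V` both sides vanish with `grad G`.
  have hH : ContDiff ℝ ∞ fun x => grad G x -
      (dot (graphNormal k g x) (grad G x) * (dot (graphNormal k g x) (graphNormal k g x))⁻¹) •
        graphNormal k g x :=
    hgr.sub (((hdd hN hgr).mul ((hdd hN hN).inv (dot_graphNormal_self_ne_zero k g))).smul hN)
  refine ⟨restrictBdry Ω _ hH, funext fun x => ?_⟩
  change grad G x - _ = grad G x - _
  by_cases hV : (x : R3) ∈ V
  · obtain ⟨c, hc, hc1⟩ := h.exists_outwardNormalC_eq hΩ hV x.2
    rw [hc, dot_smul_left, smul_smul]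
    congr 2
    rw [← div_eq_mul_inv, div_eq_iff (dot_graphNormal_self_ne_zero k g x)]
    linear_combination (-dot (graphNormal k g x) (grad G x)) * hc1
  · have : grad G x = 0 := by
      have : fderiv ℝ G x = 0 := by
        by_contra hne
        exact hV (hs (tsupport_fderiv_subset ℝ (subset_tsupport _ hne)))
      ext j; simp [grad, partialDeriv, this]
    simp [this, dot_zero_right]

/-! ### Boundary functionals on fields in `H(curl)` -/

open scoped SchwartzMap

/-- The dual norm is an infimum of admissible constants; the bound survives the infimum after
division by `B`, and membership in `HMinusHalf` makes the set nonempty. The case `B = 0` needs only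
one admissible constant. -/
theorem norm_apply_le_of_hHalfNorm_le {Ω : Set R3} {F : Type*} [NormedAddCommGroup F]
    [NormedSpace ℂ F] {u : BdryFunctional Ω F} (hu : u ∈ HMinusHalf Ω F) {φ : SmoothBdry Ω F} {B : ℝ}
    (hB : 0 ≤ B) (h : hHalfNorm (φ : frontier Ω → F) ≤ ENNReal.ofReal B) :
    ‖u φ‖ ≤ hMinusHalfNorm u * B := by
  have h1 : ∀ C ∈ {C | IsHalfBound u C}, ‖u φ‖ ≤ C * B := by
    rintro C ⟨hC, hb⟩
    have := (hb φ).trans (mul_le_mul_right h _)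
    rw [← ofReal_norm, ← ENNReal.ofReal_mul hC] at this
    exact (ENNReal.ofReal_le_ofReal_iff (by positivity)).mp this
  rcases hB.eq_or_lt with rfl | hB
  · obtain ⟨C, hC⟩ := hu
    simpa using h1 C hC
  · rw [← div_le_iff₀ hB]
    exact le_csInf hu fun C hC => (div_le_iff₀ hB).mpr (h1 C hC)

theorem hMinusHalfNorm_le_hMinusHalfDivNorm {Ω : Set R3} (f : HMinusHalfDiv Ω) :
    hMinusHalfNorm (f : BdryFunctional Ω C3) ≤ hMinusHalfDivNorm f :=
  Real.le_sqrt_of_sq_le (le_add_of_nonneg_right (sq_nonneg _))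

theorem hMinusHalfNorm_surfaceDiv_le {Ω : Set R3} (f : HMinusHalfDiv Ω) :
    hMinusHalfNorm (surfaceDiv f) ≤ hMinusHalfDivNorm f :=
  Real.le_sqrt_of_sq_le (le_add_of_nonneg_left (sq_nonneg _))

theorem rpow_half_mul_sq {D : ℝ≥0∞} (hD : D ≠ ⊤) {X : ℝ} (hX : 0 ≤ X) :
    (D * ENNReal.ofReal (X ^ 2)) ^ (1 / 2 : ℝ) = ENNReal.ofReal (√D.toReal * X) := by
  rw [← ENNReal.ofReal_toReal hD, ← ENNReal.ofReal_mul ENNReal.toReal_nonneg,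
    ENNReal.ofReal_rpow_of_nonneg (by positivity) (by norm_num), ← Real.sqrt_eq_rpow,
    Real.sqrt_mul ENNReal.toReal_nonneg, Real.sqrt_sq hX, ENNReal.toReal_ofReal ENNReal.toReal_nonneg]

theorem lintegral_enorm_sq_eq_toL2 {Ω : Set R3} (hb : Bornology.IsBounded Ω) {Φ : R3 → C3}
    (hΦ : Continuous Φ) : ∫⁻ x in Ω, ‖Φ x‖ₑ ^ 2 = ENNReal.ofReal (‖toL2 hb Φ hΦ‖ ^ 2) := by
  rw [toL2, Lp.norm_toLp, ENNReal.ofReal_pow ENNReal.toReal_nonneg,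
    ENNReal.ofReal_toReal (memLp_of_continuous hb hΦ 2).2.ne,
    eLpNorm_eq_lintegral_rpow_enorm_toReal (by norm_num) (by norm_num), ← ENNReal.rpow_natCast,
    ← ENNReal.rpow_mul]
  simp

theorem grad_mul {a b : R3 → ℂ} (ha : ContDiff ℝ ∞ a) (hb : ContDiff ℝ ∞ b) (x : R3) :
    grad (fun x => a x * b x) x = a x • grad b x + b x • grad a x := by
  have := ((ha.differentiable (by simp) x).hasFDerivAt.mul
    (hb.differentiable (by simp) x).hasFDerivAt).fderiv
  ext j
  exact congrArg (fun T : R3 →L[ℝ] ℂ => T (EuclideanSpace.single j 1)) this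

theorem grad_comp_planeProj {p : R2 → ℂ} (hp : ContDiff ℝ ∞ p) (k : Fin 3) (x : R3) (j : Fin 3) :
    grad (fun x => p (planeProj k x)) x j =
      fderiv ℝ p (planeProj k x) (planeProj k (EuclideanSpace.single j 1)) := by
  have h0 : HasFDerivAt p (fderiv ℝ p (planeProj k x)) (planeProj k x) :=
    (hp.differentiable (by simp) _).hasFDerivAt
  exact congrArg (fun T : R3 →L[ℝ] ℂ => T (EuclideanSpace.single j 1))
    (h0.comp x (planeProj k).hasFDerivAt).fderiv

/-- The energy of a field is controlled under multiplication by a cutoff. -/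
theorem exists_energy_smul_le {Ω : Set R3} (hb : Bornology.IsBounded Ω) {χ : R3 → ℂ}
    (hχ : ContDiff ℝ ∞ χ) (hc : HasCompactSupport χ) : ∃ B : ℝ, 0 ≤ B ∧ ∀ (Φ : R3 → C3)
      (hΦ : ContDiff ℝ ∞ Φ), ∫⁻ x in Ω, (‖χ x • Φ x‖ₑ ^ 2 +
        ‖classicalCurl (fun x => χ x • Φ x) x‖ₑ ^ 2) ≤ ENNReal.ofReal ((B *
        (‖toL2 hb Φ hΦ.continuous‖ + ‖toL2 hb _ (contDiff_classicalCurl hΦ).continuous‖)) ^ 2) := by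
  obtain ⟨M, hM⟩ := hc.exists_bound_of_continuous hχ.continuous
  obtain ⟨M', hM'⟩ := (hasCompactSupport_grad hc).exists_bound_of_continuous (contDiff_grad hχ).continuous
  have hM0 : 0 ≤ M := (norm_nonneg _).trans (hM 0)
  have hM0' : 0 ≤ M' := (norm_nonneg _).trans (hM' 0)
  -- The 6 is the constant of `norm_cross_le`. Both the field and its curl are bounded by `A` times
  -- the sum of the norms; adding the two squares gives `4A²`, whence the constant `2 * A`.
  set A := M + 6 * M' with hA
  have hA0 : 0 ≤ A := by positivity
  refine ⟨2 * A, by positivity, fun Φ hΦ => ?_⟩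
  have hC := (contDiff_classicalCurl hΦ).continuous
  have hpt : ∀ x, ‖χ x • Φ x‖ₑ ^ 2 + ‖classicalCurl (fun x => χ x • Φ x) x‖ₑ ^ 2 ≤
      ENNReal.ofReal ((2 * A) ^ 2) * (‖Φ x‖ₑ ^ 2 + ‖classicalCurl Φ x‖ₑ ^ 2) := by
    intro x
    rw [classicalCurl_smul hχ hΦ]
    simp only [← ofReal_norm, ← ENNReal.ofReal_pow (norm_nonneg _)]
    rw [← ENNReal.ofReal_add (by positivity) (by positivity),
      ← ENNReal.ofReal_add (by positivity) (by positivity), ← ENNReal.ofReal_mul (by positivity)]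
    refine ENNReal.ofReal_le_ofReal ?_
    have n1 := norm_nonneg (Φ x)
    have n2 := norm_nonneg (classicalCurl Φ x)
    have h1 : ‖χ x • Φ x‖ ≤ A * (‖Φ x‖ + ‖classicalCurl Φ x‖) := by
      rw [norm_smul]
      have := mul_le_mul_of_nonneg_right (hM x) n1
      have := mul_nonneg hM0 n2
      have := mul_nonneg hM0' n1
      have := mul_nonneg hM0' n2
      rw [hA]; nlinarith
    have h2 : ‖χ x • classicalCurl Φ x + cross (grad χ x) (Φ x)‖ ≤
        A * (‖Φ x‖ + ‖classicalCurl Φ x‖) := by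
      refine (norm_add_le _ _).trans ((add_le_add le_rfl (norm_cross_le _ _)).trans ?_)
      rw [norm_smul]
      have := mul_le_mul_of_nonneg_right (hM x) n2
      have := mul_le_mul_of_nonneg_right (hM' x) n1
      have := mul_nonneg hM0 n1
      have := mul_nonneg hM0' n2
      rw [hA]; nlinarith
    have h3 := pow_le_pow_left₀ (norm_nonneg _) h1 2
    have h4 := pow_le_pow_left₀ (norm_nonneg _) h2 2
    have h5 : (A * (‖Φ x‖ + ‖classicalCurl Φ x‖)) ^ 2 ≤
        2 * A ^ 2 * (‖Φ x‖ ^ 2 + ‖classicalCurl Φ x‖ ^ 2) := by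
      nlinarith [mul_nonneg (sq_nonneg A) (sq_nonneg (‖Φ x‖ - ‖classicalCurl Φ x‖))]
    nlinarith
  refine (lintegral_mono hpt).trans ?_
  rw [lintegral_const_mul' _ _ ENNReal.ofReal_ne_top,
    lintegral_add_left (hΦ.continuous.enorm.measurable.pow_const 2),
    lintegral_enorm_sq_eq_toL2 hb hΦ.continuous, lintegral_enorm_sq_eq_toL2 hb hC,
    ← ENNReal.ofReal_add (by positivity) (by positivity), ← ENNReal.ofReal_mul (by positivity)]
  refine ENNReal.ofReal_le_ofReal ?_
  rw [mul_pow (2 * A)]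
  refine mul_le_mul_of_nonneg_left ?_ (by positivity)
  nlinarith [norm_nonneg (toL2 hb Φ hΦ.continuous), norm_nonneg (toL2 hb _ hC)]

theorem exists_smooth_cutoff {K V : Set R3} (hK : IsCompact K) (hV : IsOpen V) (hKV : K ⊆ V) :
    ∃ θ : R3 → ℂ, ContDiff ℝ ∞ θ ∧ HasCompactSupport θ ∧ tsupport θ ⊆ V ∧ ∀ x ∈ K, θ x = 1 := by
  obtain ⟨s, χ, -, hχ, h1⟩ := exists_smooth_partition hK (fun _ => V) fun x hx => hV.mem_nhds (hKV hx)
  have hsupp : ∀ x, x ∉ ⋃ c ∈ s, tsupport (χ c) → ∑ c ∈ s, χ c x = 0 := fun x hx =>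
    Finset.sum_eq_zero fun c hc => image_eq_zero_of_notMem_tsupport (f := χ c) fun h =>
      hx (Set.mem_biUnion (Finset.mem_coe.mpr hc) h)
  have hcomp : IsCompact (⋃ c ∈ s, tsupport (χ c)) :=
    s.isCompact_biUnion fun c hc => (hχ c hc).2.1.isCompact
  have hts : tsupport (fun x => ((∑ c ∈ s, χ c x : ℝ) : ℂ)) ⊆ ⋃ c ∈ s, tsupport (χ c) := by
    refine closure_minimal (fun x hx => ?_) hcomp.isClosed
    by_contra h
    exact hx (by simp only [hsupp x h, Complex.ofReal_zero])
  refine ⟨fun x => ((∑ c ∈ s, χ c x : ℝ) : ℂ), ?_, ?_, ?_, fun x hx => by simp only [h1 x hx, Complex.ofReal_one]⟩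
  · exact contDiff_ofReal (ContDiff.sum fun c hc => (hχ c hc).1)
  · exact hcomp.of_isClosed_subset (isClosed_tsupport _) hts
  · exact hts.trans (Set.iUnion₂_subset fun c hc => (hχ c hc).2.2)

theorem tsupport_grad_subset (θ : R3 → ℂ) : tsupport (grad θ) ⊆ tsupport θ := by
  refine closure_minimal (fun x hx => ?_) (isClosed_tsupport θ)
  by_contra hne
  refine hx ?_
  have : fderiv ℝ θ x = 0 := by
    by_contra hne'
    exact hne (tsupport_fderiv_subset ℝ (subset_tsupport _ hne'))
  ext j; simp [grad, partialDeriv, this]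

/-- A field supported in a graph chart, with tangential components `ψⱼ + ∂ⱼ p`, is on the boundary
the sum of the fields `θ ψⱼ eⱼ`, a gradient, a multiple of `∇θ` and a normal field. -/
theorem IsGraphChart.apply_eq {Ω : Set R3} {k : Fin 3} {σ : ℝ} {g : R2 → ℝ}
    {V : Set R3} (h : IsGraphChart Ω k σ g V) (hΩ : IsOpen Ω) {Ψ : R3 → C3}
    (hs : tsupport Ψ ⊆ V) {θ : R3 → ℂ} (hθ : ContDiff ℝ ∞ θ) (hsθ : tsupport θ ⊆ V)
    (hone : ∀ x, θ x • Ψ x = Ψ x) {p ψ₀ ψ₁ : R2 → ℂ} (hp : ContDiff ℝ ∞ p)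
    (e₀ : ∀ y, pullZero k σ g Ψ (y, 0) = ψ₀ y + fderiv ℝ p y (e2 0))
    (e₁ : ∀ y, pullOne k σ g Ψ (y, 0) = ψ₁ y + fderiv ℝ p y (e2 1))
    {Ψr F₁ F₂ F₄ : SmoothBdry Ω C3} {G : SmoothBdry Ω ℂ}
    (hΨr : ∀ x, (Ψr : frontier Ω → C3) x = Ψ x)
    (hF₁ : ∀ x : frontier Ω, (F₁ : frontier Ω → C3) x =
      ψ₀ (planeProj k x) • θ x • EuclideanSpace.single (k + 1) 1)
    (hF₂ : ∀ x : frontier Ω, (F₂ : frontier Ω → C3) x =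
      ψ₁ (planeProj k x) • θ x • EuclideanSpace.single (k + 2) 1)
    (hF₄ : ∀ x : frontier Ω, (F₄ : frontier Ω → C3) x = p (planeProj k x) • grad θ x)
    (hG : ∀ x : frontier Ω, (G : frontier Ω → ℂ) x = p (planeProj k x) • θ x)
    (f : HMinusHalfDiv Ω) : (f : BdryFunctional Ω C3) Ψr = (f : BdryFunctional Ω C3) F₁ +
      (f : BdryFunctional Ω C3) F₂ - surfaceDiv f G - (f : BdryFunctional Ω C3) F₄ := by
  have hP : ContDiff ℝ ∞ fun x : R3 => p (planeProj k x) := hp.comp (planeProj k).contDiff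
  have hGs : ContDiff ℝ ∞ fun x : R3 => p (planeProj k x) * θ x := hP.mul hθ
  have hGr : restrictBdry Ω _ hGs = G := Subtype.ext (funext fun x => (hG x).symm)
  obtain ⟨T, hT⟩ := h.exists_tangentialGrad hΩ hGs
    ((tsupport_mul_subset_right (f := fun x : R3 => p (planeProj k x)) (g := θ)).trans hsθ)
  obtain ⟨-, hft, -⟩ := f.2
  obtain ⟨-, hds⟩ := f.2.2.2.choose_spec
  have hdiv : surfaceDiv f G = -(f : BdryFunctional Ω C3) T := by
    rw [← hGr]; exact hds _ hGs T hT
  -- Since `∇(pθ) = θ∇p + p∇θ`, the term `F₄` compensates the derivative falling on the cutoff. What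
  -- is left is a normal field, which the tangential functional `f` annihilates.
  have hzero : (f : BdryFunctional Ω C3) (Ψr - F₁ - F₂ - T + F₄) = 0 := by
    refine hft _ fun x => ?_
    set y := planeProj k (x : R3) with hy
    -- Where `x ∈ V`, the tangential components of `v` along the graph are `θ` times the two
    -- decomposition identities, because `θΨ = Ψ`; hence they vanish and `v` is normal.
    set v : C3 := Ψ x - θ x • (ψ₀ y • (EuclideanSpace.single (k + 1) 1 : C3) +
      ψ₁ y • (EuclideanSpace.single (k + 2) 1 : C3) + grad (fun x => p (planeProj k x)) x) with hv
    have hval : ((Ψr - F₁ - F₂ - T + F₄ : SmoothBdry Ω C3) : frontier Ω → C3) x =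
        v + dot (outwardNormalC Ω x) (grad (fun x => p (planeProj k x) * θ x) x) •
          outwardNormalC Ω x := by
      have hTx : (T : frontier Ω → C3) x = grad (fun x => p (planeProj k x) * θ x) x -
        dot (outwardNormalC Ω x) (grad (fun x => p (planeProj k x) * θ x) x) • outwardNormalC Ω x := by
        rw [hT]; rfl
      have e : ((Ψr - F₁ - F₂ - T + F₄ : SmoothBdry Ω C3) : frontier Ω → C3) x =
        (Ψr : frontier Ω → C3) x - (F₁ : frontier Ω → C3) x - (F₂ : frontier Ω → C3) x -
          (T : frontier Ω → C3) x + (F₄ : frontier Ω → C3) x := rfl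
      rw [e, hTx, hΨr, hF₁, hF₂, hF₄]
      generalize dot (outwardNormalC Ω x) (grad (fun x => p (planeProj k x) * θ x) x) = z
      rw [grad_mul hP hθ, hv]
      module
    suffices hn : ∃ c : ℂ, v = c • outwardNormalC Ω x by
      obtain ⟨c, hc⟩ := hn
      exact ⟨c + dot (outwardNormalC Ω x) (grad (fun x => p (planeProj k x) * θ x) x), by
        rw [hval, hc, add_smul]⟩
    by_cases hV : (x : R3) ∈ V
    · have hone' : ∀ i, θ (x : R3) * Ψ x i = Ψ x i := fun i => congrArg (fun v : C3 => v i) (hone x)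
      have hchart : chartMap k σ g (y, 0) = x := by
        rw [chartMap]
        simpa using h.axisLift_graph hΩ hV x.2
      have s1 : (EuclideanSpace.single (k + 1) (1 : ℂ) : C3) k = 0 := by fin_cases k <;> simp
      have s2 : (EuclideanSpace.single (k + 2) (1 : ℂ) : C3) k = 0 := by fin_cases k <;> simp
      have s3 : (EuclideanSpace.single (k + 1) (1 : ℂ) : C3) (k + 2) = 0 := by fin_cases k <;> simp
      have s4 : (EuclideanSpace.single (k + 2) (1 : ℂ) : C3) (k + 1) = 0 := by fin_cases k <;> simp
      have s5 : ∀ i : Fin 3, (EuclideanSpace.single i (1 : ℂ) : C3) i = 1 := fun i => by simp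
      have z0 := e₀ y
      have z1 := e₁ y
      rw [pullZero, hchart] at z0
      rw [pullOne, hchart] at z1
      have g0 := grad_comp_planeProj hp k x
      refine h.exists_smul_outwardNormalC hΩ hV x.2 ?_ ?_
      · simp only [hv, PiLp.sub_apply, PiLp.smul_apply, PiLp.add_apply, smul_eq_mul, g0, s1, s2, s4, s5,
          planeProj_single_self, planeProj_single_add_one, map_zero, ← hy] at z0 ⊢
        linear_combination θ (x : R3) * z0 -
          hone' (k + 1) - graphSlope g 0 (y, 0) * hone' k
      · simp only [hv, PiLp.sub_apply, PiLp.smul_apply, PiLp.add_apply, smul_eq_mul, g0, s1, s2, s3, s5,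
          planeProj_single_self, planeProj_single_add_two, map_zero, ← hy] at z1 ⊢
        linear_combination θ (x : R3) * z1 -
          hone' (k + 2) - graphSlope g 1 (y, 0) * hone' k
    · refine ⟨0, ?_⟩
      have h1 : Ψ (x : R3) = 0 := image_eq_zero_of_notMem_tsupport fun hx => hV (hs hx)
      have h2 : θ (x : R3) = 0 := image_eq_zero_of_notMem_tsupport fun hx => hV (hsθ hx)
      simp [hv, h1, h2]
  simp only [map_add, map_sub] at hzero
  rw [hdiv]
  linear_combination hzero

/-- Boundary functionals in `H^{-1/2}(div)` are controlled by the `H(curl)` norm of test fields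
supported in a graph chart. -/
theorem IsGraphChart.exists_bound {Ω : Set R3} {k : Fin 3} {σ : ℝ} {g : R2 → ℝ}
    {V : Set R3} (h : IsGraphChart Ω k σ g V) (hΩ : IsSmoothBoundedDomain Ω) {χ : R3 → ℂ}
    (hχ : ContDiff ℝ ∞ χ) (hc : HasCompactSupport χ) (hs : tsupport χ ⊆ V) : ∃ C : ℝ, 0 ≤ C ∧
    ∀ (f : HMinusHalfDiv Ω) (Φ : R3 → C3) (hΦ : ContDiff ℝ ∞ Φ),
      ‖(f : BdryFunctional Ω C3) (restrictBdry Ω (fun x => χ x • Φ x) (hχ.smul hΦ))‖ ≤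
        C * hMinusHalfDivNorm f * (‖toL2 hΩ.isBounded Φ hΦ.continuous‖ +
          ‖toL2 hΩ.isBounded _ (contDiff_classicalCurl hΦ).continuous‖) := by
  obtain ⟨C₀, hC₀, hdec⟩ := h.exists_decomposition hΩ.isOpen
  obtain ⟨B, hB0, hB⟩ := exists_energy_smul_le hΩ.isBounded hχ hc
  -- The Schwartz functions of the decomposition need not be supported in the chart. The second
  -- cutoff, equal to 1 on the support of `χ`, brings them back without changing the field `χΦ`.
  obtain ⟨θ, hθ, hcθ, hsθ, hθ1⟩ := exists_smooth_cutoff hc.isCompact h.isOpen hs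
  have hw : ∀ i : Fin 3, ContDiff ℝ ∞ fun x => θ x • (EuclideanSpace.single i 1 : C3) := fun i =>
    hθ.smul contDiff_const
  have hsw : ∀ i : Fin 3, tsupport (fun x => θ x • (EuclideanSpace.single i 1 : C3)) ⊆ V := fun i =>
    (tsupport_smul_subset_left θ fun _ => (EuclideanSpace.single i 1 : C3)).trans hsθ
  have hgs := tsupport_grad_subset θ
  obtain ⟨C₁, hC₁, b₁⟩ := h.exists_hHalfNorm_le hΩ (hw (k + 1)) hcθ.smul_right (hsw _)
  obtain ⟨C₂, hC₂, b₂⟩ := h.exists_hHalfNorm_le hΩ (hw (k + 2)) hcθ.smul_right (hsw _)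
  obtain ⟨C₃, hC₃, b₃⟩ := h.exists_hHalfNorm_le hΩ hθ hcθ hsθ
  obtain ⟨C₄, hC₄, b₄⟩ := h.exists_hHalfNorm_le hΩ (contDiff_grad hθ) (hasCompactSupport_grad hcθ)
    (hgs.trans hsθ)
  set Cm := C₁ + C₂ + C₃ + C₄ with hCm
  have hCmt : Cm * C₀ ≠ ⊤ := by finiteness
  set R : ℝ := √(Cm * C₀).toReal * B with hR
  have hR0 : 0 ≤ R := by positivity
  -- One `R` for each of the four terms in `IsGraphChart.apply_eq`.
  refine ⟨4 * R, by positivity, fun f Φ hΦ => ?_⟩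
  set X := ‖toL2 hΩ.isBounded Φ hΦ.continuous‖ +
    ‖toL2 hΩ.isBounded _ (contDiff_classicalCurl hΦ).continuous‖ with hX
  have hX0 : 0 ≤ X := by positivity
  have hcΦ : HasCompactSupport fun x => χ x • Φ x := hc.smul_right
  obtain ⟨p, ψ₀, ψ₁, e₀, e₁, hq⟩ := hdec (fun x => χ x • Φ x) (hχ.smul hΦ) hcΦ
    ((tsupport_smul_subset_left χ Φ).trans hs)
  have bd : ∀ {Ci : ℝ≥0∞} {q : 𝓢(R2, ℂ)}, Ci ≤ Cm → q ∈ ({p, ψ₀, ψ₁} : Set 𝓢(R2, ℂ)) →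
      (Ci * planeNorm q) ^ (1 / 2 : ℝ) ≤ ENNReal.ofReal (R * X) := by
    intro Ci q hCi hqm
    have e : R * X = √(Cm * C₀).toReal * (B * X) := by rw [hR]; ring
    rw [e, ← rpow_half_mul_sq hCmt (by positivity)]
    refine ENNReal.rpow_le_rpow ?_ (by norm_num)
    rw [mul_assoc]
    exact mul_le_mul' hCi ((hq q hqm).trans (mul_le_mul_right (hB Φ hΦ) _))
  have c₁ : C₁ ≤ Cm := by rw [hCm, add_assoc, add_assoc]; exact le_self_add
  have c₂ : C₂ ≤ Cm := by
    rw [hCm, add_assoc, add_assoc, add_left_comm]; exact le_self_add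
  have c₃ : C₃ ≤ Cm := by rw [hCm, add_right_comm]; exact le_add_self
  have c₄ : C₄ ≤ Cm := le_add_self
  have hP : ∀ q : 𝓢(R2, ℂ), ContDiff ℝ ∞ fun x : R3 => q (planeProj k x) := fun q =>
    (q.smooth ⊤).comp (planeProj k).contDiff
  have hone : ∀ x, θ x • χ x • Φ x = χ x • Φ x := fun x => by
    by_cases hne : χ x = 0
    · simp [hne]
    · rw [hθ1 _ (subset_tsupport _ hne), one_smul]
  obtain ⟨F₁, hF₁⟩ : ∃ F : SmoothBdry Ω C3, (F : frontier Ω → C3) = fun x : frontier Ω =>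
      ψ₀ (planeProj k x) • θ x • EuclideanSpace.single (k + 1) 1 :=
    ⟨restrictBdry Ω _ ((hP ψ₀).smul (hw (k + 1))), rfl⟩
  obtain ⟨F₂, hF₂⟩ : ∃ F : SmoothBdry Ω C3, (F : frontier Ω → C3) = fun x : frontier Ω =>
      ψ₁ (planeProj k x) • θ x • EuclideanSpace.single (k + 2) 1 :=
    ⟨restrictBdry Ω _ ((hP ψ₁).smul (hw (k + 2))), rfl⟩
  obtain ⟨F₄, hF₄⟩ : ∃ F : SmoothBdry Ω C3, (F : frontier Ω → C3) = fun x : frontier Ω =>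
      p (planeProj k x) • grad θ x :=
    ⟨restrictBdry Ω _ ((hP p).smul (contDiff_grad hθ)), rfl⟩
  obtain ⟨G, hG⟩ : ∃ G : SmoothBdry Ω ℂ, (G : frontier Ω → ℂ) = fun x : frontier Ω =>
      p (planeProj k x) • θ x := ⟨restrictBdry Ω _ ((hP p).smul hθ), rfl⟩
  have heq := h.apply_eq hΩ.isOpen ((tsupport_smul_subset_left χ Φ).trans hs) hθ hsθ
    hone (p.smooth ⊤) e₀ e₁
    (Ψr := restrictBdry Ω (fun x => χ x • Φ x) (hχ.smul hΦ)) (fun _ => rfl)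
    (congrFun hF₁) (congrFun hF₂) (congrFun hF₄) (congrFun hG) f
  have hfm := f.2.1
  have hdm := f.2.2.2.choose_spec.1
  have hN := hMinusHalfNorm_le_hMinusHalfDivNorm f
  have hN' := hMinusHalfNorm_surfaceDiv_le f
  have hRX : 0 ≤ R * X := by positivity
  have t₁ : ‖(f : BdryFunctional Ω C3) F₁‖ ≤ hMinusHalfDivNorm f * (R * X) :=
    (norm_apply_le_of_hHalfNorm_le hfm hRX ((hF₁ ▸ b₁ _ ψ₀.continuous).trans (bd c₁ (by simp)))).trans
      (mul_le_mul_of_nonneg_right hN hRX)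
  have t₂ : ‖(f : BdryFunctional Ω C3) F₂‖ ≤ hMinusHalfDivNorm f * (R * X) :=
    (norm_apply_le_of_hHalfNorm_le hfm hRX ((hF₂ ▸ b₂ _ ψ₁.continuous).trans (bd c₂ (by simp)))).trans
      (mul_le_mul_of_nonneg_right hN hRX)
  have t₃ : ‖surfaceDiv f G‖ ≤ hMinusHalfDivNorm f * (R * X) :=
    (norm_apply_le_of_hHalfNorm_le hdm hRX ((hG ▸ b₃ _ p.continuous).trans (bd c₃ (by simp)))).trans
      (mul_le_mul_of_nonneg_right hN' hRX)
  have t₄ : ‖(f : BdryFunctional Ω C3) F₄‖ ≤ hMinusHalfDivNorm f * (R * X) :=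
    (norm_apply_le_of_hHalfNorm_le hfm hRX ((hF₄ ▸ b₄ _ p.continuous).trans (bd c₄ (by simp)))).trans
      (mul_le_mul_of_nonneg_right hN hRX)
  rw [heq]
  calc _ ≤ ‖(f : BdryFunctional Ω C3) F₁‖ + ‖(f : BdryFunctional Ω C3) F₂‖ + ‖surfaceDiv f G‖ +
        ‖(f : BdryFunctional Ω C3) F₄‖ :=
        (norm_sub_le _ _).trans (add_le_add_left ((norm_sub_le _ _).trans
          (add_le_add_left (norm_add_le _ _) _)) _)
    _ ≤ 4 * (hMinusHalfDivNorm f * (R * X)) := by linarith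
    _ = _ := by ring

/-- Every boundary datum in `H^{-1/2}(div)` is the tangential trace of a field in `H(curl)`,
with a bound. -/
theorem hasTangentialLifting {Ω : Set R3} (hΩ : IsSmoothBoundedDomain Ω) : HasTangentialLifting Ω := by
  have hcomp : IsCompact (frontier Ω) :=
    hΩ.isBounded.isCompact_closure.of_isClosed_subset isClosed_frontier frontier_subset_closure
  have hch : ∀ x ∈ frontier Ω, ∃ k σ g V, IsGraphChart Ω k σ g V ∧ x ∈ V := fun x hx =>
    exists_isGraphChart hΩ hx
  choose! k σ g V hV hxV using hch
  obtain ⟨s, χ, hsK, hχ, h1⟩ := exists_smooth_partition hcomp V fun x hx =>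
    (hV x hx).isOpen.mem_nhds (hxV x hx)
  have hsupp : ∀ c, tsupport (fun x => (χ c x : ℂ)) ⊆ tsupport (χ c) := fun c =>
    closure_mono fun x hx h0 => hx (by simp [h0])
  have hbd : ∀ c (hc : c ∈ s), ∃ C : ℝ, 0 ≤ C ∧
      ∀ (f : HMinusHalfDiv Ω) (Φ : R3 → C3) (hΦ : ContDiff ℝ ∞ Φ),
      ‖(f : BdryFunctional Ω C3) (restrictBdry Ω (fun x => (χ c x : ℂ) • Φ x)
        ((contDiff_ofReal (hχ c hc).1).smul hΦ))‖ ≤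
        C * hMinusHalfDivNorm f * (‖toL2 hΩ.isBounded Φ hΦ.continuous‖ +
          ‖toL2 hΩ.isBounded _ (contDiff_classicalCurl hΦ).continuous‖) := fun c hc =>
    (hV c (hsK c hc)).exists_bound hΩ (contDiff_ofReal (hχ c hc).1)
      ((hχ c hc).2.1.of_isClosed_subset (isClosed_tsupport _) (hsupp c))
      ((hsupp c).trans (hχ c hc).2.2)
  choose! C hC0 hC using hbd
  refine hasTangentialLifting_of_bound hΩ.isOpen hΩ.isBounded
    (Finset.sum_nonneg (s := s) (f := C) hC0) fun f Φ hΦ => ?_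
  -- A boundary functional sees only boundary values, so a partition of unity on the boundary
  -- suffices even though the test field lives on `ℝ³`.
  have hsum : restrictBdry Ω Φ hΦ = ∑ c ∈ s.attach, restrictBdry Ω (fun x => (χ c x : ℂ) • Φ x)
      ((contDiff_ofReal (hχ c c.2).1).smul hΦ) := by
    apply Subtype.ext
    funext x
    rw [Submodule.coe_sum, Finset.sum_apply]
    change Φ x = ∑ c ∈ s.attach, (χ c x : ℂ) • Φ x
    rw [← Finset.sum_smul, Finset.sum_attach s (fun c => (χ c x : ℂ)), ← Complex.ofReal_sum, h1 x x.2,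
      Complex.ofReal_one, one_smul]
  rw [hsum, map_sum, Finset.sum_mul, Finset.sum_mul, ← Finset.sum_attach s]
  exact (norm_sum_le _ _).trans (Finset.sum_le_sum fun c _ => hC c c.2 f Φ hΦ)

end Maxwell

end

theorem mainTheorem5 (Ω : Set Maxwell.R3) (hΩ : Maxwell.IsSmoothBoundedDomain Ω)
    (α β ω : ℝ) (hα : 0 < α) (hαβ : α < β) (hω : 0 < ω) :
    ∃ C : ℝ, 0 < C ∧
      ∀ ε μ : Maxwell.R3 → Matrix (Fin 3) (Fin 3) ℂ,
        Maxwell.MC α β Ω ε → Maxwell.MC α β Ω μ →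
        ∀ f : Maxwell.HMinusHalfDiv Ω,
          (∃! p : Maxwell.Hcurl Ω × Maxwell.Hcurl Ω,
            Maxwell.IsMaxwellSolution ε μ ω f p.1 p.2) ∧
          ∀ E H : Maxwell.Hcurl Ω, Maxwell.IsMaxwellSolution ε μ ω f E H →
            Maxwell.hcurlNorm E + Maxwell.hcurlNorm H ≤ C * Maxwell.hMinusHalfDivNorm f := by
  exact Maxwell.maxwell_wellposed hΩ.isOpen hΩ.isBounded (Maxwell.curlPairingSymm hΩ)
    (Maxwell.hasTangentialLifting hΩ) hα hαβ hω
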